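/- Let $d\ge 1$, let $\mathbb B^d$ be the unit ball of $\mathbb C^d$ with normalised Lebesgue measure $\nu$, write $\langle f\rangle_Q=\nu(Q)^{-1}\int_Q f\,d\nu$, and let $Pf(z)=\int_{\mathbb B^d} f(\zeta)(1-z\bar\zeta)^{-(d+1)}\,d\nu(\zeta)$ be the Bergman projection. Let $\beta$ be the Bergman metric, $\beta(z,w)=\frac12\log\frac{1+|\varphi_z(w)|}{1-|\varphi_z(w)|}$ with $\varphi_z$ the biholomorphic involution of $\mathbb B^d$ exchanging $z$ and $0$; let $B(z,r)$ be its balls, $\mathbb S_r=\{z:\beta(0,z)=r\}$, and let $\pi_r$ be the radial projection onto $\mathbb S_r$ (with $\pi_0\equiv0$ and $\pi_r(0)=0$). Fix $R,\delta>0$. A *Bergman tree* is given by a constant $C_0>0$ and, for each integer $n\ge0$, finitely many points $z^n_j\in\mathbb S_{nR}$ and a partition of $\mathbb S_{nR}$ into Borel sets $\Omega^n_j$ with $B(z^n_j,\delta)\cap\mathbb S_{nR}\subseteq\Omega^n_j\subseteq B(z^n_j,C_0\delta)\cap\mathbb S_{nR}$. Its kubes are $K^n_j=\{\zeta\in B(0,(n+1)R)\setminus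 B(0,nR):\pi_{nR}(\zeta)\in\Omega^n_j\}$; the vertex $(n+1,i)$ is a child of $(n,k)$ if $\pi_{nR}(\pi_{(n+3/2)R}(z^{n+1}_i))\in\Omega^n_k$; and the dyadic tent $\hat K_\alpha$ of a vertex $\alpha$ is the union of the kubes of $\alpha$ and of all its descendants. For $z\in\mathbb B^d\setminus\{0\}$ let $T_z=\{\zeta\in\mathbb B^d:|1-\langle\zeta,z/|z|\rangle|\le1-|z|\}$ be the Carleson tent, and $T_0=\mathbb B^d$. There is a finite collection of Bergman trees (with parameters $R,\delta$) whose collection $\mathcal T$ of all dyadic tents satisfies $(\ast)$ there is a constant $c$ such that every $T_z$, $z\in\mathbb B^d$, is contained in some $\hat K\in\mathcal T$ with $\nu(\hat K)\le c\,\nu(T_z)$. Fix any finite collection of Bergman trees with property $(\ast)$, and let $\mathcal T$ be its collection of dyadic tents. A Young function is a continuous, convex, strictly increasing $\Phi:[0,\infty)\to[0,\infty)$ with $\Phi(0)=0$ and $\Phi(t)/t\to\infty$ as $t\to\infty$; put $\langle f\rangle_{\Phi,Q}=\inf\{\lambda>0:\langle\Phi(|f|/\lambda)\rangle_Q\le1\}$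 and $M_\Phi f=\sup_{\hat K\in\mathcal T}\langle f\rangle_{\Phi,\hat K}\mathbf 1_{\hat K}$. A weight is a locally integrable, a.e. positive function on $\mathbb B^d$. For weights $w,\sigma$ and Young functions $\Phi,\Psi$ let $$[w,\sigma]_{\Phi,\Psi}=\sup_{\hat K\in\mathcal T}\frac{\langle w\rangle_{\hat K}}{\langle w^{1/2}\rangle_{\Phi,\hat K}}\,\frac{\langle\sigma\rangle_{\hat K}}{\langle\sigma^{1/2}\rangle_{\Psi,\hat K}},$$ where a quotient with infinite numerator is read as $+\infty$. **Theorem.** Let $\Phi,\Psi$ be Young functions such that $M_\Phi$ and $M_\Psi$ are bounded on $L^2(\mathbb B^d,\nu)$. Then there is a constant $C>0$ such that for all weights $\sigma,w$ on $\mathbb B^d$ $$\|P(\sigma\,\cdot)\|_{L^2(\sigma)\to A^2(w)}\le C\,[w,\sigma]_{\Phi,\Psi},$$ where $A^2(w)$ is the space of holomorphic functions in $L^2(\mathbb B^d,w\,d\nu)$. In particular, if the right-hand side is finite, then for every $f\in L^2(\sigma)$ the function $\sigma f$ is $\nu$-integrable and $P(\sigma f)$, given by an absolutely convergent integral, belongs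 to $A^2(w)$. -/

import Mathlib

open MeasureTheory Filter
open scoped NNReal ENNReal

noncomputable section

namespace BergmanBump

/-- The space `ℂ^d` with its Hermitian structure. In Mathlib `inner ℂ z w` is linear in `w`, so
`inner ℂ z w` is `⟨w, z⟩ = ∑ w_i * conj z_i`. -/
abbrev E (d : ℕ) : Type := EuclideanSpace ℂ (Fin d)

/-- The open unit ball of `ℂ^d`. -/
def unitBall (d : ℕ) : Set (E d) := Metric.ball 0 1

/-- The normalised Lebesgue measure on the unit ball. -/
def nu (d : ℕ) : Measure (E d) :=
  (volume (unitBall d))⁻¹ • (volume : Measure (E d)).restrict (unitBall d)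

/-! ### The Bergman metric -/

/-- The biholomorphic involution `φ_z` of the ball exchanging `z` and the origin
(for `z = 0` the formula gives `φ_0 w = -w`). -/
def involution {d : ℕ} (z w : E d) : E d :=
  let u : E d := ((‖z‖ : ℂ)⁻¹) • z
  let p : E d := (inner ℂ u w : ℂ) • u
  (1 - inner ℂ z w : ℂ)⁻¹ • (z - p - ((Real.sqrt (1 - ‖z‖ ^ 2) : ℝ) : ℂ) • (w - p))

/-- The Bergman distance on the unit ball. -/
def bergmanDist {d : ℕ} (z w : E d) : ℝ :=
  1 / 2 * Real.log ((1 + ‖involution z w‖) / (1 - ‖involution z w‖))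

/-- The ball of centre `z` and radius `r` in the Bergman metric. -/
def bergmanBall {d : ℕ} (z : E d) (r : ℝ) : Set (E d) :=
  {w | w ∈ unitBall d ∧ bergmanDist z w < r}

/-- The sphere of radius `r` centred at the origin in the Bergman metric. -/
def bergmanSphere (d : ℕ) (r : ℝ) : Set (E d) :=
  {w | w ∈ unitBall d ∧ bergmanDist 0 w = r}

/-- The radial projection onto the Bergman sphere of radius `t`, which is the Euclidean sphere of
radius `tanh t`. -/
def radialProj {d : ℕ} (t : ℝ) (z : E d) : E d :=
  ((Real.tanh t / ‖z‖ : ℝ) : ℂ) • z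

/-! ### Bergman trees and dyadic tents -/

/-- The data of a Bergman tree with parameters `R` and `δ`: for each level `n`, finitely many
points on the Bergman sphere of radius `n R` and a partition of that sphere into Borel sets, each
comparable with the trace on the sphere of a Bergman ball of radius `δ` around its point. -/
structure BergmanTree (d : ℕ) (R δ : ℝ) where
  /-- number of pieces at each level -/
  J : ℕ → ℕ
  /-- the points `z_j^n` -/
  z : (n : ℕ) → Fin (J n) → E d
  /-- the pieces `Ω_j^n` -/
  Ω : (n : ℕ) → Fin (J n) → Set (E d)
  z_mem : ∀ (n : ℕ) (j : Fin (J n)), z n j ∈ bergmanSphere d (n * R)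
  measurableSet_Ω : ∀ (n : ℕ) (j : Fin (J n)), MeasurableSet (Ω n j)
  disjoint_Ω : ∀ n : ℕ, Pairwise fun i j => Disjoint (Ω n i) (Ω n j)
  iUnion_Ω : ∀ n : ℕ, (⋃ j, Ω n j) = bergmanSphere d (n * R)
  ball_subset_Ω : ∀ (n : ℕ) (j : Fin (J n)), bergmanBall (z n j) δ ∩ bergmanSphere d (n * R) ⊆ Ω n j
  Ω_subset_ball : ∃ C : ℝ, 0 < C ∧
    ∀ (n : ℕ) (j : Fin (J n)), Ω n j ⊆ bergmanBall (z n j) (C * δ) ∩ bergmanSphere d (n * R)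

namespace BergmanTree

variable {d : ℕ} {R δ : ℝ}

/-- The vertices of the tree. -/
def Vertex (T : BergmanTree d R δ) : Type := Σ n : ℕ, Fin (T.J n)

/-- The kube `K_j^n`. For `n = 0` this is the Bergman ball `B(0, R)`, because `B(0, 0)` is empty
and the projection onto the sphere of radius `0` is constant equal to `0`. -/
def kube (T : BergmanTree d R δ) (a : T.Vertex) : Set (E d) :=
  {ζ | ζ ∈ bergmanBall 0 ((a.1 + 1 : ℝ) * R) \ bergmanBall 0 ((a.1 : ℝ) * R) ∧
    radialProj ((a.1 : ℝ) * R) ζ ∈ T.Ω a.1 a.2}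

/-- The centre `c_j^n` of the kube `K_j^n`. -/
def center (T : BergmanTree d R δ) (a : T.Vertex) : E d :=
  radialProj (((a.1 : ℝ) + 1 / 2) * R) (T.z a.1 a.2)

/-- `b` is a child of `a`. -/
def IsChild (T : BergmanTree d R δ) (a b : T.Vertex) : Prop :=
  b.1 = a.1 + 1 ∧ radialProj ((a.1 : ℝ) * R) (T.center b) ∈ T.Ω a.1 a.2

/-- The dyadic tent over the vertex `a`: the union of the kubes of all descendants of `a`
(`a` included). -/
def tent (T : BergmanTree d R δ) (a : T.Vertex) : Set (E d) :=
  ⋃ (b : T.Vertex) (_ : Relation.ReflTransGen T.IsChild a b), T.kube b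

end BergmanTree

/-- The collection of all dyadic tents of a family of Bergman trees. -/
def tents {d : ℕ} {R δ : ℝ} {N : ℕ} (T : Fin N → BergmanTree d R δ) : Set (Set (E d)) :=
  {Q | ∃ (l : Fin N) (a : (T l).Vertex), Q = (T l).tent a}

open Classical in
/-- The Carleson tent `T_z`; it is the whole ball for `z = 0`. -/
def carlesonTent {d : ℕ} (z : E d) : Set (E d) :=
  if z = 0 then unitBall d
  else {ζ | ζ ∈ unitBall d ∧ ‖(1 - inner ℂ (((‖z‖ : ℂ)⁻¹) • z) ζ : ℂ)‖ ≤ 1 - ‖z‖}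

/-- A collection `𝒯` of sets approximates Carleson tents if every Carleson tent is contained in
a member of `𝒯` of comparable volume. -/
def ApproximatesCarlesonTents {d : ℕ} (𝒯 : Set (Set (E d))) : Prop :=
  ∃ c : ℝ≥0, ∀ z ∈ unitBall d, ∃ Q ∈ 𝒯, carlesonTent z ⊆ Q ∧ nu d Q ≤ c * nu d (carlesonTent z)

/-! ### Weights, Young functions and Orlicz averages -/

/-- A weight on the ball: a locally integrable function that is positive almost everywhere. -/
structure IsWeight {d : ℕ} (w : E d → ℝ≥0) : Prop where
  locallyIntegrable : LocallyIntegrableOn (fun z => (w z : ℝ)) (unitBall d) volume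
  pos : ∀ᵐ z ∂(nu d), 0 < w z

/-- Young functions. -/
structure IsYoung (Φ : ℝ≥0 → ℝ≥0) : Prop where
  continuous : Continuous Φ
  convex : ConvexOn ℝ≥0 Set.univ Φ
  strictMono : StrictMono Φ
  map_zero : Φ 0 = 0
  superlinear : Tendsto (fun t => Φ t / t) atTop atTop

/-- The average `⟨f⟩_Q` of a non-negative function. -/
def avg {d : ℕ} (Q : Set (E d)) (f : E d → ℝ≥0) : ℝ≥0∞ :=
  (nu d Q)⁻¹ * ∫⁻ z in Q, (f z : ℝ≥0∞) ∂(nu d)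

/-- The Orlicz average `⟨f⟩_{Φ,Q}` (Luxembourg norm) of a non-negative function. -/
def orliczAvg {d : ℕ} (Φ : ℝ≥0 → ℝ≥0) (Q : Set (E d)) (f : E d → ℝ≥0) : ℝ≥0∞ :=
  ⨅ (l : ℝ≥0) (_ : 0 < l ∧ avg Q (fun z => Φ (f z / l)) ≤ 1), (l : ℝ≥0∞)

/-- The Orlicz maximal function over the collection `𝒯`. -/
def orliczMaximal {d : ℕ} (Φ : ℝ≥0 → ℝ≥0) (𝒯 : Set (Set (E d))) (f : E d → ℂ) : E d → ℝ≥0∞ :=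
  fun z => ⨆ Q ∈ 𝒯, Q.indicator (fun _ => orliczAvg Φ Q fun ζ => ‖f ζ‖₊) z

/-- The Orlicz maximal operator over `𝒯` is bounded on `L²` of the ball. -/
def MaximalBounded {d : ℕ} (Φ : ℝ≥0 → ℝ≥0) (𝒯 : Set (Set (E d))) : Prop :=
  ∃ A : ℝ≥0, ∀ f : E d → ℂ, MemLp f 2 (nu d) →
    eLpNorm (orliczMaximal Φ 𝒯 f) 2 (nu d) ≤ A * eLpNorm f 2 (nu d)

/-- The quotient `⟨w⟩_Q / ⟨w^{1/2}⟩_{Φ,Q}`, equal to `∞` if `w` is not integrable on `Q`. -/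
def bumpQuotient {d : ℕ} (Φ : ℝ≥0 → ℝ≥0) (Q : Set (E d)) (w : E d → ℝ≥0) : ℝ≥0∞ :=
  if avg Q w = ∞ then ∞ else avg Q w / orliczAvg Φ Q fun z => NNReal.sqrt (w z)

/-- The joint Orlicz bump `[w, σ]_{Φ,Ψ}` over the collection `𝒯`. -/
def bump {d : ℕ} (𝒯 : Set (Set (E d))) (Φ Ψ : ℝ≥0 → ℝ≥0) (w σ : E d → ℝ≥0) : ℝ≥0∞ :=
  ⨆ Q ∈ 𝒯, bumpQuotient Φ Q w * bumpQuotient Ψ Q σ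

/-! ### The Bergman projection -/

/-- The measure `w dν`. -/
def weighted {d : ℕ} (w : E d → ℝ≥0) : Measure (E d) :=
  (nu d).withDensity fun z => (w z : ℝ≥0∞)

/-- The Bergman projection `P f (z) = ∫ f(ζ) / (1 - z ζ̄)^(d+1) dν(ζ)`. -/
def bergmanProj {d : ℕ} (f : E d → ℂ) (z : E d) : ℂ :=
  ∫ ζ, f ζ / (1 - inner ℂ ζ z) ^ (d + 1) ∂(nu d)

/-- Membership in the weighted Bergman space `A²(w)`. -/
def MemBergman {d : ℕ} (w : E d → ℝ≥0) (F : E d → ℂ) : Prop :=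
  DifferentiableOn ℂ F (unitBall d) ∧ MemLp F 2 (weighted w)

/-- `P(σ ·)` is defined on all of `L²(σ)` by absolutely convergent integrals, takes values in
`A²(w)`, and is bounded with constant `A`. -/
def BoundedBy {d : ℕ} (σ w : E d → ℝ≥0) (A : ℝ≥0) : Prop :=
  ∀ f : E d → ℂ, MemLp f 2 (weighted σ) →
    Integrable (fun ζ => (σ ζ : ℂ) * f ζ) (nu d) ∧
    MemBergman w (bergmanProj fun ζ => (σ ζ : ℂ) * f ζ) ∧
    eLpNorm (bergmanProj fun ζ => (σ ζ : ℂ) * f ζ) 2 (weighted w) ≤ A * eLpNorm f 2 (weighted σ)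

/-- The operator norm of `P(σ ·) : L²(σ) → A²(w)`; it is `∞` if `P(σ ·)` is not a bounded
operator between these spaces. -/
def opNorm {d : ℕ} (σ w : E d → ℝ≥0) : ℝ≥0∞ :=
  ⨅ (A : ℝ≥0) (_ : BoundedBy σ w A), (A : ℝ≥0∞)

end BergmanBump

end

/-!
Any two points `z, ζ` of the ball lie in a common Carleson tent of size comparable to
`|1 - ⟨z, ζ⟩|`, hence in a dyadic tent `Q` with
`|1 - ⟨z, ζ⟩|^{-(d+1)} ≤ C ν(Q)⁻¹`. The Bergman projection is therefore dominated pointwise by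
the positive operator `F ↦ ∑_Q 1_Q ν(Q)⁻¹ ∫_Q F`, summed over all dyadic tents
(`exists_kernel_le`, `exists_lintegral_kernel_le`).

The bilinear form of that operator on `L²(σ) × L²(w)` is
`∑_Q ⟨σ⟩_Q ⟨w⟩_Q (E^σ_Q f) (E^w_Q g) ν(Q)`, where `E^μ_Q` is the average with respect to `μ dν`.
The bump condition replaces `⟨σ⟩_Q ⟨w⟩_Q` by `[w, σ] ⟨σ^{1/2}⟩_{Ψ,Q} ⟨w^{1/2}⟩_{Φ,Q}`. After
Cauchy--Schwarz it remains to bound `∑_Q ⟨σ^{1/2}⟩²_{Ψ,Q} ν(Q) (E^σ_Q f)²` by `∫ f² σ`, and likewise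
for `w` and `Φ` (`exists_tsum_orliczAvg_le`). By the Carleson embedding theorem on the tree, proved
with a Bellman function (`treeSum_le_bellman`), this needs only the Carleson condition
`∑_{Q' ⊆ Q} ⟨σ^{1/2}⟩²_{Ψ,Q'} ν(Q') ≤ C σ(Q)`. The kubes are pairwise disjoint and fill a fixed
proportion of their tents (`exists_nu_tent_le_nu_kube`), so the left-hand side is at most a multiple
of `∫_Q M_Ψ(σ^{1/2} 1_Q)² dν`, which the boundedness of `M_Ψ` on `L²` controls by `σ(Q)`.
Some dyadic tent is the whole ball, so a finite bump makes `σ` and `w` integrable; this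
gives the absolute convergence of `P(σ f)` and its holomorphy (`exists_boundedBy`).

The existence of trees whose tents approximate the Carleson tents is a statement about the
nonisotropic metric `|1 - ⟨ξ, η⟩|^{1/2}` of the unit sphere. This metric is doubling, so at each scale
a bounded number of partitions suffices for every ball of that scale to lie in a cell of one of them
(`exists_adjacent_partitions`). One partition is used at `M` consecutive levels, with `e^{MR}` large
compared with `cosh δ`. The next scale is then much smaller, so the total drift of the unit vectors
along a branch of the tree does not leave the cell around the vertex of the Carleson tent
(`exists_ancestor_of_rho_lt`).
-/

namespace BergmanBump

variable {d : ℕ}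

/-! ### Geometry of the Bergman metric and of the nonisotropic metric -/

theorem norm_smul_add_sq {x v : E d} (hx : ‖x‖ = 1) (hv : inner ℂ x v = 0) (a : ℂ) :
    ‖a • x + v‖ ^ 2 = ‖a‖ ^ 2 + ‖v‖ ^ 2 := by
  rw [norm_add_sq (𝕜 := ℂ), inner_smul_left, hv, mul_zero, norm_smul, hx]
  simp

/-- `v - ⟨v, x⟩ x` is the component of `v` orthogonal to the unit vector `x`. -/
theorem inner_sub_inner_smul {x : E d} (hx : ‖x‖ = 1) (v : E d) :
    inner ℂ x (v - (inner ℂ x v : ℂ) • x) = 0 := by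
  rw [inner_sub_right, inner_smul_right, inner_self_eq_norm_sq_to_K, hx]
  simp

theorem norm_sq_eq_inner_add {x : E d} (hx : ‖x‖ = 1) (v : E d) :
    ‖v‖ ^ 2 = ‖(inner ℂ x v : ℂ)‖ ^ 2 + ‖v - (inner ℂ x v : ℂ) • x‖ ^ 2 := by
  rw [← norm_smul_add_sq hx (inner_sub_inner_smul hx v)]
  congr 2
  abel

theorem norm_unit {z : E d} (hz : z ≠ 0) : ‖((‖z‖ : ℂ)⁻¹) • z‖ = 1 := by
  rw [norm_smul, norm_inv, Complex.norm_real, norm_norm, inv_mul_cancel₀ (norm_ne_zero_iff.2 hz)]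

theorem norm_smul_unit {z : E d} (hz : z ≠ 0) : (‖z‖ : ℂ) • ((‖z‖ : ℂ)⁻¹) • z = z := by
  rw [smul_smul, mul_inv_cancel₀, one_smul]
  exact_mod_cast norm_ne_zero_iff.2 hz

theorem mem_unitBall {z : E d} : z ∈ unitBall d ↔ ‖z‖ < 1 := by simp [unitBall]

theorem norm_involution_zero (w : E d) : ‖involution 0 w‖ = ‖w‖ := by
  simp [involution]

/-- The invariance identity of the involution: `1 - |φ_z(w)|² = (1-|z|²)(1-|w|²)/|1-⟨w,z⟩|²`. -/
theorem one_sub_norm_involution_sq {z w : E d} (hz : ‖z‖ < 1) (hw : ‖w‖ < 1) :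
    (1 - ‖involution z w‖ ^ 2) * ‖(1 - inner ℂ z w : ℂ)‖ ^ 2 =
      (1 - ‖z‖ ^ 2) * (1 - ‖w‖ ^ 2) := by
  rcases eq_or_ne z 0 with rfl | hz0
  · rw [norm_involution_zero]; simp
  have hden : (1 - inner ℂ z w : ℂ) ≠ 0 := by
    intro h
    have h1 : ‖(inner ℂ z w : ℂ)‖ = 1 := by rw [← sub_eq_zero.1 h]; simp
    have := norm_inner_le_norm (𝕜 := ℂ) z w
    nlinarith [norm_nonneg z, norm_nonneg w]
  have hu := norm_unit hz0
  have hzu := norm_smul_unit hz0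
  set u : E d := ((‖z‖ : ℂ)⁻¹) • z with hudef
  set s : ℝ := ‖z‖ with hs
  set a : ℂ := inner ℂ u w with ha
  have hr : 0 ≤ 1 - s ^ 2 := by nlinarith [norm_nonneg z]
  have hiz : (inner ℂ z w : ℂ) = s * a := by
    rw [← hzu, inner_smul_left]; simp [ha]
  have hexp : involution z w = (1 - inner ℂ z w : ℂ)⁻¹ •
      (((s : ℂ) - a) • u + (-((Real.sqrt (1 - s ^ 2) : ℝ) : ℂ)) • (w - a • u)) := by
    have : involution z w = (1 - inner ℂ z w : ℂ)⁻¹ •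
        (z - a • u - ((Real.sqrt (1 - s ^ 2) : ℝ) : ℂ) • (w - a • u)) := rfl
    rw [this]
    congr 1
    rw [sub_smul, hzu, neg_smul]
    abel
  have hn : ‖involution z w‖ ^ 2 * ‖(1 - inner ℂ z w : ℂ)‖ ^ 2 =
      ‖(s : ℂ) - a‖ ^ 2 + (1 - s ^ 2) * ‖w - a • u‖ ^ 2 := by
    rw [hexp, norm_smul, mul_pow, norm_inv, norm_smul_add_sq hu, norm_smul, norm_neg, mul_pow,
      Complex.norm_real, Real.norm_eq_abs, sq_abs, Real.sq_sqrt hr]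
    · have := norm_ne_zero_iff.2 hden
      field_simp
    · rw [inner_smul_right, ha, inner_sub_inner_smul hu, mul_zero]
  have hw2 := norm_sq_eq_inner_add hu w
  rw [← ha] at hw2
  have h1 : ‖(1 - inner ℂ z w : ℂ)‖ ^ 2 = ‖(s : ℂ) - a‖ ^ 2 + (1 - s ^ 2) * (1 - ‖a‖ ^ 2) := by
    rw [hiz]
    simp only [← Complex.normSq_eq_norm_sq, Complex.normSq_apply, Complex.sub_re, Complex.sub_im,
      Complex.mul_re, Complex.mul_im, Complex.ofReal_re, Complex.ofReal_im, Complex.one_re,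
      Complex.one_im]
    ring
  rw [sub_mul, hn, hw2, h1]
  ring

theorem mem_bergmanBall_iff {z w : E d} {r : ℝ} (hw : ‖w‖ < 1) (hφ : ‖involution z w‖ < 1) :
    w ∈ bergmanBall z r ↔ ‖involution z w‖ < Real.tanh r := by
  have h0 := norm_nonneg (involution z w)
  have : bergmanDist z w = Real.artanh ‖involution z w‖ := by
    rw [Real.artanh_eq_half_log ⟨by linarith, hφ.le⟩, bergmanDist]
  simp only [bergmanBall, Set.mem_ofPred_eq, mem_unitBall, hw, true_and, this]
  conv_lhs => rw [← Real.artanh_tanh r]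
  exact Real.artanh_lt_artanh_iff ⟨by linarith, hφ⟩ ⟨Real.neg_one_lt_tanh r, Real.tanh_lt_one r⟩

theorem mem_bergmanBall_zero {w : E d} {r : ℝ} : w ∈ bergmanBall 0 r ↔ ‖w‖ < Real.tanh r := by
  by_cases hw : ‖w‖ < 1
  · rw [mem_bergmanBall_iff hw (by rwa [norm_involution_zero]), norm_involution_zero]
  · constructor
    · intro h; exact absurd (mem_unitBall.1 h.1) hw
    · intro h; exact absurd (h.trans (Real.tanh_lt_one r)) hw

theorem mem_bergmanSphere {w : E d} {r : ℝ} : w ∈ bergmanSphere d r ↔ ‖w‖ = Real.tanh r := by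
  have key : ‖w‖ < 1 → (bergmanDist 0 w = r ↔ ‖w‖ = Real.tanh r) := by
    intro hw
    have h0 := norm_nonneg w
    have : bergmanDist 0 w = Real.artanh ‖w‖ := by
      rw [Real.artanh_eq_half_log ⟨by linarith, hw.le⟩, bergmanDist, norm_involution_zero]
    rw [this]
    constructor
    · rintro rfl; rw [Real.tanh_artanh ⟨by linarith, hw⟩]
    · intro h; rw [h, Real.artanh_tanh]
  constructor
  · intro h; exact (key (mem_unitBall.1 h.1)).1 h.2
  · intro h
    have hw : ‖w‖ < 1 := h ▸ Real.tanh_lt_one r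
    exact ⟨mem_unitBall.2 hw, (key hw).2 h⟩

theorem one_sub_tanh_sq (x : ℝ) : 1 - Real.tanh x ^ 2 = (Real.cosh x ^ 2)⁻¹ := by
  have := Real.cosh_pos x
  rw [Real.tanh_eq_sinh_div_cosh, div_pow, Real.sinh_sq]
  field_simp
  ring

/-- The trace of a Bergman ball on a sphere through its centre is a nonisotropic ball. -/
theorem mem_bergmanBall_of_norm_eq {z w : E d} {t r : ℝ} (hr : 0 < r) (ht : t < 1) (hz : ‖z‖ = t)
    (hw : ‖w‖ = t) :
    w ∈ bergmanBall z r ↔ ‖(1 - inner ℂ z w : ℂ)‖ < (1 - t ^ 2) * Real.cosh r := by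
  have h0 : 0 ≤ t := hz ▸ norm_nonneg z
  have hid := one_sub_norm_involution_sq (z := z) (w := w) (hz ▸ ht) (hw ▸ ht)
  rw [hz, hw] at hid
  set f := ‖involution z w‖
  set q := ‖(1 - inner ℂ z w : ℂ)‖
  have ht2 : 0 < 1 - t ^ 2 := by nlinarith
  have hq : 0 ≤ q := norm_nonneg _
  have hf : 0 ≤ f := norm_nonneg _
  have hq2 : 0 < q ^ 2 := by
    rcases hq.eq_or_lt with h | h
    · rw [← h] at hid; nlinarith
    · positivity
  have hf1 : f < 1 := by
    by_contra h
    push Not at h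
    have : 1 ≤ f ^ 2 := one_le_pow₀ h
    nlinarith [mul_pos ht2 ht2]
  rw [mem_bergmanBall_iff (hw ▸ ht) hf1]
  have hth : 0 < Real.tanh r := by
    rw [Real.tanh_eq_sinh_div_cosh]
    exact div_pos (Real.sinh_pos_iff.2 hr) (Real.cosh_pos r)
  have hc := Real.cosh_pos r
  rw [← sq_lt_sq₀ hf hth.le, ← sq_lt_sq₀ hq (by positivity)]
  have h1 := one_sub_tanh_sq r
  have h2 : (1 - Real.tanh r ^ 2) * Real.cosh r ^ 2 = 1 := by
    rw [h1]; field_simp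
  rw [mul_pow]
  set c2 := Real.cosh r ^ 2
  have hc2 : 0 < c2 := by positivity
  set p := Real.tanh r ^ 2
  constructor
  · intro h
    have h3 : (1 - t ^ 2) ^ 2 * c2 = (1 - f ^ 2) * c2 * q ^ 2 := by
      have : (1 - t ^ 2) ^ 2 = (1 - f ^ 2) * q ^ 2 := by rw [hid]; ring
      rw [this]; ring
    rw [h3]
    have : 1 < (1 - f ^ 2) * c2 := by nlinarith
    nlinarith
  · intro h
    have h3 : (1 - t ^ 2) ^ 2 * c2 = (1 - f ^ 2) * c2 * q ^ 2 := by
      have : (1 - t ^ 2) ^ 2 = (1 - f ^ 2) * q ^ 2 := by rw [hid]; ring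
      rw [this]; ring
    rw [h3] at h
    have : 1 < (1 - f ^ 2) * c2 := by
      by_contra h4
      push Not at h4
      nlinarith
    nlinarith

/-- The nonisotropic distance `|1 - ⟨w, z⟩|^{1/2}` on the closed unit ball. -/
noncomputable def rho (z w : E d) : ℝ := Real.sqrt ‖(1 - inner ℂ z w : ℂ)‖

theorem rho_nonneg (z w : E d) : 0 ≤ rho z w := Real.sqrt_nonneg _

theorem rho_sq (z w : E d) : rho z w ^ 2 = ‖(1 - inner ℂ z w : ℂ)‖ :=
  Real.sq_sqrt (norm_nonneg _)

theorem rho_comm (z w : E d) : rho z w = rho w z := by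
  have : (1 - inner ℂ z w : ℂ) = (starRingEnd ℂ) (1 - inner ℂ w z : ℂ) := by simp
  rw [rho, rho, this, RCLike.norm_conj]

theorem rho_self {x : E d} (hx : ‖x‖ = 1) : rho x x = 0 := by
  simp [rho, inner_self_eq_norm_sq_to_K, hx]

theorem continuous_rho (z : E d) : Continuous (rho z) := by unfold rho; fun_prop

/-- Cauchy--Schwarz for the form `⟨c, a⟩ - ⟨b, a⟩⟨c, b⟩`, which is positive semidefinite as soon
as `|b| ≤ 1`. -/
theorem norm_inner_sub_inner_mul_le {a b c : E d} (ha : ‖a‖ ≤ 1) (hb : ‖b‖ ≤ 1) (hc : ‖c‖ ≤ 1) :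
    ‖(inner ℂ a c - inner ℂ a b * inner ℂ b c : ℂ)‖ ≤
      Real.sqrt (1 - ‖(inner ℂ a b : ℂ)‖ ^ 2) * Real.sqrt (1 - ‖(inner ℂ b c : ℂ)‖ ^ 2) := by
  -- With `2 l - l² |b|² = 1` the form is `⟨c - l⟨c,b⟩b, a - l⟨a,b⟩b⟩`.
  set s := Real.sqrt (1 - ‖b‖ ^ 2) with hs
  have hs0 : 0 ≤ s := Real.sqrt_nonneg _
  have hs2 : s ^ 2 = 1 - ‖b‖ ^ 2 := Real.sq_sqrt (by nlinarith [norm_nonneg b])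
  set l : ℝ := 1 / (1 + s) with hl
  have hlb : 2 * l - l ^ 2 * ‖b‖ ^ 2 = 1 := by
    have : ‖b‖ ^ 2 = 1 - s ^ 2 := by linarith
    rw [this, hl]
    field_simp
    ring
  have hform : ∀ x y : E d, (inner ℂ (x - ((l : ℂ) * inner ℂ b x) • b)
      (y - ((l : ℂ) * inner ℂ b y) • b) : ℂ) = inner ℂ x y - inner ℂ x b * inner ℂ b y := by
    intro x y
    have h1 : (2 * l - l ^ 2 * ‖b‖ ^ 2 : ℂ) = 1 := by exact_mod_cast hlb
    rw [inner_sub_left, inner_sub_right, inner_sub_right, inner_smul_left, inner_smul_right,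
      inner_smul_left, inner_smul_right, inner_self_eq_norm_sq_to_K]
    simp only [map_mul, Complex.conj_ofReal, inner_conj_symm, Complex.coe_algebraMap]
    linear_combination (-(inner ℂ x b * inner ℂ b y : ℂ)) * h1
  have hnorm : ∀ x : E d, ‖x‖ ≤ 1 → ‖x - ((l : ℂ) * inner ℂ b x) • b‖ ≤
      Real.sqrt (1 - ‖(inner ℂ b x : ℂ)‖ ^ 2) := by
    intro x hx
    apply Real.le_sqrt_of_sq_le
    have h1 := hform x x
    rw [inner_self_eq_norm_sq_to_K, inner_self_eq_norm_sq_to_K, ← inner_conj_symm x b,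
      ← Complex.normSq_eq_conj_mul_self] at h1
    have h2 : ‖x - ((l : ℂ) * inner ℂ b x) • b‖ ^ 2 = ‖x‖ ^ 2 - ‖(inner ℂ b x : ℂ)‖ ^ 2 := by
      rw [← Complex.normSq_eq_norm_sq (inner ℂ b x)]
      simp only [Complex.coe_algebraMap] at h1
      exact_mod_cast h1
    rw [h2]
    nlinarith [norm_nonneg x]
  rw [← hform]
  refine (norm_inner_le_norm _ _).trans ?_
  rw [norm_inner_symm a b]
  exact mul_le_mul (hnorm a ha) (hnorm c hc) (norm_nonneg _) (Real.sqrt_nonneg _)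

theorem rho_triangle {a b c : E d} (ha : ‖a‖ ≤ 1) (hb : ‖b‖ ≤ 1) (hc : ‖c‖ ≤ 1) :
    rho a c ≤ rho a b + rho b c := by
  have h1 := norm_inner_sub_inner_mul_le ha hb hc
  set α : ℂ := inner ℂ a b
  set γ : ℂ := inner ℂ b c
  have hbound : ∀ x : ℂ, Real.sqrt (1 - ‖x‖ ^ 2) ≤ Real.sqrt 2 * Real.sqrt ‖1 - x‖ := by
    intro x
    rw [← Real.sqrt_mul (by norm_num)]
    apply Real.sqrt_le_sqrt
    have : 1 - ‖x‖ ≤ ‖1 - x‖ := by simpa using norm_sub_norm_le (1 : ℂ) x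
    nlinarith [sq_nonneg (1 - ‖x‖)]
  have hα : ‖α‖ ≤ 1 := (norm_inner_le_norm a b).trans (by nlinarith [norm_nonneg a, norm_nonneg b])
  have h2 : ‖1 - α * γ‖ ≤ ‖1 - α‖ + ‖1 - γ‖ := by
    have : 1 - α * γ = (1 - α) + α * (1 - γ) := by ring
    rw [this]
    refine (norm_add_le _ _).trans ?_
    rw [norm_mul]
    nlinarith [norm_nonneg (1 - γ)]
  have h3 : ‖(1 - inner ℂ a c : ℂ)‖ ≤ ‖1 - α * γ‖ + ‖(inner ℂ a c - α * γ : ℂ)‖ := by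
    have : (1 - inner ℂ a c : ℂ) = (1 - α * γ) - (inner ℂ a c - α * γ) := by ring
    rw [this]
    exact norm_sub_le _ _
  have h4 : Real.sqrt (1 - ‖α‖ ^ 2) * Real.sqrt (1 - ‖γ‖ ^ 2) ≤ 2 * (rho a b * rho b c) := by
    refine (mul_le_mul (hbound α) (hbound γ) (Real.sqrt_nonneg _) (by positivity)).trans_eq ?_
    have : Real.sqrt 2 * Real.sqrt 2 = 2 := Real.mul_self_sqrt (by norm_num)
    change Real.sqrt 2 * rho a b * (Real.sqrt 2 * rho b c) = _
    linear_combination (rho a b * rho b c) * this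
  refine Real.sqrt_le_iff.2 ⟨add_nonneg (rho_nonneg _ _) (rho_nonneg _ _), ?_⟩
  have e1 : rho a b ^ 2 = ‖1 - α‖ := rho_sq a b
  have e2 : rho b c ^ 2 = ‖1 - γ‖ := rho_sq b c
  nlinarith

/-! ### Volumes of nonisotropic balls -/

/-- The complex linear map that multiplies the unit vector `x` by `τ` and its orthogonal
complement by `√τ`. -/
noncomputable def stretch (x : E d) (τ : ℝ) : E d →ₗ[ℂ] E d :=
  ((Real.sqrt τ : ℝ) : ℂ) • LinearMap.transvection
    (((Real.sqrt τ : ℝ) - 1 : ℂ) • (innerSL ℂ x).toLinearMap) x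

theorem stretch_apply (x : E d) {τ : ℝ} (hτ : 0 ≤ τ) (u : E d) :
    stretch x τ u = ((Real.sqrt τ : ℝ) : ℂ) • (u - (inner ℂ x u : ℂ) • x) +
      ((τ : ℂ) * inner ℂ x u) • x := by
  have h : ((Real.sqrt τ : ℝ) : ℂ) * ((Real.sqrt τ : ℝ) : ℂ) = τ := by
    exact_mod_cast Real.mul_self_sqrt hτ
  rw [stretch, LinearMap.smul_apply, LinearMap.transvection.apply]
  simp only [LinearMap.smul_apply, ContinuousLinearMap.coe_coe, innerSL_apply_apply, smul_eq_mul]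
  rw [← h]
  module

theorem det_stretch {x : E d} (hx : ‖x‖ = 1) (τ : ℝ) :
    LinearMap.det ((stretch x τ).restrictScalars ℝ) = (Real.sqrt τ ^ (d + 1)) ^ 2 := by
  rw [LinearMap.det_restrictScalars, stretch, LinearMap.det_smul, LinearMap.transvection.det,
    Algebra.norm_complex_apply]
  simp only [finrank_euclideanSpace_fin, LinearMap.smul_apply, ContinuousLinearMap.coe_coe,
    innerSL_apply_apply, inner_self_eq_norm_sq_to_K, hx, smul_eq_mul]
  have : ((Real.sqrt τ : ℝ) : ℂ) ^ d * (1 + (((Real.sqrt τ : ℝ) : ℂ) - 1) * (((1 : ℝ) : ℂ)) ^ 2) =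
      ((Real.sqrt τ ^ (d + 1) : ℝ) : ℂ) := by
    push_cast; ring
  erw [this]
  rw [Complex.normSq_ofReal]
  ring

/-- The ellipsoid with centre `c`, radius `τ` in the direction `x` and radius `√τ` in the
directions orthogonal to `x`. -/
def ellipsoid (c x : E d) (τ : ℝ) : Set (E d) :=
  (fun u => c + stretch x τ u) '' unitBall d

theorem volume_unitBall_ne_zero : volume (unitBall d) ≠ 0 :=
  (Metric.measure_ball_pos volume _ one_pos).ne'

theorem volume_unitBall_ne_top : volume (unitBall d) ≠ ∞ := measure_ball_lt_top.ne

theorem volume_ellipsoid (c : E d) {x : E d} (hx : ‖x‖ = 1) {τ : ℝ} (hτ : 0 ≤ τ) :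
    volume (ellipsoid c x τ) = ENNReal.ofReal (τ ^ (d + 1)) * volume (unitBall d) := by
  have : ellipsoid c x τ = (fun v => c + v) '' ((stretch x τ).restrictScalars ℝ '' unitBall d) := by
    rw [Set.image_image]; rfl
  rw [this, Set.image_add_left, measure_preimage_add, Measure.addHaar_image_linearMap,
    det_stretch hx, abs_of_nonneg (by positivity), ← pow_mul, mul_comm (d + 1) 2, pow_mul,
    Real.sq_sqrt hτ]

theorem measurableSet_unitBall : MeasurableSet (unitBall d) := measurableSet_ball

theorem nu_apply_of_subset {A : Set (E d)} (hA : A ⊆ unitBall d) :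
    nu d A = (volume (unitBall d))⁻¹ * volume A := by
  rw [nu, Measure.smul_apply, Measure.restrict_eq_self _ hA, smul_eq_mul]

theorem nu_unitBall : nu d (unitBall d) = 1 := by
  rw [nu_apply_of_subset subset_rfl]
  exact ENNReal.inv_mul_cancel volume_unitBall_ne_zero volume_unitBall_ne_top

theorem nu_compl_unitBall : nu d (unitBall d)ᶜ = 0 := by
  rw [nu, Measure.smul_apply, Measure.restrict_apply measurableSet_unitBall.compl]
  simp

instance isProbabilityMeasure_nu : IsProbabilityMeasure (nu d) := by
  constructor
  rw [← Set.union_compl_self (unitBall d), measure_union disjoint_compl_right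
    measurableSet_unitBall.compl, nu_unitBall, nu_compl_unitBall, add_zero]

theorem ae_mem_unitBall : ∀ᵐ z ∂(nu d), z ∈ unitBall d := nu_compl_unitBall

theorem le_nu_of_ellipsoid_subset {c x : E d} (hx : ‖x‖ = 1) {τ : ℝ} (hτ : 0 ≤ τ)
    {A : Set (E d)} (hA : A ⊆ unitBall d) (h : ellipsoid c x τ ⊆ A) :
    ENNReal.ofReal (τ ^ (d + 1)) ≤ nu d A := by
  rw [nu_apply_of_subset hA]
  refine le_trans ?_ (mul_le_mul_right (measure_mono h) _)
  rw [volume_ellipsoid c hx hτ, mul_comm (ENNReal.ofReal _), ← mul_assoc,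
    ENNReal.inv_mul_cancel volume_unitBall_ne_zero volume_unitBall_ne_top, one_mul]

theorem nu_le_of_subset_ellipsoid {c x : E d} (hx : ‖x‖ = 1) {τ : ℝ} (hτ : 0 ≤ τ)
    {A : Set (E d)} (hA : A ⊆ unitBall d) (h : A ⊆ ellipsoid c x τ) :
    nu d A ≤ ENNReal.ofReal (τ ^ (d + 1)) := by
  rw [nu_apply_of_subset hA]
  refine (mul_le_mul_right (measure_mono h) _).trans ?_
  rw [volume_ellipsoid c hx hτ, mul_comm (ENNReal.ofReal _), ← mul_assoc,
    ENNReal.inv_mul_cancel volume_unitBall_ne_zero volume_unitBall_ne_top, one_mul]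

/-- A point of the ellipsoid is `c + v`, where the components of `v` along `x` and orthogonal
to `x` are controlled. -/
theorem exists_of_mem_ellipsoid {c x ζ : E d} (hx : ‖x‖ = 1) {τ : ℝ} (hτ : 0 < τ)
    (h : ζ ∈ ellipsoid c x τ) : ∃ (a : ℂ) (v : E d), inner ℂ x v = 0 ∧ ‖a‖ < τ ∧ ‖v‖ ^ 2 < τ ∧
      ζ = c + (a • x + v) := by
  obtain ⟨u, hu, rfl⟩ := h
  have hu1 := mem_unitBall.1 hu
  have h2 := norm_sq_eq_inner_add hx u
  have h3 : ‖u‖ ^ 2 < 1 := by nlinarith [norm_nonneg u]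
  refine ⟨(τ : ℂ) * inner ℂ x u, ((Real.sqrt τ : ℝ) : ℂ) • (u - (inner ℂ x u : ℂ) • x),
    ?_, ?_, ?_, ?_⟩
  · rw [inner_smul_right, inner_sub_inner_smul hx, mul_zero]
  · rw [norm_mul, Complex.norm_real, Real.norm_of_nonneg hτ.le]
    have := norm_inner_le_norm (𝕜 := ℂ) x u
    rw [hx, one_mul] at this
    nlinarith
  · rw [norm_smul, mul_pow, Complex.norm_real, Real.norm_eq_abs, sq_abs, Real.sq_sqrt hτ.le]
    nlinarith [sq_nonneg ‖(inner ℂ x u : ℂ)‖]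
  · simp only [stretch_apply x hτ.le]
    abel

theorem mem_ellipsoid {c x v : E d} (hx : ‖x‖ = 1) {τ : ℝ} (hτ : 0 < τ) {a : ℂ}
    (hv : inner ℂ x v = 0) (h : ‖a‖ ^ 2 / τ ^ 2 + ‖v‖ ^ 2 / τ < 1) :
    c + (a • x + v) ∈ ellipsoid c x τ := by
  have hs : 0 < Real.sqrt τ := Real.sqrt_pos.2 hτ
  have hsne : ((Real.sqrt τ : ℝ) : ℂ) ≠ 0 := by exact_mod_cast hs.ne'
  have hv' : inner ℂ x (((Real.sqrt τ : ℝ) : ℂ)⁻¹ • v) = 0 := by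
    rw [inner_smul_right, hv, mul_zero]
  have hin : (inner ℂ x ((a / τ) • x + ((Real.sqrt τ : ℝ) : ℂ)⁻¹ • v) : ℂ) = a / τ := by
    rw [inner_add_right, hv', inner_smul_right, inner_self_eq_norm_sq_to_K, hx]; simp
  refine ⟨(a / τ) • x + ((Real.sqrt τ : ℝ) : ℂ)⁻¹ • v, ?_, ?_⟩
  · rw [mem_unitBall, ← sq_lt_one_iff₀ (norm_nonneg _), norm_smul_add_sq hx hv', norm_div,
      norm_smul, norm_inv, Complex.norm_real, Complex.norm_real, mul_pow, div_pow, inv_pow,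
      Real.norm_eq_abs, Real.norm_eq_abs, sq_abs, sq_abs, Real.sq_sqrt hτ.le, ← div_eq_inv_mul]
    exact h
  · have hτ' : (τ : ℂ) ≠ 0 := by exact_mod_cast hτ.ne'
    simp only [stretch_apply x hτ.le, hin, add_sub_cancel_left]
    rw [smul_smul, mul_inv_cancel₀ hsne, one_smul, mul_div_cancel₀ _ hτ']
    abel

/-- A nonisotropic ball centred on the sphere lies in an ellipsoid with the same centre; its volume
is at most of order `s ^ (d + 1)`. -/
theorem nu_setOf_norm_one_sub_inner_le {x : E d} (hx : ‖x‖ = 1) {s : ℝ} (hs : 0 < s) :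
    nu d {ζ | ζ ∈ unitBall d ∧ ‖(1 - inner ℂ x ζ : ℂ)‖ ≤ s} ≤
      ENNReal.ofReal ((3 * s) ^ (d + 1)) := by
  refine nu_le_of_subset_ellipsoid (c := x) hx (by positivity) (fun ζ h => h.1) ?_
  rintro ζ ⟨hζ, h⟩
  have hζ1 := mem_unitBall.1 hζ
  have e : ζ = x + ((inner ℂ x ζ - 1 : ℂ) • x + (ζ - (inner ℂ x ζ : ℂ) • x)) := by
    module
  rw [e]
  refine mem_ellipsoid hx (by positivity) (inner_sub_inner_smul hx ζ) ?_
  have h2 := norm_sq_eq_inner_add hx ζ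
  rw [norm_sub_rev] at h
  have h3 : 1 - ‖(inner ℂ x ζ : ℂ)‖ ≤ ‖(inner ℂ x ζ - 1 : ℂ)‖ := by
    rw [norm_sub_rev]; simpa using norm_sub_norm_le (1 : ℂ) (inner ℂ x ζ)
  have h4 : ‖ζ - (inner ℂ x ζ : ℂ) • x‖ ^ 2 ≤ 2 * s := by
    nlinarith [norm_nonneg ζ, sq_nonneg (1 - ‖(inner ℂ x ζ : ℂ)‖)]
  have h5 : ‖(inner ℂ x ζ - 1 : ℂ)‖ ^ 2 ≤ s ^ 2 := pow_le_pow_left₀ (norm_nonneg _) h 2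
  have h6 : ‖(inner ℂ x ζ - 1 : ℂ)‖ ^ 2 / (3 * s) ^ 2 ≤ 1 / 9 := by
    rw [div_le_div_iff₀ (by positivity) (by norm_num)]; nlinarith
  have h7 : ‖ζ - (inner ℂ x ζ : ℂ) • x‖ ^ 2 / (3 * s) ≤ 2 / 3 := by
    rw [div_le_div_iff₀ (by positivity) (by norm_num)]; nlinarith
  linarith

/-- A nonisotropic ball centred at `x` on the sphere contains the ellipsoid of size `s / 8` around
`(1 - s / 2) x`. -/
theorem le_nu_setOf_norm_one_sub_inner_lt {x : E d} (hx : ‖x‖ = 1) {s : ℝ} (hs : 0 < s)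
    (hs1 : s ≤ 1) :
    ENNReal.ofReal ((s / 8) ^ (d + 1)) ≤
      nu d {ζ | ζ ∈ unitBall d ∧ ‖(1 - inner ℂ x ζ : ℂ)‖ < s} := by
  refine le_nu_of_ellipsoid_subset (c := ((1 - s / 2 : ℝ) : ℂ) • x) hx (by positivity)
    (fun ζ h => h.1) ?_
  intro ζ hζ
  obtain ⟨a, v, hv, ha, hv2, rfl⟩ := exists_of_mem_ellipsoid hx (by positivity) hζ
  have e : ((1 - s / 2 : ℝ) : ℂ) • x + (a • x + v) = (((1 - s / 2 : ℝ) : ℂ) + a) • x + v := by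
    module
  rw [e]
  constructor
  · rw [mem_unitBall, ← sq_lt_one_iff₀ (norm_nonneg _), norm_smul_add_sq hx hv]
    have h1 : ‖((1 - s / 2 : ℝ) : ℂ) + a‖ ≤ (1 - s / 2) + s / 8 := by
      refine (norm_add_le _ _).trans ?_
      rw [Complex.norm_real, Real.norm_of_nonneg (by linarith)]
      linarith
    nlinarith [norm_nonneg (((1 - s / 2 : ℝ) : ℂ) + a)]
  · rw [inner_add_right, hv, inner_smul_right, inner_self_eq_norm_sq_to_K, hx]
    have : (1 - ((((1 - s / 2 : ℝ) : ℂ) + a) * ((1 : ℝ) : ℂ) ^ 2 + 0) : ℂ) =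
        ((s / 2 : ℝ) : ℂ) - a := by push_cast; ring
    erw [this]
    refine (norm_sub_le _ _).trans_lt ?_
    rw [Complex.norm_real, Real.norm_of_nonneg (by positivity)]
    linarith

/-! ### Bergman trees -/

theorem tanh_lt_tanh {x y : ℝ} : Real.tanh x < Real.tanh y ↔ x < y := by
  conv_rhs => rw [← Real.artanh_tanh x, ← Real.artanh_tanh y]
  exact (Real.artanh_lt_artanh_iff ⟨Real.neg_one_lt_tanh x, Real.tanh_lt_one x⟩
    ⟨Real.neg_one_lt_tanh y, Real.tanh_lt_one y⟩).symm

theorem tanh_le_tanh {x y : ℝ} : Real.tanh x ≤ Real.tanh y ↔ x ≤ y := by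
  rw [← not_lt, ← not_lt, tanh_lt_tanh]

theorem tanh_nonneg {x : ℝ} (hx : 0 ≤ x) : 0 ≤ Real.tanh x := by
  simpa using tanh_le_tanh.2 hx

theorem tanh_pos {x : ℝ} (hx : 0 < x) : 0 < Real.tanh x := by
  simpa using tanh_lt_tanh.2 hx

theorem one_sub_tanh_sq_pos (x : ℝ) : 0 < 1 - Real.tanh x ^ 2 := by
  rw [one_sub_tanh_sq]; have := Real.cosh_pos x; positivity

theorem one_sub_tanh_sq_le_one (x : ℝ) : 1 - Real.tanh x ^ 2 ≤ 1 := by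
  nlinarith [sq_nonneg (Real.tanh x)]

/-- `ζ / |ζ|`. -/
noncomputable def direction (ζ : E d) : E d := ((‖ζ‖ : ℂ)⁻¹) • ζ

theorem norm_direction {ζ : E d} (h : ζ ≠ 0) : ‖direction ζ‖ = 1 := norm_unit h

theorem norm_smul_direction (ζ : E d) : (‖ζ‖ : ℂ) • direction ζ = ζ := by
  rcases eq_or_ne ζ 0 with rfl | h
  · simp
  · exact norm_smul_unit h

theorem direction_smul {t : ℝ} (ht : 0 < t) {x : E d} (hx : ‖x‖ = 1) :
    direction ((t : ℂ) • x) = x := by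
  have : (t : ℂ) ≠ 0 := by exact_mod_cast ht.ne'
  rw [direction, norm_smul, hx, mul_one, Complex.norm_real, Real.norm_of_nonneg ht.le, smul_smul,
    inv_mul_cancel₀ this, one_smul]

theorem measurable_direction : Measurable (direction : E d → E d) := by
  unfold direction; fun_prop

theorem radialProj_eq (t : ℝ) (ζ : E d) :
    radialProj t ζ = ((Real.tanh t : ℝ) : ℂ) • direction ζ := by
  rw [radialProj, direction, smul_smul]
  push_cast
  rfl

theorem measurable_radialProj (t : ℝ) : Measurable (radialProj t : E d → E d) := by
  unfold radialProj; fun_prop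

theorem norm_radialProj {t : ℝ} (ht : 0 ≤ t) {ζ : E d} (h : t = 0 ∨ ζ ≠ 0) :
    ‖radialProj t ζ‖ = Real.tanh t := by
  rw [radialProj_eq, norm_smul, Complex.norm_real, Real.norm_of_nonneg (tanh_nonneg ht)]
  rcases h with rfl | h
  · simp
  · rw [norm_direction h, mul_one]

theorem one_sub_smul_inner (t : ℝ) (x y : E d) :
    (1 - inner ℂ ((t : ℂ) • x) ((t : ℂ) • y) : ℂ) = 1 - ((t ^ 2 : ℝ) : ℂ) * inner ℂ x y := by
  rw [inner_smul_left, inner_smul_right]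
  simp only [Complex.conj_ofReal]
  push_cast
  ring

theorem mul_norm_one_sub_le {c : ℂ} (hc : ‖c‖ ≤ 1) {s : ℝ} (h0 : 0 ≤ s) (h1 : s ≤ 1) :
    s * ‖1 - c‖ ≤ ‖1 - (s : ℂ) * c‖ := by
  have hre : c.re ≤ 1 := (Complex.re_le_norm c).trans hc
  rw [← sq_le_sq₀ (by positivity) (norm_nonneg _), mul_pow]
  simp only [← Complex.normSq_eq_norm_sq, Complex.normSq_apply, Complex.sub_re, Complex.sub_im,
    Complex.mul_re, Complex.mul_im, Complex.ofReal_re, Complex.ofReal_im, Complex.one_re,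
    Complex.one_im]
  nlinarith [mul_nonneg (mul_nonneg h0 (sub_nonneg.2 h1)) (sub_nonneg.2 hre)]

theorem norm_one_sub_mul_le (c : ℂ) {s : ℝ} (h0 : 0 ≤ s) (h1 : s ≤ 1) :
    ‖1 - (s : ℂ) * c‖ ≤ (1 - s) + s * ‖1 - c‖ := by
  have : 1 - (s : ℂ) * c = ((1 - s : ℝ) : ℂ) + (s : ℂ) * (1 - c) := by push_cast; ring
  rw [this]
  refine (norm_add_le _ _).trans_eq ?_
  rw [norm_mul, Complex.norm_real, Complex.norm_real, Real.norm_of_nonneg h0,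
    Real.norm_of_nonneg (by linarith)]

theorem exists_norm_eq_one (hd : 1 ≤ d) : ∃ x : E d, ‖x‖ = 1 :=
  ⟨EuclideanSpace.single ⟨0, hd⟩ 1, by simp⟩

namespace BergmanTree

variable {R δ : ℝ} (T : BergmanTree d R δ)

instance : Countable T.Vertex := inferInstanceAs (Countable (Σ n : ℕ, Fin (T.J n)))

theorem norm_z (n : ℕ) (j : Fin (T.J n)) : ‖T.z n j‖ = Real.tanh (n * R) :=
  mem_bergmanSphere.1 (T.z_mem n j)

variable {T}

theorem mem_kube {a : T.Vertex} {ζ : E d} : ζ ∈ T.kube a ↔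
    Real.tanh (a.1 * R) ≤ ‖ζ‖ ∧ ‖ζ‖ < Real.tanh ((a.1 + 1) * R) ∧
      radialProj (a.1 * R) ζ ∈ T.Ω a.1 a.2 := by
  simp only [kube, Set.mem_ofPred_eq, Set.mem_sdiff, mem_bergmanBall_zero, not_lt]
  tauto

theorem measurableSet_kube (a : T.Vertex) : MeasurableSet (T.kube a) := by
  have : T.kube a = {ζ | Real.tanh (a.1 * R) ≤ ‖ζ‖} ∩ ({ζ | ‖ζ‖ < Real.tanh ((a.1 + 1) * R)} ∩
      radialProj (a.1 * R) ⁻¹' T.Ω a.1 a.2) := by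
    ext ζ; exact mem_kube
  rw [this]
  exact (measurableSet_le measurable_const measurable_norm).inter
    ((measurableSet_lt measurable_norm measurable_const).inter
      (measurable_radialProj _ (T.measurableSet_Ω _ _)))

theorem kube_subset_unitBall (a : T.Vertex) : T.kube a ⊆ unitBall d := fun _ h =>
  mem_unitBall.2 ((mem_kube.1 h).2.1.trans (Real.tanh_lt_one _))

theorem kube_subset_tent {a b : T.Vertex} (h : Relation.ReflTransGen T.IsChild a b) :
    T.kube b ⊆ T.tent a := Set.subset_iUnion₂_of_subset b h subset_rfl

theorem mem_tent {a : T.Vertex} {ζ : E d} : ζ ∈ T.tent a ↔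
    ∃ b : T.Vertex, Relation.ReflTransGen T.IsChild a b ∧ ζ ∈ T.kube b := by
  simp [tent]

theorem measurableSet_tent (a : T.Vertex) : MeasurableSet (T.tent a) :=
  MeasurableSet.iUnion fun b => MeasurableSet.iUnion fun _ => measurableSet_kube b

theorem tent_subset_unitBall (a : T.Vertex) : T.tent a ⊆ unitBall d :=
  Set.iUnion₂_subset fun b _ => kube_subset_unitBall b

theorem tent_subset_tent {a b : T.Vertex} (h : Relation.ReflTransGen T.IsChild a b) :
    T.tent b ⊆ T.tent a := by
  intro ζ hζ
  obtain ⟨c, hc, hζ⟩ := mem_tent.1 hζ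
  exact mem_tent.2 ⟨c, h.trans hc, hζ⟩

theorem level_le {a b : T.Vertex} (h : Relation.ReflTransGen T.IsChild a b) : a.1 ≤ b.1 := by
  induction h with
  | refl => exact le_rfl
  | tail _ h ih => have := h.1; omega

theorem eq_of_level_eq {a b : T.Vertex} (h : Relation.ReflTransGen T.IsChild a b)
    (hl : a.1 = b.1) : a = b := by
  rcases Relation.ReflTransGen.cases_head h with h | ⟨c, hc, hcb⟩
  · exact h
  · have := level_le hcb
    have := hc.1
    omega

theorem eq_of_mem_Ω {n : ℕ} {i j : Fin (T.J n)} {w : E d} (hi : w ∈ T.Ω n i) (hj : w ∈ T.Ω n j) :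
    i = j := by
  by_contra h
  exact Set.disjoint_left.1 (T.disjoint_Ω n h) hi hj

theorem eq_of_isChild {a b c : T.Vertex} (ha : T.IsChild a c) (hb : T.IsChild b c) : a = b := by
  obtain ⟨n, i⟩ := a
  obtain ⟨m, j⟩ := b
  have h1 := ha.1
  have h2 := hb.1
  obtain rfl : n = m := by simp only at h1 h2; omega
  obtain rfl := eq_of_mem_Ω ha.2 hb.2
  rfl

theorem eq_of_common_descendant {a b c : T.Vertex} (ha : Relation.ReflTransGen T.IsChild a c)
    (hb : Relation.ReflTransGen T.IsChild b c) (hl : a.1 = b.1) : a = b := by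
  have hr : Relator.RightUnique (Function.swap T.IsChild) := fun _ _ _ h1 h2 => eq_of_isChild h1 h2
  rcases Relation.ReflTransGen.total_of_right_unique hr ha.swap hb.swap with h | h
  · exact (eq_of_level_eq h.swap hl.symm).symm
  · exact eq_of_level_eq h.swap hl

variable (T) in
/-- The unit vector pointing to the point `z_j^n` of a vertex of positive level. -/
noncomputable def dir (a : T.Vertex) : E d := direction (T.z a.1 a.2)

theorem z_ne_zero (hR : 0 < R) {a : T.Vertex} (ha : 1 ≤ a.1) : T.z a.1 a.2 ≠ 0 := by
  rw [← norm_ne_zero_iff, norm_z]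
  have : (1 : ℝ) ≤ a.1 := by exact_mod_cast ha
  exact (tanh_pos (by positivity)).ne'

theorem norm_dir (hR : 0 < R) {a : T.Vertex} (ha : 1 ≤ a.1) : ‖T.dir a‖ = 1 :=
  norm_direction (z_ne_zero hR ha)

theorem tanh_smul_dir (a : T.Vertex) :
    ((Real.tanh (a.1 * R) : ℝ) : ℂ) • T.dir a = T.z a.1 a.2 := by
  rw [← norm_z, dir, norm_smul_direction]

theorem radialProj_center (hR : 0 < R) {b : T.Vertex} (hb : 1 ≤ b.1) (t : ℝ) :
    radialProj t (T.center b) = ((Real.tanh t : ℝ) : ℂ) • T.dir b := by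
  rw [center, radialProj_eq, radialProj_eq (((b.1 : ℝ) + 1 / 2) * R)]
  change _ • direction (_ • T.dir b) = _
  rw [direction_smul (tanh_pos (by positivity)) (norm_dir hR hb)]

theorem isChild_iff (hR : 0 < R) {a b : T.Vertex} : T.IsChild a b ↔
    b.1 = a.1 + 1 ∧ ((Real.tanh (a.1 * R) : ℝ) : ℂ) • T.dir b ∈ T.Ω a.1 a.2 := by
  refine and_congr_right fun h => ?_
  rw [radialProj_center hR (by omega)]

theorem exists_mem_Ω {n : ℕ} {w : E d} (hw : ‖w‖ = Real.tanh (n * R)) :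
    ∃ j, w ∈ T.Ω n j := by
  have := mem_bergmanSphere.2 hw
  rw [← T.iUnion_Ω n] at this
  exact Set.mem_iUnion.1 this

theorem exists_parent (hR : 0 < R) {n : ℕ} {b : T.Vertex} (hb : b.1 = n + 1) :
    ∃ j : Fin (T.J n), T.IsChild ⟨n, j⟩ b := by
  obtain ⟨j, hj⟩ := exists_mem_Ω (T := T) (n := n) (w := ((Real.tanh (n * R) : ℝ) : ℂ) • T.dir b)
    (by rw [norm_smul, norm_dir hR (by omega), mul_one, Complex.norm_real,
          Real.norm_of_nonneg (tanh_nonneg (by positivity))])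
  exact ⟨j, (isChild_iff hR).2 ⟨hb, hj⟩⟩

theorem disjoint_kube (hR : 0 < R) {a b : T.Vertex} (h : a ≠ b) :
    Disjoint (T.kube a) (T.kube b) := by
  have key : ∀ a b : T.Vertex, a.1 < b.1 → Disjoint (T.kube a) (T.kube b) := by
    intro a b hlt
    rw [Set.disjoint_left]
    intro ζ ha hb
    have h1 := (mem_kube.1 ha).2.1
    have h2 := (mem_kube.1 hb).1
    have h3 : ((a.1 : ℝ) + 1) ≤ b.1 := by exact_mod_cast hlt
    have h4 := tanh_le_tanh.2 (mul_le_mul_of_nonneg_right h3 hR.le)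
    linarith
  rcases lt_trichotomy a.1 b.1 with hlt | heq | hlt
  · exact key a b hlt
  · obtain ⟨n, i⟩ := a
    obtain ⟨m, j⟩ := b
    obtain rfl : n = m := heq
    rw [Set.disjoint_left]
    intro ζ ha hb
    obtain rfl := eq_of_mem_Ω (mem_kube.1 ha).2.2 (mem_kube.1 hb).2.2
    exact h rfl
  · exact (key b a hlt).symm

theorem disjoint_tent (hR : 0 < R) {a b : T.Vertex} (hl : a.1 = b.1) (h : a ≠ b) :
    Disjoint (T.tent a) (T.tent b) := by
  rw [Set.disjoint_left]
  intro ζ ha hb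
  obtain ⟨c, hc, hζc⟩ := mem_tent.1 ha
  obtain ⟨c', hc', hζc'⟩ := mem_tent.1 hb
  by_cases hcc : c = c'
  · subst hcc
    exact h (eq_of_common_descendant hc hc' hl)
  · exact Set.disjoint_left.1 (disjoint_kube hR hcc) hζc hζc'

variable (T) in
/-- The vertices of level `n`. -/
noncomputable def vertices (n : ℕ) : Finset T.Vertex :=
  (Finset.univ : Finset (Fin (T.J n))).map ⟨fun j => (⟨n, j⟩ : T.Vertex), fun _ _ h =>
    eq_of_heq (Sigma.mk.inj h).2⟩

theorem mem_vertices {n : ℕ} {a : T.Vertex} : a ∈ T.vertices n ↔ a.1 = n := by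
  obtain ⟨m, j⟩ := a
  refine Finset.mem_map.trans ⟨?_, ?_⟩
  · rintro ⟨i, -, hi⟩; exact (Sigma.mk.inj hi).1.symm
  · rintro rfl; exact ⟨j, Finset.mem_univ _, rfl⟩

theorem card_vertices (n : ℕ) : (T.vertices n).card = T.J n := by simp [vertices]

open Classical in
variable (T) in
/-- The children of a vertex. -/
noncomputable def children (a : T.Vertex) : Finset T.Vertex :=
  (T.vertices (a.1 + 1)).filter (T.IsChild a)

theorem mem_children {a b : T.Vertex} : b ∈ T.children a ↔ T.IsChild a b := by
  simp only [children, Finset.mem_filter, mem_vertices, and_iff_right_iff_imp]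
  exact fun h => h.1

theorem tent_eq (a : T.Vertex) :
    T.tent a = T.kube a ∪ ⋃ b ∈ T.children a, T.tent b := by
  ext ζ
  simp only [Set.mem_union, Set.mem_iUnion, exists_prop, mem_children]
  constructor
  · intro h
    obtain ⟨b, hb, hζ⟩ := mem_tent.1 h
    rcases Relation.ReflTransGen.cases_head hb with rfl | ⟨c, hc, hcb⟩
    · exact Or.inl hζ
    · exact Or.inr ⟨c, hc, mem_tent.2 ⟨b, hcb, hζ⟩⟩
  · rintro (h | ⟨c, hc, h⟩)
    · exact kube_subset_tent .refl h
    · exact tent_subset_tent (.single hc) h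

theorem disjoint_kube_iUnion_tent (hR : 0 < R) (a : T.Vertex) :
    Disjoint (T.kube a) (⋃ b ∈ T.children a, T.tent b) := by
  simp only [Set.disjoint_iUnion_right]
  intro c hc
  rw [Set.disjoint_left]
  intro ζ hζ h
  obtain ⟨b, hb, hζb⟩ := mem_tent.1 h
  have hl := level_le hb
  have hl' := (mem_children.1 hc).1
  refine Set.disjoint_left.1 (disjoint_kube hR (a := a) (b := b) ?_) hζ hζb
  rintro rfl
  omega

/-- A tent splits into its top kube and the tents of its children. -/
theorem measure_tent (hR : 0 < R) (μ : Measure (E d)) (a : T.Vertex) :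
    μ (T.tent a) = μ (T.kube a) + ∑ b ∈ T.children a, μ (T.tent b) := by
  rw [tent_eq, measure_union (disjoint_kube_iUnion_tent hR a)
    (Finset.measurableSet_biUnion _ fun b _ => measurableSet_tent b),
    measure_biUnion_finset _ fun b _ => measurableSet_tent b]
  intro b hb c hc hbc
  exact disjoint_tent hR ((mem_children.1 hb).1.trans (mem_children.1 hc).1.symm) hbc

/-- Summation over the children of all vertices of a level is summation over the next level. -/
theorem sum_children (hR : 0 < R) (n : ℕ) {M : Type*} [AddCommMonoid M] (g : T.Vertex → M) :
    ∑ a ∈ T.vertices n, ∑ b ∈ T.children a, g b = ∑ b ∈ T.vertices (n + 1), g b := by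
  classical
  rw [← Finset.sum_biUnion]
  · congr 1
    ext b
    simp only [Finset.mem_biUnion, mem_vertices, mem_children]
    constructor
    · rintro ⟨a, rfl, h⟩; exact h.1
    · intro h
      obtain ⟨j, hj⟩ := exists_parent hR h
      exact ⟨_, rfl, hj⟩
  · intro a _ a' _ haa
    exact Finset.disjoint_left.2 fun b hb hb' =>
      haa (eq_of_isChild (mem_children.1 hb) (mem_children.1 hb'))

/-! ### Volumes of kubes and tents -/

theorem exists_z_eq_smul (hd : 1 ≤ d) (hR : 0 < R) (a : T.Vertex) :
    ∃ x : E d, ‖x‖ = 1 ∧ T.z a.1 a.2 = ((Real.tanh (a.1 * R) : ℝ) : ℂ) • x := by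
  rcases Nat.eq_zero_or_pos a.1 with h | h
  · obtain ⟨x, hx⟩ := exists_norm_eq_one hd
    obtain ⟨n, j⟩ := a
    obtain rfl : n = 0 := h
    refine ⟨x, hx, ?_⟩
    have := T.norm_z 0 j
    simp only [Nat.cast_zero, zero_mul, Real.tanh_zero, Complex.ofReal_zero, zero_smul] at this ⊢
    exact norm_eq_zero.1 this
  · exact ⟨T.dir a, norm_dir hR h, (tanh_smul_dir a).symm⟩

theorem mem_Ω_of_norm_lt (hδ : 0 < δ) {a : T.Vertex} {x ξ : E d}
    (hx : T.z a.1 a.2 = ((Real.tanh (a.1 * R) : ℝ) : ℂ) • x)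
    (hw : ‖((Real.tanh (a.1 * R) : ℝ) : ℂ) • ξ‖ = Real.tanh (a.1 * R))
    (h : Real.tanh (a.1 * R) ^ 2 * ‖(1 - inner ℂ x ξ : ℂ)‖ <
      (1 - Real.tanh (a.1 * R) ^ 2) * (Real.cosh δ - 1)) :
    ((Real.tanh (a.1 * R) : ℝ) : ℂ) • ξ ∈ T.Ω a.1 a.2 := by
  refine T.ball_subset_Ω _ _ ⟨?_, mem_bergmanSphere.2 hw⟩
  rw [mem_bergmanBall_of_norm_eq hδ (Real.tanh_lt_one (a.1 * R)) (T.norm_z _ _) hw, hx,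
    one_sub_smul_inner]
  have := norm_one_sub_mul_le (inner ℂ x ξ) (sq_nonneg (Real.tanh (a.1 * R)))
    (Real.tanh_sq_lt_one _).le
  linarith

theorem one_sub_tanh_sq_add_le (x y : ℝ) (hx : 0 ≤ x) (hy : 0 ≤ y) :
    1 - Real.tanh (x + y) ^ 2 ≤ (1 - Real.tanh x ^ 2) * (1 - Real.tanh y ^ 2) := by
  rw [one_sub_tanh_sq, one_sub_tanh_sq, one_sub_tanh_sq, ← mul_inv, ← mul_pow]
  have h1 := Real.cosh_pos x
  have h2 := Real.cosh_pos y
  have h3 : Real.cosh x * Real.cosh y ≤ Real.cosh (x + y) := by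
    rw [Real.cosh_add]
    have := mul_nonneg (Real.sinh_nonneg_iff.2 hx) (Real.sinh_nonneg_iff.2 hy)
    linarith
  gcongr

/-- Points of the ellipsoid around `s x`: their norm is close to `s`, and their direction is close
to `x`. -/
theorem norm_and_direction_of_mem_ellipsoid {x ζ : E d} (hx : ‖x‖ = 1) {s t τ : ℝ} (hs0 : 0 ≤ s)
    (hs1 : s ≤ 1) (hτ0 : 0 < τ) (hτ1 : τ ≤ 1) (ht0 : 0 ≤ t) (hts : t ^ 2 + 4 * τ < s ^ 2)
    (hζ : ζ ∈ ellipsoid ((s : ℂ) • x) x τ) :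
    |‖ζ‖ ^ 2 - s ^ 2| ≤ 4 * τ ∧ t ^ 2 * ‖(1 - inner ℂ x (direction ζ) : ℂ)‖ ≤ 5 * τ := by
  obtain ⟨α, v, hv, hα, hv2, he⟩ := exists_of_mem_ellipsoid hx hτ0 hζ
  have e : ζ = ((s : ℂ) + α) • x + v := by rw [he]; module
  have hin : (inner ℂ x ζ : ℂ) = (s : ℂ) + α := by
    rw [e, inner_add_right, hv, inner_smul_right, inner_self_eq_norm_sq_to_K, hx]; simp
  have hnorm : ‖ζ‖ ^ 2 = ‖(s : ℂ) + α‖ ^ 2 + ‖v‖ ^ 2 := by rw [e, norm_smul_add_sq hx hv]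
  have hsα : |‖(s : ℂ) + α‖ - s| ≤ τ := by
    have h1 := abs_norm_sub_norm_le ((s : ℂ) + α) (s : ℂ)
    rw [Complex.norm_real, Real.norm_of_nonneg hs0, add_sub_cancel_left] at h1
    linarith
  have hζs : |‖ζ‖ ^ 2 - s ^ 2| ≤ 4 * τ := by
    have hn0 := norm_nonneg ((s : ℂ) + α)
    have hn2 : ‖(s : ℂ) + α‖ + s ≤ 3 := by linarith [(abs_le.1 hsα).2]
    have hn3 : |‖(s : ℂ) + α‖ ^ 2 - s ^ 2| ≤ 3 * τ := by
      have : ‖(s : ℂ) + α‖ ^ 2 - s ^ 2 = (‖(s : ℂ) + α‖ + s) * (‖(s : ℂ) + α‖ - s) := by ring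
      rw [this, abs_mul, abs_of_nonneg (add_nonneg hn0 hs0)]
      exact mul_le_mul hn2 hsα (abs_nonneg _) (by norm_num)
    rw [abs_le] at hn3 ⊢
    have := sq_nonneg ‖v‖
    constructor <;> linarith
  refine ⟨hζs, ?_⟩
  have hts' : t ≤ s := by
    rw [← sq_le_sq₀ ht0 hs0]; linarith
  have hζ0 : 0 ≤ ‖ζ‖ := norm_nonneg _
  have hζt : t ≤ ‖ζ‖ := by
    rw [← sq_le_sq₀ ht0 hζ0]; linarith [(abs_le.1 hζs).1]
  have hstep : s * |‖ζ‖ - s| ≤ 4 * τ := by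
    refine le_trans ?_ hζs
    have : ‖ζ‖ ^ 2 - s ^ 2 = (‖ζ‖ + s) * (‖ζ‖ - s) := by ring
    rw [this, abs_mul, abs_of_nonneg (add_nonneg hζ0 hs0)]
    exact mul_le_mul_of_nonneg_right (by linarith) (abs_nonneg _)
  have hdir : ‖ζ‖ * ‖(1 - inner ℂ x (direction ζ) : ℂ)‖ ≤ |‖ζ‖ - s| + τ := by
    have h5 : ((‖ζ‖ : ℂ)) * (1 - inner ℂ x (direction ζ)) = ((‖ζ‖ - s : ℝ) : ℂ) - α := by
      have : (‖ζ‖ : ℂ) * inner ℂ x (direction ζ) = inner ℂ x ζ := by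
        rw [← inner_smul_right, norm_smul_direction]
      rw [mul_sub, this, hin]; push_cast; ring
    have h6 := congrArg norm h5
    rw [norm_mul, Complex.norm_real, norm_norm] at h6
    rw [h6]
    refine (norm_sub_le _ _).trans ?_
    rw [Complex.norm_real, Real.norm_eq_abs]
    linarith
  set q := ‖(1 - inner ℂ x (direction ζ) : ℂ)‖
  have hq : 0 ≤ q := norm_nonneg _
  have h7 : t * q ≤ |‖ζ‖ - s| + τ := (mul_le_mul_of_nonneg_right hζt hq).trans hdir
  have h8 : t * |‖ζ‖ - s| ≤ s * |‖ζ‖ - s| := mul_le_mul_of_nonneg_right hts' (abs_nonneg _)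
  calc t ^ 2 * q = t * (t * q) := by ring
    _ ≤ t * (|‖ζ‖ - s| + τ) := mul_le_mul_of_nonneg_left h7 ht0
    _ = t * |‖ζ‖ - s| + t * τ := by ring
    _ ≤ 5 * τ := by nlinarith

/-- The volume of a kube is bounded below by that of an ellipsoid of comparable size, centred over
the point `z_j^n`, which it contains. -/
theorem exists_le_nu_kube (hd : 1 ≤ d) (hR : 0 < R) (hδ : 0 < δ) :
    ∃ c : ℝ, 0 < c ∧ ∀ (T : BergmanTree d R δ) (a : T.Vertex),
      ENNReal.ofReal ((c * (1 - Real.tanh (a.1 * R) ^ 2)) ^ (d + 1)) ≤ nu d (T.kube a) := by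
  have hcosh : 0 < Real.cosh δ - 1 := sub_pos.2 (Real.one_lt_cosh.2 hδ.ne')
  have htR := tanh_pos hR
  have htR1 := Real.tanh_sq_lt_one R
  set m := min 1 (Real.cosh δ - 1) with hm
  have hm0 : 0 < m := lt_min one_pos hcosh
  have hm1 : m ≤ 1 := min_le_left _ _
  have hm2 : m ≤ Real.cosh δ - 1 := min_le_right _ _
  refine ⟨Real.tanh R ^ 2 * m / 16, by positivity, fun T a => ?_⟩
  obtain ⟨x, hx, hzx⟩ := exists_z_eq_smul hd hR a
  set t := Real.tanh (a.1 * R) with ht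
  set t' := Real.tanh ((a.1 + 1) * R) with ht'
  set h := 1 - t ^ 2 with hh
  have hh0 : 0 < h := one_sub_tanh_sq_pos _
  have hh1 : h ≤ 1 := one_sub_tanh_sq_le_one _
  have ht0 : 0 ≤ t := tanh_nonneg (by positivity)
  have ht1 : t < 1 := Real.tanh_lt_one _
  have ht'0 : 0 ≤ t' := tanh_nonneg (by positivity)
  have ht'1 : t' < 1 := Real.tanh_lt_one _
  have hgap : h * Real.tanh R ^ 2 ≤ t' ^ 2 - t ^ 2 := by
    have := one_sub_tanh_sq_add_le (a.1 * R) R (by positivity) hR.le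
    rw [← add_one_mul, ← ht, ← ht', ← hh] at this
    nlinarith
  set κ := Real.tanh R ^ 2
  have hκ : 0 < κ := by positivity
  set τ := κ * m / 16 * h with hτ
  have hτ0 : 0 < τ := by positivity
  have hκm : κ * m ≤ 1 := by nlinarith
  have hτ1 : τ ≤ 1 := by nlinarith [mul_pos hκ hm0]
  have hτgap : 16 * τ ≤ t' ^ 2 - t ^ 2 := by
    have : 16 * τ = h * κ * m := by rw [hτ]; ring
    nlinarith [mul_pos hh0 hκ]
  have hτδ : 16 * τ ≤ h * (Real.cosh δ - 1) := by
    have : 16 * τ = h * m * κ := by rw [hτ]; ring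
    nlinarith [mul_pos hh0 hm0]
  -- The ellipsoid is centred at `s x`, where `s²` is half-way between `t²` and `t'²`.
  set s := Real.sqrt ((t ^ 2 + t' ^ 2) / 2) with hs
  have hs0 : 0 ≤ s := Real.sqrt_nonneg _
  have hs2 : s ^ 2 = (t ^ 2 + t' ^ 2) / 2 := Real.sq_sqrt (by positivity)
  have hs1 : s ≤ 1 := by nlinarith
  refine le_nu_of_ellipsoid_subset (c := ((s : ℝ) : ℂ) • x) hx hτ0.le (kube_subset_unitBall a) ?_
  intro ζ hζ
  obtain ⟨hζs, hdir⟩ := norm_and_direction_of_mem_ellipsoid hx hs0 hs1 hτ0 hτ1 ht0 (by linarith) hζ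
  have h4 := abs_le.1 hζs
  have hζ0 : 0 ≤ ‖ζ‖ := norm_nonneg _
  have hζt : t < ‖ζ‖ := lt_of_pow_lt_pow_left₀ 2 hζ0 (by linarith)
  have hζne : ζ ≠ 0 := norm_pos_iff.1 (ht0.trans_lt hζt)
  refine mem_kube.2 ⟨hζt.le, lt_of_pow_lt_pow_left₀ 2 ht'0 (by linarith), ?_⟩
  rw [radialProj_eq]
  refine mem_Ω_of_norm_lt hδ hzx ?_ ?_
  · rw [norm_smul, norm_direction hζne, mul_one, Complex.norm_real, Real.norm_of_nonneg ht0]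
  · rw [← ht, ← hh]
    linarith

theorem one_div_sinh_sq {x : ℝ} (hx : 0 < x) :
    1 / Real.sinh x ^ 2 = (1 - Real.tanh x ^ 2) / Real.tanh x ^ 2 := by
  have := Real.cosh_pos x
  have := Real.sinh_pos_iff.2 hx
  rw [one_sub_tanh_sq, Real.tanh_eq_sinh_div_cosh]
  field_simp

theorem rho_dir_le_of_mem_Ω (hR : 0 < R) {C : ℝ} (hC : 0 < C * δ) {a : T.Vertex}
    (hΩ : T.Ω a.1 a.2 ⊆ bergmanBall (T.z a.1 a.2) (C * δ) ∩ bergmanSphere d (a.1 * R))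
    (ha : 1 ≤ a.1) {ξ : E d} (hξ : ‖ξ‖ = 1)
    (h : ((Real.tanh (a.1 * R) : ℝ) : ℂ) • ξ ∈ T.Ω a.1 a.2) :
    rho (T.dir a) ξ ≤ Real.sqrt (Real.cosh (C * δ)) / Real.sinh (a.1 * R) := by
  have ha' : (1 : ℝ) ≤ a.1 := by exact_mod_cast ha
  have haR : 0 < a.1 * R := by positivity
  have ht0 := tanh_pos haR
  have hsinh := Real.sinh_pos_iff.2 haR
  have h1 := hΩ h
  have h2 := (mem_bergmanBall_of_norm_eq hC (Real.tanh_lt_one (a.1 * R)) (T.norm_z _ _)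
    (mem_bergmanSphere.1 h1.2)).1 h1.1
  rw [← tanh_smul_dir, one_sub_smul_inner] at h2
  have h3 := mul_norm_one_sub_le (c := inner ℂ (T.dir a) ξ) (s := Real.tanh (a.1 * R) ^ 2)
    ((norm_inner_le_norm _ _).trans_eq (by rw [norm_dir hR ha, hξ, one_mul])) (sq_nonneg _)
    (Real.tanh_sq_lt_one _).le
  rw [← rho_sq] at h3
  have hc := Real.cosh_pos (C * δ)
  rw [← sq_le_sq₀ (rho_nonneg _ _) (by positivity), div_pow, Real.sq_sqrt hc.le,
    div_eq_mul_one_div, one_div_sinh_sq haR, mul_div_assoc', le_div_iff₀ (by positivity)]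
  linarith

theorem exp_mul_sinh_le {x y : ℝ} (hy : 0 ≤ y) :
    Real.exp y * Real.sinh x ≤ Real.sinh (x + y) := by
  rw [Real.sinh_add, ← Real.cosh_add_sinh]
  have h1 := Real.sinh_nonneg_iff.2 hy
  have h2 := Real.sinh_lt_cosh x
  nlinarith

/-- The unit vectors of the descendants of `a` stay close to that of `a`: the sizes of the pieces
decrease geometrically along a branch of the tree. -/
theorem exists_rho_dir_le (hR : 0 < R) (hδ : 0 < δ) (T : BergmanTree d R δ) :
    ∃ G : ℝ, 0 < G ∧ ∀ a b : T.Vertex, 1 ≤ a.1 → Relation.ReflTransGen T.IsChild a b →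
      ∀ ξ : E d, ‖ξ‖ = 1 → ((Real.tanh (b.1 * R) : ℝ) : ℂ) • ξ ∈ T.Ω b.1 b.2 →
      rho (T.dir a) ξ ≤ G / Real.sinh (a.1 * R) := by
  obtain ⟨C, hC, hΩ⟩ := T.Ω_subset_ball
  set K := Real.sqrt (Real.cosh (C * δ)) with hK
  have hK0 : 0 < K := Real.sqrt_pos.2 (Real.cosh_pos _)
  have he : 0 < 1 - Real.exp (-R) := sub_pos.2 (Real.exp_lt_one_iff.2 (by linarith))
  set G := K / (1 - Real.exp (-R)) with hG
  have hG0 : 0 < G := by positivity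
  have hKG : K = G * (1 - Real.exp (-R)) := by rw [hG]; field_simp
  have hsinh : ∀ a : T.Vertex, 1 ≤ a.1 → 0 < Real.sinh (a.1 * R) := fun a ha => by
    have ha' : (1 : ℝ) ≤ a.1 := by exact_mod_cast ha
    exact Real.sinh_pos_iff.2 (by positivity)
  have hstep : ∀ b : T.Vertex, 1 ≤ b.1 → ∀ ξ : E d, ‖ξ‖ = 1 →
      ((Real.tanh (b.1 * R) : ℝ) : ℂ) • ξ ∈ T.Ω b.1 b.2 →
      rho (T.dir b) ξ ≤ K / Real.sinh (b.1 * R) := fun b hb ξ hξ h =>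
    rho_dir_le_of_mem_Ω hR (by positivity) (hΩ _ _) hb hξ h
  have hdrift : ∀ a b : T.Vertex, 1 ≤ a.1 → Relation.ReflTransGen T.IsChild a b →
      rho (T.dir a) (T.dir b) ≤ G / Real.sinh (a.1 * R) - G / Real.sinh (b.1 * R) := by
    intro a b ha h
    induction h with
    | refl => rw [rho_self (norm_dir hR ha), sub_self]
    | @tail b c hab hbc ih =>
      have hb : 1 ≤ b.1 := ha.trans (level_le hab)
      obtain ⟨hcl, hcΩ⟩ := (isChild_iff hR).1 hbc
      have hc : 1 ≤ c.1 := by omega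
      have h1 := hstep b hb (T.dir c) (norm_dir hR hc) hcΩ
      have h2 := rho_triangle (norm_dir hR ha).le (norm_dir hR hb).le (norm_dir hR hc).le
      have h3 : Real.exp R * Real.sinh (b.1 * R) ≤ Real.sinh (c.1 * R) := by
        rw [hcl]; push_cast; rw [add_one_mul]; exact exp_mul_sinh_le hR.le
      have hsb := hsinh b hb
      have h4 : G / Real.sinh (c.1 * R) ≤ G * Real.exp (-R) / Real.sinh (b.1 * R) := by
        rw [div_le_div_iff₀ (hsinh c hc) hsb]
        have : Real.exp (-R) * Real.exp R = 1 := by rw [← Real.exp_add]; simp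
        calc G * Real.sinh (b.1 * R)
            = G * Real.exp (-R) * (Real.exp R * Real.sinh (b.1 * R)) := by
              linear_combination (-(G * Real.sinh (b.1 * R))) * this
          _ ≤ _ := by gcongr
      have h5 : K / Real.sinh (b.1 * R) =
          G / Real.sinh (b.1 * R) - G * Real.exp (-R) / Real.sinh (b.1 * R) := by
        rw [hKG]; ring
      linarith
  refine ⟨G, hG0, fun a b ha hab ξ hξ h => ?_⟩
  have hb : 1 ≤ b.1 := ha.trans (level_le hab)
  have h1 := hstep b hb ξ hξ h
  have h2 := hdrift a b ha hab
  have h3 := rho_triangle (norm_dir hR ha).le (norm_dir hR hb).le hξ.le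
  have h4 : K / Real.sinh (b.1 * R) ≤ G / Real.sinh (b.1 * R) := by
    have := hsinh b hb
    gcongr
    rw [hKG]
    nlinarith [Real.exp_pos (-R)]
  linarith

/-- A tent lies in a nonisotropic ball of comparable size around the unit vector of its vertex. -/
theorem exists_nu_tent_le (hR : 0 < R) (hδ : 0 < δ) (T : BergmanTree d R δ) :
    ∃ D : ℝ, 0 < D ∧ ∀ a : T.Vertex,
      nu d (T.tent a) ≤ ENNReal.ofReal ((D * (1 - Real.tanh (a.1 * R) ^ 2)) ^ (d + 1)) := by
  obtain ⟨G, hG, hdrift⟩ := exists_rho_dir_le hR hδ T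
  have htR := tanh_pos hR
  set D := 1 + G ^ 2 / Real.tanh R ^ 2 with hD
  have hD1 : 1 ≤ D := by rw [hD]; have : 0 < G ^ 2 / Real.tanh R ^ 2 := by positivity
                         linarith
  refine ⟨3 * D, by positivity, fun a => ?_⟩
  rcases Nat.eq_zero_or_pos a.1 with h0 | ha
  · rw [h0]
    simp only [Nat.cast_zero, zero_mul, Real.tanh_zero]
    refine prob_le_one.trans ?_
    rw [← ENNReal.ofReal_one]
    apply ENNReal.ofReal_le_ofReal
    apply one_le_pow₀
    norm_num
    linarith
  have ha' : (1 : ℝ) ≤ a.1 := by exact_mod_cast ha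
  have haR : 0 < a.1 * R := by positivity
  have hsinh := Real.sinh_pos_iff.2 haR
  have htR2 : Real.tanh R ≤ Real.tanh (a.1 * R) := tanh_le_tanh.2 (by nlinarith)
  set t := Real.tanh (a.1 * R) with ht
  have ht0 : 0 < t := tanh_pos haR
  have ht1 : t < 1 := Real.tanh_lt_one _
  have hh0 : 0 < 1 - t ^ 2 := one_sub_tanh_sq_pos _
  rw [mul_assoc]
  refine le_trans (measure_mono ?_) (nu_setOf_norm_one_sub_inner_le (norm_dir hR ha)
    (s := D * (1 - t ^ 2)) (by positivity))
  intro ζ hζ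
  refine ⟨tent_subset_unitBall a hζ, ?_⟩
  obtain ⟨b, hab, hζb⟩ := mem_tent.1 hζ
  have hk := mem_kube.1 hζb
  have hlev : (a.1 : ℝ) ≤ b.1 := by exact_mod_cast level_le hab
  have htζ : t ≤ ‖ζ‖ := le_trans (tanh_le_tanh.2 (by nlinarith)) hk.1
  have hζ1 : ‖ζ‖ < 1 := hk.2.1.trans (Real.tanh_lt_one _)
  have hζ0 : ζ ≠ 0 := norm_pos_iff.1 (ht0.trans_le htζ)
  have hΩ := hk.2.2
  rw [radialProj_eq] at hΩ
  have h1 := hdrift a b ha hab _ (norm_direction hζ0) hΩ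
  have h2 : rho (T.dir a) (direction ζ) ^ 2 ≤ G ^ 2 / Real.tanh R ^ 2 * (1 - t ^ 2) := by
    calc rho (T.dir a) (direction ζ) ^ 2 ≤ (G / Real.sinh (a.1 * R)) ^ 2 :=
          pow_le_pow_left₀ (rho_nonneg _ _) h1 2
      _ = G ^ 2 * ((1 - t ^ 2) / t ^ 2) := by
          rw [div_pow, div_eq_mul_one_div, one_div_sinh_sq haR]
      _ ≤ G ^ 2 * ((1 - t ^ 2) / Real.tanh R ^ 2) := by gcongr
      _ = _ := by ring
  rw [rho_sq] at h2
  have h3 := norm_one_sub_mul_le (inner ℂ (T.dir a) (direction ζ)) (norm_nonneg ζ) hζ1.le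
  rw [← inner_smul_right, norm_smul_direction] at h3
  have h4 : ‖ζ‖ * ‖(1 - inner ℂ (T.dir a) (direction ζ) : ℂ)‖ ≤
      ‖(1 - inner ℂ (T.dir a) (direction ζ) : ℂ)‖ :=
    mul_le_of_le_one_left (norm_nonneg _) hζ1.le
  have h5 : 1 - ‖ζ‖ ≤ 1 - t ^ 2 := by nlinarith
  have h6 : D * (1 - t ^ 2) = (1 - t ^ 2) + G ^ 2 / Real.tanh R ^ 2 * (1 - t ^ 2) := by
    rw [hD]; ring
  linarith

theorem nu_kube_pos (hd : 1 ≤ d) (hR : 0 < R) (hδ : 0 < δ) (a : T.Vertex) :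
    0 < nu d (T.kube a) := by
  obtain ⟨c, hc, h⟩ := exists_le_nu_kube (δ := δ) hd hR hδ
  refine lt_of_lt_of_le ?_ (h T a)
  rw [ENNReal.ofReal_pos]
  have := one_sub_tanh_sq_pos (a.1 * R)
  positivity

theorem nu_tent_pos (hd : 1 ≤ d) (hR : 0 < R) (hδ : 0 < δ) (a : T.Vertex) :
    0 < nu d (T.tent a) :=
  (nu_kube_pos hd hR hδ a).trans_le (measure_mono (kube_subset_tent .refl))

/-- The kubes are the major subsets that make the collection of tents sparse. -/
theorem exists_nu_tent_le_nu_kube (hd : 1 ≤ d) (hR : 0 < R) (hδ : 0 < δ)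
    (T : BergmanTree d R δ) : ∃ Λ : ℝ≥0, ∀ a : T.Vertex,
      nu d (T.tent a) ≤ Λ * nu d (T.kube a) := by
  obtain ⟨c, hc, hlow⟩ := exists_le_nu_kube (δ := δ) hd hR hδ
  obtain ⟨D, hD, hup⟩ := exists_nu_tent_le hR hδ T
  refine ⟨Real.toNNReal ((D / c) ^ (d + 1)), fun a => ?_⟩
  refine (hup a).trans (le_trans ?_ (mul_le_mul_right (hlow T a) _))
  have := one_sub_tanh_sq_pos (a.1 * R)
  rw [← ENNReal.ofReal, ← ENNReal.ofReal_mul (by positivity), ← mul_pow]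
  apply ENNReal.ofReal_le_ofReal
  apply le_of_eq
  congr 1
  field_simp

end BergmanTree

namespace BergmanTree

variable {R δ : ℝ} {T : BergmanTree d R δ}

/-! ### The Carleson embedding theorem on a tree -/

/-- The sum of `g` over the descendants of a vertex in the first `k` generations, the vertex
itself being the first one. -/
noncomputable def treeSum {M : Type*} [AddCommMonoid M] (g : T.Vertex → M) : ℕ → T.Vertex → M
  | 0, _ => 0
  | k + 1, a => g a + ∑ b ∈ T.children a, treeSum g k b

theorem treeSum_zero {M : Type*} [AddCommMonoid M] (g : T.Vertex → M) (a : T.Vertex) :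
    treeSum g 0 a = 0 := rfl

theorem treeSum_succ {M : Type*} [AddCommMonoid M] (g : T.Vertex → M) (k : ℕ) (a : T.Vertex) :
    treeSum g (k + 1) a = g a + ∑ b ∈ T.children a, treeSum g k b := rfl

theorem sum_treeSum (hR : 0 < R) {M : Type*} [AddCommMonoid M] (g : T.Vertex → M) (k n : ℕ) :
    ∑ a ∈ T.vertices n, treeSum g k a =
      ∑ i ∈ Finset.range k, ∑ a ∈ T.vertices (n + i), g a := by
  induction k generalizing n with
  | zero => simp [treeSum_zero]
  | succ k ih =>
    simp only [treeSum_succ]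
    rw [Finset.sum_add_distrib, sum_children hR, ih, Finset.sum_range_succ', add_comm, add_zero]
    congr 1
    refine Finset.sum_congr rfl fun i _ => ?_
    rw [show n + 1 + i = n + (i + 1) by ring]

theorem treeSum_nonneg {g : T.Vertex → ℝ} (hg : ∀ a, 0 ≤ g a) (k : ℕ) (a : T.Vertex) :
    0 ≤ treeSum g k a := by
  induction k generalizing a with
  | zero => exact le_rfl
  | succ k ih => exact add_nonneg (hg a) (Finset.sum_nonneg fun i _ => ih _)

theorem treeSum_mul_left (r : ℝ) (g : T.Vertex → ℝ) (k : ℕ) (a : T.Vertex) :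
    treeSum (fun b => r * g b) k a = r * treeSum g k a := by
  induction k generalizing a with
  | zero => simp [treeSum_zero]
  | succ k ih => simp only [treeSum_succ, ih, ← Finset.mul_sum, mul_add]

theorem treeSum_ne_top {g : T.Vertex → ℝ≥0∞} (hg : ∀ a, g a ≠ ∞) (k : ℕ) (a : T.Vertex) :
    treeSum g k a ≠ ∞ := by
  induction k generalizing a with
  | zero => simp [treeSum_zero]
  | succ k ih =>
    exact ENNReal.add_ne_top.2 ⟨hg a, (ENNReal.sum_ne_top.2 fun i _ => ih _)⟩

theorem treeSum_toReal {g : T.Vertex → ℝ≥0∞} (hg : ∀ a, g a ≠ ∞) (k : ℕ) (a : T.Vertex) :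
    treeSum (fun b => (g b).toReal) k a = (treeSum g k a).toReal := by
  induction k generalizing a with
  | zero => simp [treeSum_zero]
  | succ k ih =>
    rw [treeSum_succ, treeSum_succ, ENNReal.toReal_add (hg a)
      (ENNReal.sum_ne_top.2 fun i _ => treeSum_ne_top hg k _),
      ENNReal.toReal_sum fun i _ => treeSum_ne_top hg k _]
    simp only [ih]

/-- If the coefficients are controlled by the mass of the kubes, then sums over descendants are
controlled by the mass of the tent. -/
theorem treeSum_le_measure_tent (hR : 0 < R) (κ : Measure (E d)) {c : T.Vertex → ℝ≥0∞}
    (k : ℕ) (a : T.Vertex)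
    (h : ∀ b, Relation.ReflTransGen T.IsChild a b → c b ≤ κ (T.kube b)) :
    treeSum c k a ≤ κ (T.tent a) := by
  induction k generalizing a with
  | zero => exact bot_le
  | succ k ih =>
    rw [treeSum_succ, measure_tent hR]
    exact add_le_add (h a .refl) (Finset.sum_le_sum fun i hi =>
      ih _ fun b hb => h b (.head (mem_children.1 hi) hb))

/-- The Bellman function `4 (s - x² / (m + N))` of the dyadic Carleson embedding theorem dominates
the Carleson sums: it is superadditive in `(m, x, s, N)`, and raising `N` by `c` with
`m + N + c ≤ 2 m` raises it by at least `c (x / m)²`. -/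
theorem treeSum_le_bellman (hR : 0 < R) {μ μ₁ μ₂ : Measure (E d)} [IsFiniteMeasure μ]
    [IsFiniteMeasure μ₁] [IsFiniteMeasure μ₂]
    (hpos : ∀ a : T.Vertex, 0 < μ.real (T.kube a))
    (hCS : ∀ A, MeasurableSet A → μ₁.real A ^ 2 ≤ μ.real A * μ₂.real A)
    {c : T.Vertex → ℝ} (hc : ∀ a, 0 ≤ c a)
    (hN : ∀ k a, treeSum c k a ≤ μ.real (T.tent a)) (k : ℕ) (a : T.Vertex) :
    treeSum (fun b => c b * (μ₁.real (T.tent b) / μ.real (T.tent b)) ^ 2) k a ≤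
      4 * (μ₂.real (T.tent a) -
        μ₁.real (T.tent a) ^ 2 / (μ.real (T.tent a) + treeSum c k a)) := by
  have hmpos : ∀ a : T.Vertex, 0 < μ.real (T.tent a) := fun a =>
    (hpos a).trans_le (measureReal_mono (kube_subset_tent .refl))
  have hsplit : ∀ (ν : Measure (E d)) [IsFiniteMeasure ν] (a : T.Vertex), ν.real (T.tent a) =
      ν.real (T.kube a) + ∑ i ∈ T.children a, ν.real (T.tent i) := by
    intro ν _ a
    simp only [Measure.real]
    rw [measure_tent hR, ENNReal.toReal_add (measure_ne_top _ _)
      (ENNReal.sum_ne_top.2 fun i _ => measure_ne_top _ _),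
      ENNReal.toReal_sum fun i _ => measure_ne_top _ _]
  -- The tangent line estimate replaces the convexity of `x² / p`.
  have htangent : ∀ x p l : ℝ, 0 < p → 2 * l * x - l ^ 2 * p ≤ x ^ 2 / p := by
    intro x p l hp
    rw [le_div_iff₀ hp]
    nlinarith [sq_nonneg (x - l * p)]
  induction k generalizing a with
  | zero =>
    rw [treeSum_zero, treeSum_zero, add_zero]
    have h := hCS _ (measurableSet_tent a)
    have : μ₁.real (T.tent a) ^ 2 / μ.real (T.tent a) ≤ μ₂.real (T.tent a) := by
      rw [div_le_iff₀ (hmpos a)]; linarith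
    linarith
  | succ k ih =>
    have hNa := hN (k + 1) a
    rw [treeSum_succ] at hNa
    rw [treeSum_succ, treeSum_succ]
    set m := μ.real (T.tent a)
    set x := μ₁.real (T.tent a) with hx
    set s := μ₂.real (T.tent a) with hs
    set N := ∑ i ∈ T.children a, treeSum c k i
    have hm : 0 < m := hmpos a
    have hN0 : 0 ≤ N := Finset.sum_nonneg fun i _ => treeSum_nonneg hc k _
    set l := x / (m + N) with hl
    have h1 : ∑ i ∈ T.children a, treeSum
        (fun b => c b * (μ₁.real (T.tent b) / μ.real (T.tent b)) ^ 2) k i ≤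
        ∑ i ∈ T.children a, 4 * (μ₂.real (T.tent i) -
          (2 * l * μ₁.real (T.tent i) -
            l ^ 2 * (μ.real (T.tent i) + treeSum c k i))) := by
      refine Finset.sum_le_sum fun i _ => (ih i).trans ?_
      have := htangent (μ₁.real (T.tent i)) _ l
        (add_pos_of_pos_of_nonneg (hmpos i) (treeSum_nonneg hc k i))
      linarith
    rw [← Finset.mul_sum, Finset.sum_sub_distrib, Finset.sum_sub_distrib, ← Finset.mul_sum,
      ← Finset.mul_sum, Finset.sum_add_distrib] at h1
    have e0 := hsplit μ a
    have e1 := hsplit μ₁ a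
    have e2 := hsplit μ₂ a
    have h2 : 2 * l * μ₁.real (T.kube a) - l ^ 2 * μ.real (T.kube a) ≤ μ₂.real (T.kube a) := by
      refine (htangent _ _ l (hpos a)).trans ?_
      rw [div_le_iff₀ (hpos a)]
      linarith [hCS _ (measurableSet_kube a)]
    have h3 : 2 * l * x - l ^ 2 * (m + N) = x ^ 2 / (m + N) := by
      rw [hl]; field_simp; ring
    have h4 : c a * (x / m) ^ 2 ≤ 4 * (x ^ 2 / (m + N) - x ^ 2 / (m + (c a + N))) := by
      have hca := hc a
      have hp : 0 < m + N := by positivity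
      have hq : 0 < m + (c a + N) := by positivity
      have : x ^ 2 / (m + N) - x ^ 2 / (m + (c a + N)) =
          c a * x ^ 2 / ((m + N) * (m + (c a + N))) := by
        field_simp; ring
      rw [this, div_pow, ← mul_div_assoc, ← mul_div_assoc, div_le_div_iff₀ (by positivity)
        (by positivity)]
      have h5 : (m + N) * (m + (c a + N)) ≤ 4 * m ^ 2 := by nlinarith
      have h6 : 0 ≤ c a * x ^ 2 := by positivity
      nlinarith
    generalize ∑ i ∈ T.children a, treeSum
        (fun b => c b * (μ₁.real (T.tent b) / μ.real (T.tent b)) ^ 2) k i = Z at h1 ⊢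
    have h7 : 2 * l * x - l ^ 2 * (m + N) = (2 * l * μ₁.real (T.kube a) -
        l ^ 2 * μ.real (T.kube a)) + (2 * l * ∑ i ∈ T.children a, μ₁.real (T.tent i) -
        l ^ 2 * (∑ i ∈ T.children a, μ.real (T.tent i) + N)) := by
      change 2 * l * μ₁.real (T.tent a) - l ^ 2 * (μ.real (T.tent a) + N) = _
      rw [e0, e1]; ring
    have e2' : s = _ := e2
    linarith

/-- The Carleson embedding theorem for the tents of a Bergman tree: `μ₁` and `μ₂` play the role of
`f dμ` and `f² dμ`. -/
theorem tsum_carleson_le (hR : 0 < R) {μ μ₁ μ₂ : Measure (E d)} [IsFiniteMeasure μ]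
    [IsFiniteMeasure μ₁] [IsFiniteMeasure μ₂]
    (hpos : ∀ a : T.Vertex, μ (T.kube a) ≠ 0)
    (hCS : ∀ A, MeasurableSet A → μ₁ A ^ 2 ≤ μ A * μ₂ A)
    {c : T.Vertex → ℝ≥0∞} (hc : ∀ a, c a ≠ ∞) {A : ℝ≥0} (hA : 0 < A)
    (hN : ∀ k a, treeSum c k a ≤ A * μ (T.tent a)) :
    ∑' a : T.Vertex, c a * (μ₁ (T.tent a) / μ (T.tent a)) ^ 2 ≤
      4 * A * T.J 0 * μ₂ Set.univ := by
  have hm : ∀ a : T.Vertex, μ (T.tent a) ≠ 0 := fun a h =>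
    hpos a (measure_mono_null (kube_subset_tent .refl) h)
  set g : T.Vertex → ℝ≥0∞ := fun a => c a * (μ₁ (T.tent a) / μ (T.tent a)) ^ 2 with hg
  have hgtop : ∀ a, g a ≠ ∞ := fun a => ENNReal.mul_ne_top (hc a)
    (ENNReal.pow_ne_top (ENNReal.div_ne_top (measure_ne_top _ _) (hm a)))
  have hA' : (0 : ℝ) < A := hA
  have key : ∀ k (a : T.Vertex), treeSum g k a ≤ 4 * A * μ₂ (T.tent a) := by
    intro k a
    have hb := treeSum_le_bellman (T := T) hR (μ := μ) (μ₁ := μ₁) (μ₂ := μ₂)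
      (fun a => ENNReal.toReal_pos (hpos a) (measure_ne_top _ _))
      (fun B hB => by
        simp only [Measure.real]
        rw [← ENNReal.toReal_pow, ← ENNReal.toReal_mul]
        exact ENNReal.toReal_mono (ENNReal.mul_ne_top (measure_ne_top _ _) (measure_ne_top _ _))
          (hCS B hB))
      (c := fun b => (A : ℝ)⁻¹ * (c b).toReal) (fun b => by positivity)
      (fun k a => by
        rw [treeSum_mul_left, treeSum_toReal hc, inv_mul_le_iff₀ hA']
        have := ENNReal.toReal_mono (ENNReal.mul_ne_top ENNReal.coe_ne_top (measure_ne_top _ _))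
          (hN k a)
        simpa [Measure.real] using this) k a
    simp only [mul_assoc] at hb
    rw [treeSum_mul_left] at hb
    have hgr : treeSum (fun b => (c b).toReal * (μ₁.real (T.tent b) / μ.real (T.tent b)) ^ 2) k a =
        (treeSum g k a).toReal := by
      rw [← treeSum_toReal hgtop]
      congr 1
      ext b
      simp [hg, Measure.real]
    rw [hgr, inv_mul_le_iff₀ hA'] at hb
    have hNr : 0 ≤ treeSum (fun b => (A : ℝ)⁻¹ * (c b).toReal) k a :=
      treeSum_nonneg (fun b => by positivity) k a
    have hle : (treeSum g k a).toReal ≤ A * (4 * μ₂.real (T.tent a)) := by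
      refine hb.trans ?_
      have : 0 ≤ μ₁.real (T.tent a) ^ 2 / (μ.real (T.tent a) +
          treeSum (fun b => (A : ℝ)⁻¹ * (c b).toReal) k a) := by positivity
      gcongr
      linarith
    rw [← ENNReal.toReal_le_toReal (treeSum_ne_top hgtop k a)
      (ENNReal.mul_ne_top (ENNReal.mul_ne_top (by simp) (by simp)) (measure_ne_top _ _))]
    refine hle.trans_eq ?_
    simp [Measure.real]
    ring
  have hsum : ∑' a : T.Vertex, g a = ∑' n : ℕ, ∑ a ∈ T.vertices n, g a := by
    refine (ENNReal.tsum_sigma' (fun a : Σ n, Fin (T.J n) => g a)).trans (tsum_congr fun n => ?_)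
    rw [tsum_fintype, vertices, Finset.sum_map]
    rfl
  rw [hsum, ENNReal.tsum_eq_iSup_nat]
  refine iSup_le fun k => ?_
  have h1 := sum_treeSum (T := T) hR g k 0
  simp only [zero_add] at h1
  rw [← h1]
  calc ∑ a ∈ T.vertices 0, treeSum g k a
      ≤ ∑ _a ∈ T.vertices 0, 4 * A * μ₂ Set.univ := Finset.sum_le_sum fun a _ =>
        (key k a).trans (mul_le_mul_right (measure_mono (Set.subset_univ _)) _)
    _ = _ := by
        simp only [Finset.sum_const, card_vertices, nsmul_eq_mul]
        ring

end BergmanTree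

/-! ### Square-integral tools -/

theorem sq_eLpNorm_two {α ε : Type*} [MeasurableSpace α] [ENorm ε] (f : α → ε) (μ : Measure α) :
    eLpNorm f 2 μ ^ 2 = ∫⁻ x, ‖f x‖ₑ ^ 2 ∂μ := by
  have := eLpNorm_nnreal_pow_eq_lintegral (f := f) (μ := μ) (p := 2) (by norm_num)
  simpa using this

theorem lintegral_mul_le_eLpNorm_two {α : Type*} [MeasurableSpace α] {μ : Measure α}
    {f g : α → ℝ≥0∞} (hf : AEMeasurable f μ) (hg : AEMeasurable g μ) :
    ∫⁻ x, f x * g x ∂μ ≤ eLpNorm f 2 μ * eLpNorm g 2 μ := by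
  have h := ENNReal.lintegral_mul_le_Lp_mul_Lq μ Real.HolderConjugate.two_two hf hg
  have e : ∀ f : α → ℝ≥0∞, eLpNorm f 2 μ = (∫⁻ x, f x ^ (2 : ℝ) ∂μ) ^ (1 / 2 : ℝ) := by
    intro f
    rw [eLpNorm_eq_lintegral_rpow_enorm_toReal (by norm_num) (by norm_num)]
    simp
  rw [e, e]
  exact h

theorem sq_lintegral_mul_le {α : Type*} [MeasurableSpace α] {μ : Measure α}
    {f g : α → ℝ≥0∞} (hf : AEMeasurable f μ) (hg : AEMeasurable g μ) :
    (∫⁻ x, f x * g x ∂μ) ^ 2 ≤ (∫⁻ x, f x ^ 2 ∂μ) * ∫⁻ x, g x ^ 2 ∂μ := by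
  have h := pow_le_pow_left' (lintegral_mul_le_eLpNorm_two hf hg) 2
  rw [mul_pow, sq_eLpNorm_two, sq_eLpNorm_two] at h
  simpa using h

theorem sq_tsum_mul_le {ι : Type*} (f g : ι → ℝ≥0∞) :
    (∑' i, f i * g i) ^ 2 ≤ (∑' i, f i ^ 2) * ∑' i, g i ^ 2 := by
  let _ : MeasurableSpace ι := ⊤
  have h := sq_lintegral_mul_le (μ := (Measure.count : Measure ι)) (f := f) (g := g)
    (Measurable.of_discrete.aemeasurable) (Measurable.of_discrete.aemeasurable)
  simpa only [lintegral_count] using h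

/-! ### Weights -/

theorem nu_absolutelyContinuous : nu d ≪ (volume : Measure (E d)).restrict (unitBall d) :=
  Measure.smul_absolutelyContinuous

theorem IsWeight.aemeasurable {σ : E d → ℝ≥0} (h : IsWeight σ) :
    AEMeasurable (fun z => (σ z : ℝ≥0∞)) (nu d) := by
  have h1 := (h.locallyIntegrable.aestronglyMeasurable.mono_ac nu_absolutelyContinuous).aemeasurable
  have h2 := h1.ennreal_ofReal
  simpa using h2

theorem IsWeight.absolutelyContinuous {σ : E d → ℝ≥0} (h : IsWeight σ) : nu d ≪ weighted σ :=
  withDensity_absolutelyContinuous' h.aemeasurable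
    (h.pos.mono fun z hz => by simpa using hz.ne')

theorem weighted_absolutelyContinuous (σ : E d → ℝ≥0) : weighted σ ≪ nu d :=
  withDensity_absolutelyContinuous _ _

theorem avg_eq (σ : E d → ℝ≥0) {Q : Set (E d)} (hQ : MeasurableSet Q) :
    avg Q σ = (nu d Q)⁻¹ * weighted σ Q := by
  rw [avg, weighted, withDensity_apply _ hQ]

theorem weighted_eq_avg_mul (σ : E d → ℝ≥0) {Q : Set (E d)} (hQ : MeasurableSet Q)
    (h0 : nu d Q ≠ 0) : weighted σ Q = avg Q σ * nu d Q := by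
  rw [avg_eq σ hQ, mul_comm, ← mul_assoc, ENNReal.mul_inv_cancel h0 (measure_ne_top _ _), one_mul]

/-- The Orlicz average depends only on the values of the function on the set. -/
theorem orliczAvg_congr {Φ : ℝ≥0 → ℝ≥0} {Q : Set (E d)} (hQ : MeasurableSet Q)
    {f g : E d → ℝ≥0} (h : Set.EqOn f g Q) : orliczAvg Φ Q f = orliczAvg Φ Q g := by
  have : ∀ l : ℝ≥0, avg Q (fun z => Φ (f z / l)) = avg Q fun z => Φ (g z / l) := by
    intro l
    unfold avg
    rw [setLIntegral_congr_fun hQ fun z hz => by simp only; rw [h hz]]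
  simp only [orliczAvg, this]

/-- `σ^{1/2}` on a set and `0` outside, with complex values as in the definition of the maximal
operator. -/
noncomputable def sqrtOn (σ : E d → ℝ≥0) (Q : Set (E d)) (z : E d) : ℂ :=
  Q.indicator (fun z => ((NNReal.sqrt (σ z) : ℝ) : ℂ)) z

theorem nnnorm_sqrtOn {σ : E d → ℝ≥0} {Q : Set (E d)} {z : E d} (hz : z ∈ Q) :
    ‖sqrtOn σ Q z‖₊ = NNReal.sqrt (σ z) := by
  rw [sqrtOn, Set.indicator_of_mem hz]
  ext
  simp

theorem sq_eLpNorm_sqrtOn (σ : E d → ℝ≥0) {Q : Set (E d)} (hQ : MeasurableSet Q) :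
    eLpNorm (sqrtOn σ Q) 2 (nu d) ^ 2 = weighted σ Q := by
  rw [sq_eLpNorm_two, weighted, withDensity_apply _ hQ, ← lintegral_indicator hQ]
  congr 1
  ext z
  by_cases hz : z ∈ Q
  · rw [Set.indicator_of_mem hz, ← ofReal_norm, ← coe_nnnorm, nnnorm_sqrtOn hz,
      ENNReal.ofReal_coe_nnreal, ← ENNReal.coe_pow, NNReal.sq_sqrt]
  · rw [Set.indicator_of_notMem hz, sqrtOn, Set.indicator_of_notMem hz]; simp

theorem memLp_sqrtOn {σ : E d → ℝ≥0} (h : IsWeight σ) {Q : Set (E d)} (hQ : MeasurableSet Q)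
    (hfin : weighted σ Q ≠ ∞) : MemLp (sqrtOn σ Q) 2 (nu d) := by
  refine ⟨?_, ?_⟩
  · refine AEStronglyMeasurable.indicator ?_ hQ
    have h1 : AEMeasurable σ (nu d) := by simpa using h.aemeasurable.ennreal_toNNReal
    exact (Complex.measurable_ofReal.comp_aemeasurable
      (measurable_coe_nnreal_real.comp_aemeasurable
        (NNReal.continuous_sqrt.measurable.comp_aemeasurable h1))).aestronglyMeasurable
  · by_contra hc
    rw [not_lt, top_le_iff] at hc
    rw [← sq_eLpNorm_sqrtOn σ hQ, hc] at hfin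
    simp at hfin

/-- The Orlicz maximal function of `σ^{1/2} 1_Q` has square integral controlled by `σ(Q)`. -/
theorem lintegral_sq_orliczMaximal_le {𝒯 : Set (Set (E d))} {Φ : ℝ≥0 → ℝ≥0} {A : ℝ≥0}
    (hA : ∀ f : E d → ℂ, MemLp f 2 (nu d) →
      eLpNorm (orliczMaximal Φ 𝒯 f) 2 (nu d) ≤ A * eLpNorm f 2 (nu d))
    {σ : E d → ℝ≥0} (h : IsWeight σ) {Q : Set (E d)} (hQ : MeasurableSet Q)
    (hfin : weighted σ Q ≠ ∞) :
    ∫⁻ z, orliczMaximal Φ 𝒯 (sqrtOn σ Q) z ^ 2 ∂(nu d) ≤ A ^ 2 * weighted σ Q := by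
  have h1 := pow_le_pow_left' (hA _ (memLp_sqrtOn h hQ hfin)) 2
  rw [mul_pow, sq_eLpNorm_sqrtOn σ hQ, sq_eLpNorm_two] at h1
  simpa using h1

theorem orliczAvg_le_orliczMaximal {𝒯 : Set (Set (E d))} {Φ : ℝ≥0 → ℝ≥0} {σ : E d → ℝ≥0}
    {Q Q' : Set (E d)} (hQ' : Q' ∈ 𝒯) (hm : MeasurableSet Q') (hsub : Q' ⊆ Q) {z : E d}
    (hz : z ∈ Q') :
    orliczAvg Φ Q' (fun z => NNReal.sqrt (σ z)) ≤ orliczMaximal Φ 𝒯 (sqrtOn σ Q) z := by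
  refine le_trans ?_ (le_iSup₂ (f := fun Q _ => Set.indicator Q
    (fun _ => orliczAvg Φ Q fun ζ => ‖sqrtOn σ _ ζ‖₊) z) Q' hQ')
  rw [Set.indicator_of_mem hz]
  refine (orliczAvg_congr hm fun ζ hζ => ?_).le
  exact (nnnorm_sqrtOn (hsub hζ)).symm

theorem orliczAvg_ne_top {𝒯 : Set (Set (E d))} {Φ : ℝ≥0 → ℝ≥0} (hΦ : MaximalBounded Φ 𝒯)
    {σ : E d → ℝ≥0} (h : IsWeight σ) {Q : Set (E d)} (hQ𝒯 : Q ∈ 𝒯) (hQ : MeasurableSet Q)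
    (h0 : nu d Q ≠ 0) (hfin : weighted σ Q ≠ ∞) :
    orliczAvg Φ Q (fun z => NNReal.sqrt (σ z)) ≠ ∞ := by
  obtain ⟨A, hA⟩ := hΦ
  have h1 := lintegral_sq_orliczMaximal_le hA h hQ hfin
  have h2 : ∫⁻ _z in Q, orliczAvg Φ Q (fun z => NNReal.sqrt (σ z)) ^ 2 ∂(nu d) ≤
      A ^ 2 * weighted σ Q := by
    refine le_trans ?_ (le_trans (setLIntegral_le_lintegral Q _) h1)
    exact setLIntegral_mono' hQ fun z hz =>
      pow_le_pow_left' (orliczAvg_le_orliczMaximal hQ𝒯 hQ subset_rfl hz) 2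
  rw [setLIntegral_const] at h2
  intro htop
  rw [htop, ENNReal.top_pow two_ne_zero, ENNReal.top_mul h0, top_le_iff] at h2
  exact ENNReal.mul_ne_top (by simp) hfin h2

/-! ### The bump condition -/

/-- A finite bump forces both weights to be integrable on every tent and gives the joint bound on
the averages. -/
theorem avg_mul_avg_le {𝒯 : Set (Set (E d))} {Φ Ψ : ℝ≥0 → ℝ≥0} (hΦ : MaximalBounded Φ 𝒯)
    (hΨ : MaximalBounded Ψ 𝒯) {w σ : E d → ℝ≥0} (hw : IsWeight w) (hσ : IsWeight σ)
    (hB : bump 𝒯 Φ Ψ w σ ≠ ∞) {Q : Set (E d)} (hQ𝒯 : Q ∈ 𝒯) (hQ : MeasurableSet Q)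
    (h0 : nu d Q ≠ 0) :
    weighted w Q ≠ ∞ ∧ weighted σ Q ≠ ∞ ∧ avg Q w * avg Q σ ≤ bump 𝒯 Φ Ψ w σ *
      (orliczAvg Φ Q (fun z => NNReal.sqrt (w z)) * orliczAvg Ψ Q fun z => NNReal.sqrt (σ z)) := by
  have hle : bumpQuotient Φ Q w * bumpQuotient Ψ Q σ ≤ bump 𝒯 Φ Ψ w σ :=
    le_iSup₂ (f := fun Q _ => bumpQuotient Φ Q w * bumpQuotient Ψ Q σ) Q hQ𝒯
  have hne := ne_top_of_le_ne_top hB hle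
  have hinv : (nu d Q)⁻¹ ≠ ∞ := ENNReal.inv_ne_top.2 h0
  have havg0 : ∀ {v : E d → ℝ≥0}, IsWeight v → avg Q v ≠ 0 := fun {v} hv => by
    rw [avg_eq v hQ]
    exact mul_ne_zero (ENNReal.inv_ne_zero.2 (measure_ne_top _ _))
      fun h => h0 (hv.absolutelyContinuous h)
  have hfin : ∀ {v : E d → ℝ≥0}, avg Q v ≠ ∞ → weighted v Q ≠ ∞ := fun {v} hv => by
    rw [weighted_eq_avg_mul v hQ h0]
    exact ENNReal.mul_ne_top hv (measure_ne_top _ _)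
  have hq0 : ∀ {v : E d → ℝ≥0} {Θ : ℝ≥0 → ℝ≥0}, IsWeight v → MaximalBounded Θ 𝒯 →
      bumpQuotient Θ Q v ≠ 0 := fun {v Θ} hv hΘ => by
    unfold bumpQuotient
    split_ifs with h
    · simp
    · exact ENNReal.div_ne_zero.2 ⟨havg0 hv, orliczAvg_ne_top hΘ hv hQ𝒯 hQ h0 (hfin h)⟩
  have hqw : bumpQuotient Φ Q w ≠ ∞ := fun h => hne (by rw [h, ENNReal.top_mul (hq0 hσ hΨ)])
  have hqσ : bumpQuotient Ψ Q σ ≠ ∞ := fun h => hne (by rw [h, ENNReal.mul_top (hq0 hw hΦ)])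
  have hdecomp : ∀ {v : E d → ℝ≥0} {Θ : ℝ≥0 → ℝ≥0}, IsWeight v → MaximalBounded Θ 𝒯 →
      bumpQuotient Θ Q v ≠ ∞ → weighted v Q ≠ ∞ ∧
        avg Q v = bumpQuotient Θ Q v * orliczAvg Θ Q fun z => NNReal.sqrt (v z) := by
    intro v Θ hv hΘ hq
    have hav : avg Q v ≠ ∞ := fun h => hq (by rw [bumpQuotient, if_pos h])
    refine ⟨hfin hav, ?_⟩
    rw [bumpQuotient, if_neg hav] at hq ⊢
    refine (ENNReal.div_mul_cancel ?_ (orliczAvg_ne_top hΘ hv hQ𝒯 hQ h0 (hfin hav))).symm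
    intro h
    rw [h, ENNReal.div_zero (havg0 hv)] at hq
    exact hq rfl
  obtain ⟨hw1, hw2⟩ := hdecomp hw hΦ hqw
  obtain ⟨hσ1, hσ2⟩ := hdecomp hσ hΨ hqσ
  refine ⟨hw1, hσ1, ?_⟩
  rw [hw2, hσ2]
  calc bumpQuotient Φ Q w * orliczAvg Φ Q (fun z => NNReal.sqrt (w z)) *
        (bumpQuotient Ψ Q σ * orliczAvg Ψ Q fun z => NNReal.sqrt (σ z))
      = bumpQuotient Φ Q w * bumpQuotient Ψ Q σ * (orliczAvg Φ Q (fun z => NNReal.sqrt (w z)) *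
          orliczAvg Ψ Q fun z => NNReal.sqrt (σ z)) := by ring
    _ ≤ _ := by gcongr

namespace BergmanTree

variable {R δ : ℝ}

/-- The Carleson embedding theorem for the coefficients `⟨σ^{1/2}⟩²_{Φ,Q} ν(Q)`: their Carleson
condition is the `L²` bound of the maximal operator tested on `σ^{1/2} 1_Q`. -/
theorem exists_tsum_orliczAvg_le (hd : 1 ≤ d) (hR : 0 < R) (hδ : 0 < δ) (T : BergmanTree d R δ)
    {𝒯 : Set (Set (E d))} (hT : ∀ a : T.Vertex, T.tent a ∈ 𝒯) {Φ : ℝ≥0 → ℝ≥0}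
    (hΦ : MaximalBounded Φ 𝒯) : ∃ K : ℝ≥0, ∀ σ : E d → ℝ≥0, IsWeight σ →
      weighted σ Set.univ ≠ ∞ → ∀ F : E d → ℝ≥0∞, AEMeasurable F (weighted σ) →
      ∫⁻ z, F z ^ 2 ∂(weighted σ) ≠ ∞ →
      ∑' a : T.Vertex, orliczAvg Φ (T.tent a) (fun z => NNReal.sqrt (σ z)) ^ 2 * nu d (T.tent a) *
        ((∫⁻ z in T.tent a, F z ∂(weighted σ)) / weighted σ (T.tent a)) ^ 2 ≤
        K * ∫⁻ z, F z ^ 2 ∂(weighted σ) := by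
  obtain ⟨Λ, hΛ⟩ := exists_nu_tent_le_nu_kube hd hR hδ T
  have hΦ' := hΦ
  obtain ⟨A, hA⟩ := hΦ'
  refine ⟨4 * (Λ * A ^ 2 + 1) * T.J 0, fun σ hσ hfin F hF hF2 => ?_⟩
  have hfinite : IsFiniteMeasure (weighted σ) := ⟨lt_top_iff_ne_top.2 hfin⟩
  set μ := weighted σ with hμ
  have hF1 : ∫⁻ z, F z ∂μ ≠ ∞ := by
    have h := sq_lintegral_mul_le hF (aemeasurable_const (b := (1 : ℝ≥0∞)))
    simp only [mul_one, one_pow, lintegral_const, one_mul] at h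
    intro htop
    rw [htop, ENNReal.top_pow two_ne_zero, top_le_iff] at h
    exact ENNReal.mul_ne_top hF2 hfin h
  have := isFiniteMeasure_withDensity hF1
  have := isFiniteMeasure_withDensity (μ := μ) (f := fun z => F z ^ 2) hF2
  have hpos : ∀ a : T.Vertex, nu d (T.kube a) ≠ 0 := fun a => (nu_kube_pos hd hR hδ a).ne'
  have hpos' : ∀ a : T.Vertex, nu d (T.tent a) ≠ 0 := fun a => (nu_tent_pos hd hR hδ a).ne'
  have h := tsum_carleson_le (T := T) hR (μ := μ) (μ₁ := μ.withDensity F)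
    (μ₂ := μ.withDensity fun z => F z ^ 2)
    (fun a ha => hpos a (hσ.absolutelyContinuous ha))
    (fun B hB => by
      rw [withDensity_apply _ hB, withDensity_apply _ hB, mul_comm]
      have h := sq_lintegral_mul_le (μ := μ.restrict B) hF.restrict
        (aemeasurable_const (b := (1 : ℝ≥0∞)))
      simpa using h)
    (c := fun a => orliczAvg Φ (T.tent a) (fun z => NNReal.sqrt (σ z)) ^ 2 * nu d (T.tent a))
    (fun a => ENNReal.mul_ne_top (ENNReal.pow_ne_top (orliczAvg_ne_top hΦ hσ (hT a)
      (measurableSet_tent a) (hpos' a) (measure_ne_top _ _))) (measure_ne_top _ _))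
    (A := Λ * A ^ 2 + 1) (by positivity)
    (fun k a => by
      set M := orliczMaximal Φ 𝒯 (sqrtOn σ (T.tent a))
      have h1 := treeSum_le_measure_tent (T := T) hR
        (Λ • (nu d).withDensity fun z => M z ^ 2)
        (c := fun a => orliczAvg Φ (T.tent a) (fun z => NNReal.sqrt (σ z)) ^ 2 * nu d (T.tent a))
        k a (fun b hab => by
          rw [Measure.smul_apply, withDensity_apply _ (measurableSet_kube b)]
          calc orliczAvg Φ (T.tent b) (fun z => NNReal.sqrt (σ z)) ^ 2 * nu d (T.tent b)
              ≤ orliczAvg Φ (T.tent b) (fun z => NNReal.sqrt (σ z)) ^ 2 *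
                  (Λ * nu d (T.kube b)) := by gcongr; exact hΛ b
            _ = Λ * ∫⁻ _z in T.kube b,
                  orliczAvg Φ (T.tent b) (fun z => NNReal.sqrt (σ z)) ^ 2 ∂(nu d) := by
                rw [setLIntegral_const]; ring
            _ ≤ Λ * ∫⁻ z in T.kube b, M z ^ 2 ∂(nu d) := by
                refine mul_le_mul_right (setLIntegral_mono' (measurableSet_kube b) fun z hz => ?_) _
                exact pow_le_pow_left' (orliczAvg_le_orliczMaximal (hT b) (measurableSet_tent b)
                  (tent_subset_tent hab) (kube_subset_tent .refl hz)) 2)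
      refine h1.trans ?_
      rw [Measure.smul_apply, withDensity_apply _ (measurableSet_tent a)]
      calc (Λ : ℝ≥0∞) * ∫⁻ z in T.tent a, M z ^ 2 ∂(nu d)
          ≤ Λ * (A ^ 2 * weighted σ (T.tent a)) :=
            mul_le_mul_right ((setLIntegral_le_lintegral _ _).trans
              (lintegral_sq_orliczMaximal_le hA hσ (measurableSet_tent a) (measure_ne_top _ _))) _
        _ ≤ (Λ * A ^ 2 + 1) * μ (T.tent a) := by
            rw [← mul_assoc]; gcongr; exact le_self_add
        _ = _ := by push_cast; rfl)
  refine le_trans (le_of_eq ?_) (h.trans (le_of_eq ?_))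
  · refine tsum_congr fun a => ?_
    rw [withDensity_apply _ (measurableSet_tent a)]
  · rw [withDensity_apply _ MeasurableSet.univ, Measure.restrict_univ]
    push_cast
    rfl

/-- The bilinear estimate for the positive dyadic operator of a tree. -/
theorem exists_bilinear_le (hd : 1 ≤ d) (hR : 0 < R) (hδ : 0 < δ) (T : BergmanTree d R δ)
    {𝒯 : Set (Set (E d))} (hT : ∀ a : T.Vertex, T.tent a ∈ 𝒯) {Φ Ψ : ℝ≥0 → ℝ≥0}
    (hΦ : MaximalBounded Φ 𝒯) (hΨ : MaximalBounded Ψ 𝒯) : ∃ K : ℝ≥0,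
      ∀ σ w : E d → ℝ≥0, IsWeight σ → IsWeight w → weighted σ Set.univ ≠ ∞ →
      weighted w Set.univ ≠ ∞ → bump 𝒯 Φ Ψ w σ ≠ ∞ →
      ∀ F G : E d → ℝ≥0∞, AEMeasurable F (weighted σ) → AEMeasurable G (weighted w) →
      eLpNorm F 2 (weighted σ) ≠ ∞ → eLpNorm G 2 (weighted w) ≠ ∞ →
      ∑' a : T.Vertex, (∫⁻ z in T.tent a, F z ∂(weighted σ)) / nu d (T.tent a) *
        ∫⁻ z in T.tent a, G z ∂(weighted w) ≤
        K * bump 𝒯 Φ Ψ w σ * eLpNorm F 2 (weighted σ) * eLpNorm G 2 (weighted w) := by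
  obtain ⟨K₁, hK₁⟩ := exists_tsum_orliczAvg_le hd hR hδ T hT hΨ
  obtain ⟨K₂, hK₂⟩ := exists_tsum_orliczAvg_le hd hR hδ T hT hΦ
  refine ⟨K₁ + K₂, fun σ w hσ hw hσfin hwfin hB F G hF hG hF2 hG2 => ?_⟩
  have hfσ : IsFiniteMeasure (weighted σ) := ⟨lt_top_iff_ne_top.2 hσfin⟩
  have hfw : IsFiniteMeasure (weighted w) := ⟨lt_top_iff_ne_top.2 hwfin⟩
  set B := bump 𝒯 Φ Ψ w σ
  have h2 : ∀ {α : Type _} [MeasurableSpace α] (μ : Measure α) (F : α → ℝ≥0∞),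
      ∫⁻ z, F z ^ 2 ∂μ = eLpNorm F 2 μ ^ 2 := by
    intro α _ μ F; rw [sq_eLpNorm_two]; rfl
  have hs₁ := hK₁ σ hσ hσfin F hF (by rw [h2]; exact ENNReal.pow_ne_top hF2)
  have hs₂ := hK₂ w hw hwfin G hG (by rw [h2]; exact ENNReal.pow_ne_top hG2)
  rw [h2] at hs₁ hs₂
  set f : T.Vertex → ℝ≥0∞ := fun a => orliczAvg Ψ (T.tent a) (fun z => NNReal.sqrt (σ z)) *
    nu d (T.tent a) ^ (1 / 2 : ℝ) *
    ((∫⁻ z in T.tent a, F z ∂(weighted σ)) / weighted σ (T.tent a)) with hf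
  set g : T.Vertex → ℝ≥0∞ := fun a => orliczAvg Φ (T.tent a) (fun z => NNReal.sqrt (w z)) *
    nu d (T.tent a) ^ (1 / 2 : ℝ) *
    ((∫⁻ z in T.tent a, G z ∂(weighted w)) / weighted w (T.tent a)) with hg
  have hhalf : ∀ x : ℝ≥0∞, (x ^ (1 / 2 : ℝ)) ^ 2 = x := by
    intro x
    rw [← ENNReal.rpow_natCast, ← ENNReal.rpow_mul]
    norm_num
  have hterm : ∀ a : T.Vertex, (∫⁻ z in T.tent a, F z ∂(weighted σ)) / nu d (T.tent a) *
      ∫⁻ z in T.tent a, G z ∂(weighted w) ≤ B * (f a * g a) := by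
    intro a
    have hm := measurableSet_tent a
    have h0 : nu d (T.tent a) ≠ 0 := (nu_tent_pos hd hR hδ a).ne'
    obtain ⟨hwt, hσt, hle⟩ := avg_mul_avg_le hΦ hΨ hw hσ hB (hT a) hm h0
    set X := ∫⁻ z in T.tent a, F z ∂(weighted σ)
    set Y := ∫⁻ z in T.tent a, G z ∂(weighted w)
    have hσ0 : weighted σ (T.tent a) ≠ 0 := fun h => h0 (hσ.absolutelyContinuous h)
    have hw0 : weighted w (T.tent a) ≠ 0 := fun h => h0 (hw.absolutelyContinuous h)
    have eX : X = X / weighted σ (T.tent a) * (avg (T.tent a) σ * nu d (T.tent a)) := by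
      rw [← weighted_eq_avg_mul σ hm h0, ENNReal.div_mul_cancel hσ0 hσt]
    have eY : Y = Y / weighted w (T.tent a) * (avg (T.tent a) w * nu d (T.tent a)) := by
      rw [← weighted_eq_avg_mul w hm h0, ENNReal.div_mul_cancel hw0 hwt]
    set x := X / weighted σ (T.tent a)
    set y := Y / weighted w (T.tent a)
    have hn := hhalf (nu d (T.tent a))
    calc X / nu d (T.tent a) * Y
        = x * avg (T.tent a) σ * (nu d (T.tent a) / nu d (T.tent a)) *
            (y * (avg (T.tent a) w * nu d (T.tent a))) := by
          rw [eX, eY]; simp only [div_eq_mul_inv]; ring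
      _ = x * y * nu d (T.tent a) * (avg (T.tent a) w * avg (T.tent a) σ) := by
          rw [ENNReal.div_self h0 (measure_ne_top _ _)]; ring
      _ ≤ x * y * nu d (T.tent a) * (B * (orliczAvg Φ (T.tent a) (fun z => NNReal.sqrt (w z)) *
            orliczAvg Ψ (T.tent a) fun z => NNReal.sqrt (σ z))) := by gcongr
      _ = B * (f a * g a) := by
          conv_lhs => rw [← hn]
          simp only [hf, hg]
          ring
  have hCS := sq_tsum_mul_le f g
  have ef : ∑' a, f a ^ 2 ≤ K₁ * eLpNorm F 2 (weighted σ) ^ 2 := by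
    refine le_trans (le_of_eq (tsum_congr fun a => ?_)) hs₁
    simp only [hf, mul_pow, hhalf]
  have eg : ∑' a, g a ^ 2 ≤ K₂ * eLpNorm G 2 (weighted w) ^ 2 := by
    refine le_trans (le_of_eq (tsum_congr fun a => ?_)) hs₂
    simp only [hg, mul_pow, hhalf]
  have hfg : ∑' a, f a * g a ≤ (K₁ + K₂) * (eLpNorm F 2 (weighted σ) * eLpNorm G 2 (weighted w)) := by
    refine (ENNReal.pow_le_pow_left_iff two_ne_zero).1 (hCS.trans ((mul_le_mul' ef eg).trans ?_))
    calc (K₁ : ℝ≥0∞) * eLpNorm F 2 (weighted σ) ^ 2 * (K₂ * eLpNorm G 2 (weighted w) ^ 2)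
        = (K₁ * K₂) * (eLpNorm F 2 (weighted σ) * eLpNorm G 2 (weighted w)) ^ 2 := by ring
      _ ≤ ((K₁ + K₂) * (K₁ + K₂)) * (eLpNorm F 2 (weighted σ) * eLpNorm G 2 (weighted w)) ^ 2 := by
          gcongr
          · exact le_self_add
          · exact le_add_self
      _ = _ := by ring
  calc _ ≤ ∑' a, B * (f a * g a) := ENNReal.tsum_le_tsum hterm
    _ = B * ∑' a, f a * g a := ENNReal.tsum_mul_left
    _ ≤ B * ((K₁ + K₂) * (eLpNorm F 2 (weighted σ) * eLpNorm G 2 (weighted w))) := by gcongr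
    _ = _ := by push_cast; ring

end BergmanTree

/-! ### Domination of the Bergman kernel by tents -/

theorem one_sub_norm_le_norm_one_sub_inner {z ζ : E d} (hζ : ‖ζ‖ ≤ 1) :
    1 - ‖z‖ ≤ ‖(1 - inner ℂ ζ z : ℂ)‖ := by
  have h1 : 1 - ‖(inner ℂ ζ z : ℂ)‖ ≤ ‖(1 - inner ℂ ζ z : ℂ)‖ := by
    simpa using norm_sub_norm_le (1 : ℂ) (inner ℂ ζ z)
  have h2 := norm_inner_le_norm (𝕜 := ℂ) ζ z
  nlinarith [norm_nonneg z]

theorem one_sub_inner_ne_zero {z ζ : E d} (hz : z ∈ unitBall d) (hζ : ζ ∈ unitBall d) :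
    (1 - inner ℂ ζ z : ℂ) ≠ 0 := by
  intro h
  have := one_sub_norm_le_norm_one_sub_inner (z := z) (mem_unitBall.1 hζ).le
  rw [h, norm_zero] at this
  linarith [mem_unitBall.1 hz]

theorem carlesonTent_zero : carlesonTent (0 : E d) = unitBall d := by simp [carlesonTent]

theorem mem_carlesonTent {z ζ : E d} (hz : z ≠ 0) : ζ ∈ carlesonTent z ↔
    ζ ∈ unitBall d ∧ ‖(1 - inner ℂ (direction z) ζ : ℂ)‖ ≤ 1 - ‖z‖ := by
  rw [carlesonTent, if_neg hz]; rfl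

theorem inner_direction_self (z : E d) : (inner ℂ (direction z) z : ℂ) = ‖z‖ := by
  rcases eq_or_ne z 0 with rfl | hz
  · simp
  have h : (inner ℂ (direction z) ((‖z‖ : ℂ) • direction z) : ℂ) = ‖z‖ := by
    rw [inner_smul_right, inner_self_eq_norm_sq_to_K, norm_direction hz]; simp
  rwa [norm_smul_direction] at h

theorem nu_carlesonTent_le {z : E d} (hz : z ∈ unitBall d) :
    nu d (carlesonTent z) ≤ ENNReal.ofReal ((3 * (1 - ‖z‖)) ^ (d + 1)) := by
  rcases eq_or_ne z 0 with rfl | h0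
  · refine prob_le_one.trans ?_
    rw [← ENNReal.ofReal_one]
    apply ENNReal.ofReal_le_ofReal
    apply one_le_pow₀
    simp
  · refine le_trans (measure_mono fun ζ hζ => (mem_carlesonTent h0).1 hζ)
      (nu_setOf_norm_one_sub_inner_le (norm_direction h0) (sub_pos.2 (mem_unitBall.1 hz)))

/-- Two points lie in a common Carleson tent of size comparable to `|1 - ⟨ζ, z⟩|`. -/
theorem exists_mem_carlesonTent {z ζ : E d} (hz : z ∈ unitBall d) (hζ : ζ ∈ unitBall d) :
    ∃ u ∈ unitBall d, z ∈ carlesonTent u ∧ ζ ∈ carlesonTent u ∧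
      1 - ‖u‖ ≤ 8 * ‖(1 - inner ℂ z ζ : ℂ)‖ := by
  set q := ‖(1 - inner ℂ z ζ : ℂ)‖ with hq
  rcases le_or_gt (1 / 8) q with h | h
  · refine ⟨0, by simp [mem_unitBall], ?_, ?_, ?_⟩
    · rwa [carlesonTent_zero]
    · rwa [carlesonTent_zero]
    · rw [norm_zero]; linarith
  have hz1 : 1 - ‖z‖ ≤ q := by
    have := one_sub_norm_le_norm_one_sub_inner (z := z) (mem_unitBall.1 hζ).le
    have e : (1 - inner ℂ z ζ : ℂ) = (starRingEnd ℂ) (1 - inner ℂ ζ z : ℂ) := by simp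
    rwa [hq, e, RCLike.norm_conj]
  have hzle := mem_unitBall.1 hz
  have hz0 : z ≠ 0 := norm_pos_iff.1 (by linarith)
  have hq0 : 0 < q := by linarith
  have hx := norm_direction hz0
  -- `|1 - ⟨z/|z|, ζ⟩| ≤ 2 q / |z| < 4 q`, so the tent of size `4 q` in the direction of `z` suffices.
  set u : E d := ((1 - 4 * q : ℝ) : ℂ) • direction z with hu
  have hun : ‖u‖ = 1 - 4 * q := by
    rw [hu, norm_smul, hx, mul_one, Complex.norm_real, Real.norm_of_nonneg (by linarith)]
  have hu0 : u ≠ 0 := norm_pos_iff.1 (by rw [hun]; linarith)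
  have hdir : direction u = direction z := direction_smul (by linarith) hx
  refine ⟨u, mem_unitBall.2 (by rw [hun]; linarith), ?_, ?_, by rw [hun]; linarith⟩
  · refine (mem_carlesonTent hu0).2 ⟨hz, ?_⟩
    have : (1 - (‖z‖ : ℂ)) = ((1 - ‖z‖ : ℝ) : ℂ) := by push_cast; rfl
    rw [hdir, hun, inner_direction_self, this, Complex.norm_real,
      Real.norm_of_nonneg (by linarith)]
    linarith
  · refine (mem_carlesonTent hu0).2 ⟨hζ, ?_⟩
    rw [hdir, hun]
    have e : (‖z‖ : ℂ) * (1 - inner ℂ (direction z) ζ) =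
        (1 - inner ℂ z ζ) - ((1 - ‖z‖ : ℝ) : ℂ) := by
      have : (inner ℂ z ζ : ℂ) = ‖z‖ * inner ℂ (direction z) ζ := by
        conv_lhs => rw [← norm_smul_direction z, inner_smul_left]
        simp
      rw [this]; push_cast; ring
    have h1 := congrArg norm e
    rw [norm_mul, Complex.norm_real, norm_norm] at h1
    have h2 : ‖(1 - inner ℂ z ζ) - ((1 - ‖z‖ : ℝ) : ℂ)‖ ≤ 2 * q := by
      refine (norm_sub_le _ _).trans ?_
      rw [Complex.norm_real, Real.norm_of_nonneg (by linarith)]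
      linarith
    nlinarith [norm_nonneg (1 - inner ℂ (direction z) ζ : ℂ)]

section

variable {R δ : ℝ} {N : ℕ} {T : Fin N → BergmanTree d R δ}

theorem tent_mem_tents (l : Fin N) (a : (T l).Vertex) : (T l).tent a ∈ tents T := ⟨l, a, rfl⟩

/-- The Bergman kernel is at most a constant times the inverse volume of some dyadic tent containing
both points. -/
theorem exists_kernel_le (hd : 1 ≤ d) (hR : 0 < R) (hδ : 0 < δ)
    (hT : ApproximatesCarlesonTents (tents T)) :
    ∃ C : ℝ≥0, ∀ z ∈ unitBall d, ∀ ζ ∈ unitBall d, ∃ (l : Fin N) (a : (T l).Vertex),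
      z ∈ (T l).tent a ∧ ζ ∈ (T l).tent a ∧
      ‖(1 - inner ℂ ζ z : ℂ) ^ (d + 1)‖ₑ⁻¹ ≤ C * (nu d ((T l).tent a))⁻¹ := by
  obtain ⟨c, hc⟩ := hT
  refine ⟨c * 24 ^ (d + 1), fun z hz ζ hζ => ?_⟩
  obtain ⟨u, hu, hζu, hzu, hsize⟩ := exists_mem_carlesonTent hζ hz
  obtain ⟨_, ⟨l, a, rfl⟩, hsub, hle⟩ := hc u hu
  refine ⟨l, a, hsub hzu, hsub hζu, ?_⟩
  set q := ‖(1 - inner ℂ ζ z : ℂ)‖ with hq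
  have hq0 : 0 < q := norm_pos_iff.2 (one_sub_inner_ne_zero hz hζ)
  have h0 : nu d ((T l).tent a) ≠ 0 := (BergmanTree.nu_tent_pos hd hR hδ a).ne'
  have e1 : ‖(1 - inner ℂ ζ z : ℂ) ^ (d + 1)‖ₑ = ENNReal.ofReal (q ^ (d + 1)) := by
    rw [← ofReal_norm, norm_pow]
  have h1 : nu d ((T l).tent a) ≤ c * 24 ^ (d + 1) * ENNReal.ofReal (q ^ (d + 1)) := by
    refine hle.trans ?_
    rw [mul_assoc]
    refine mul_le_mul_right ((nu_carlesonTent_le hu).trans ?_) _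
    have e2 : (24 : ℝ≥0∞) ^ (d + 1) = ENNReal.ofReal (24 ^ (d + 1)) := by
      rw [ENNReal.ofReal_pow (by norm_num)]; norm_num
    rw [e2, ← ENNReal.ofReal_mul (by positivity), ← mul_pow]
    apply ENNReal.ofReal_le_ofReal
    apply pow_le_pow_left₀
    · have := mem_unitBall.1 hu
      linarith
    · linarith
  rw [e1, ← div_eq_mul_inv, ENNReal.le_div_iff_mul_le (Or.inl h0) (Or.inl (measure_ne_top _ _)),
    mul_comm, ← div_eq_mul_inv]
  refine ENNReal.div_le_of_le_mul ?_
  push_cast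
  exact h1

/-! ### The positive dyadic operator -/

/-- The positive dyadic operator `F ↦ ∑_Q 1_Q ν(Q)⁻¹ ∫_Q F dμ` over all tents of all trees. -/
noncomputable def dyadicOp (T : Fin N → BergmanTree d R δ) (μ : Measure (E d))
    (F : E d → ℝ≥0∞) (z : E d) : ℝ≥0∞ :=
  ∑ l, ∑' a : (T l).Vertex, ((T l).tent a).indicator
    (fun _ => (∫⁻ ζ in (T l).tent a, F ζ ∂μ) / nu d ((T l).tent a)) z

theorem measurable_dyadicOp (μ : Measure (E d)) (F : E d → ℝ≥0∞) :
    Measurable (dyadicOp T μ F) := by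
  refine Finset.measurable_fun_sum _ fun l _ => Measurable.tsum fun a => ?_
  exact measurable_const.indicator (BergmanTree.measurableSet_tent a)

theorem lintegral_dyadicOp_mul (μ ν : Measure (E d)) (F : E d → ℝ≥0∞) {G : E d → ℝ≥0∞}
    (hG : AEMeasurable G ν) :
    ∫⁻ z, dyadicOp T μ F z * G z ∂ν = ∑ l, ∑' a : (T l).Vertex,
      (∫⁻ ζ in (T l).tent a, F ζ ∂μ) / nu d ((T l).tent a) * ∫⁻ z in (T l).tent a, G z ∂ν := by
  have hm : ∀ (l : Fin N) (a : (T l).Vertex), AEMeasurable (fun z => ((T l).tent a).indicator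
      (fun _ => (∫⁻ ζ in (T l).tent a, F ζ ∂μ) / nu d ((T l).tent a)) z * G z) ν := fun l a =>
    ((measurable_const.indicator (BergmanTree.measurableSet_tent a)).aemeasurable).mul hG
  simp only [dyadicOp, Finset.sum_mul, ← ENNReal.tsum_mul_right]
  rw [lintegral_finsetSum' _ fun l _ => AEMeasurable.tsum (hm l)]
  refine Finset.sum_congr rfl fun l _ => ?_
  rw [lintegral_tsum (hm l)]
  refine tsum_congr fun a => ?_
  rw [← lintegral_const_mul'' _ hG.restrict,
    ← lintegral_indicator (BergmanTree.measurableSet_tent a)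
      (fun z => (∫⁻ ζ in (T l).tent a, F ζ ∂μ) / nu d ((T l).tent a) * G z)]
  refine lintegral_congr fun z => ?_
  by_cases hz : z ∈ (T l).tent a <;> simp [hz]

/-- The Bergman kernel operator with absolute values is dominated by the positive dyadic
operator. -/
theorem exists_lintegral_kernel_le (hd : 1 ≤ d) (hR : 0 < R) (hδ : 0 < δ)
    (hT : ApproximatesCarlesonTents (tents T)) :
    ∃ C : ℝ≥0, ∀ (μ : Measure (E d)) (F : E d → ℝ≥0∞), μ ≪ nu d → AEMeasurable F μ →
      ∀ z ∈ unitBall d, ∫⁻ ζ, ‖(1 - inner ℂ ζ z : ℂ) ^ (d + 1)‖ₑ⁻¹ * F ζ ∂μ ≤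
        C * dyadicOp T μ F z := by
  obtain ⟨C, hC⟩ := exists_kernel_le hd hR hδ hT
  refine ⟨C, fun μ F hμ hF z hz => ?_⟩
  set k : (l : Fin N) → (T l).Vertex → E d → ℝ≥0∞ := fun l a ζ =>
    ((T l).tent a).indicator (fun _ => (nu d ((T l).tent a))⁻¹ *
      ((T l).tent a).indicator F ζ) z with hk
  have hkm : ∀ l a, AEMeasurable (k l a) μ := by
    intro l a
    by_cases hza : z ∈ (T l).tent a
    · simp only [hk, Set.indicator_of_mem hza]
      exact (hF.indicator (BergmanTree.measurableSet_tent a)).const_mul _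
    · simp only [hk, Set.indicator_of_notMem hza]
      exact aemeasurable_const
  have hpt : ∀ᵐ ζ ∂μ, ‖(1 - inner ℂ ζ z : ℂ) ^ (d + 1)‖ₑ⁻¹ * F ζ ≤
      C * ∑ l, ∑' a : (T l).Vertex, k l a ζ := by
    filter_upwards [hμ.ae_le ae_mem_unitBall] with ζ hζ
    obtain ⟨l, a, hza, hζa, hle⟩ := hC z hz ζ hζ
    calc ‖(1 - inner ℂ ζ z : ℂ) ^ (d + 1)‖ₑ⁻¹ * F ζ
        ≤ C * (nu d ((T l).tent a))⁻¹ * F ζ := by gcongr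
      _ = C * k l a ζ := by simp [hk, hza, hζa, mul_assoc]
      _ ≤ C * ∑' a : (T l).Vertex, k l a ζ := by gcongr; exact ENNReal.le_tsum a
      _ ≤ C * ∑ l, ∑' a : (T l).Vertex, k l a ζ := by
          gcongr
          exact Finset.single_le_sum (f := fun l => ∑' a : (T l).Vertex, k l a ζ)
            (fun _ _ => bot_le) (Finset.mem_univ l)
  refine (lintegral_mono_ae hpt).trans ?_
  rw [lintegral_const_mul' _ _ ENNReal.coe_ne_top,
    lintegral_finsetSum' _ fun l _ => AEMeasurable.tsum (hkm l), dyadicOp]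
  gcongr with l
  rw [lintegral_tsum (hkm l)]
  refine ENNReal.tsum_le_tsum fun a => ?_
  by_cases hza : z ∈ (T l).tent a
  · simp only [hk, Set.indicator_of_mem hza]
    rw [lintegral_const_mul'' _ (hF.indicator (BergmanTree.measurableSet_tent a)),
      lintegral_indicator (BergmanTree.measurableSet_tent a), mul_comm, ← div_eq_mul_inv]
  · simp only [hk, Set.indicator_of_notMem hza]
    simp

/-- A finite bump makes a weight have finite total mass, because some tent contains the ball. -/
theorem weighted_univ_ne_top (hd : 1 ≤ d) (hR : 0 < R) (hδ : 0 < δ)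
    (hT : ApproximatesCarlesonTents (tents T)) {Φ Ψ : ℝ≥0 → ℝ≥0}
    (hΦ : MaximalBounded Φ (tents T)) (hΨ : MaximalBounded Ψ (tents T)) {w σ : E d → ℝ≥0}
    (hw : IsWeight w) (hσ : IsWeight σ) (hB : bump (tents T) Φ Ψ w σ ≠ ∞) :
    weighted w Set.univ ≠ ∞ ∧ weighted σ Set.univ ≠ ∞ := by
  obtain ⟨c, hc⟩ := hT
  obtain ⟨_, ⟨l, a, rfl⟩, hsub, -⟩ := hc 0 (by simp [mem_unitBall])
  rw [carlesonTent_zero] at hsub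
  have h := avg_mul_avg_le hΦ hΨ hw hσ hB (tent_mem_tents l a) (BergmanTree.measurableSet_tent a)
    (BergmanTree.nu_tent_pos hd hR hδ a).ne'
  have huniv : ∀ v : E d → ℝ≥0, weighted v Set.univ ≤ weighted v ((T l).tent a) := by
    intro v
    refine measure_mono_ae ?_
    filter_upwards [(weighted_absolutelyContinuous v).ae_le ae_mem_unitBall] with z hz _
    exact hsub hz
  exact ⟨ne_top_of_le_ne_top h.1 (huniv w), ne_top_of_le_ne_top h.2.1 (huniv σ)⟩

/-- The positive dyadic operator is bounded from `L²(σ)` to `L²(w)`, by duality from the bilinear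
estimate. -/
theorem exists_eLpNorm_dyadicOp_le (hd : 1 ≤ d) (hR : 0 < R) (hδ : 0 < δ)
    (hT : ApproximatesCarlesonTents (tents T)) {Φ Ψ : ℝ≥0 → ℝ≥0}
    (hΦ : MaximalBounded Φ (tents T)) (hΨ : MaximalBounded Ψ (tents T)) :
    ∃ K : ℝ≥0, ∀ σ w : E d → ℝ≥0, IsWeight σ → IsWeight w → bump (tents T) Φ Ψ w σ ≠ ∞ →
      ∀ F : E d → ℝ≥0∞, AEMeasurable F (weighted σ) → eLpNorm F 2 (weighted σ) ≠ ∞ →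
      eLpNorm (dyadicOp T (weighted σ) F) 2 (weighted w) ≤
        K * bump (tents T) Φ Ψ w σ * eLpNorm F 2 (weighted σ) := by
  choose K hK using fun l => BergmanTree.exists_bilinear_le hd hR hδ (T l)
    (fun a => tent_mem_tents l a) hΦ hΨ
  refine ⟨∑ l, K l, fun σ w hσ hw hB F hF hF2 => ?_⟩
  obtain ⟨hwfin, hσfin⟩ := weighted_univ_ne_top hd hR hδ hT hΦ hΨ hw hσ hB
  set B := bump (tents T) Φ Ψ w σ
  set S := dyadicOp T (weighted σ) F with hS
  have hSm : Measurable S := measurable_dyadicOp _ _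
  set X := ((∑ l, K l : ℝ≥0) : ℝ≥0∞) * B * eLpNorm F 2 (weighted σ) with hX
  -- Truncating the operator makes its norm finite a priori; testing the bilinear form against the
  -- truncation then bounds it.
  set G : ℕ → E d → ℝ≥0∞ := fun n z => min (S z) n with hG
  have hGm : ∀ n, Measurable (G n) := fun n => hSm.min measurable_const
  have hsq : ∀ n, ∫⁻ z, G n z ^ 2 ∂(weighted w) = eLpNorm (G n) 2 (weighted w) ^ 2 := by
    intro n; rw [sq_eLpNorm_two]; rfl
  have hGfin : ∀ n, eLpNorm (G n) 2 (weighted w) ≠ ∞ := by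
    intro n htop
    have h := hsq n
    rw [htop, ENNReal.top_pow two_ne_zero] at h
    have : ∫⁻ z, G n z ^ 2 ∂(weighted w) ≤ ∫⁻ _z, (n : ℝ≥0∞) ^ 2 ∂(weighted w) :=
      lintegral_mono fun z => pow_le_pow_left' (min_le_right _ _) 2
    rw [h, lintegral_const, top_le_iff] at this
    exact ENNReal.mul_ne_top (by simp) hwfin this
  have hle : ∀ n, eLpNorm (G n) 2 (weighted w) ≤ X := by
    intro n
    have h1 : eLpNorm (G n) 2 (weighted w) ^ 2 ≤ X * eLpNorm (G n) 2 (weighted w) := by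
      calc eLpNorm (G n) 2 (weighted w) ^ 2 = ∫⁻ z, G n z ^ 2 ∂(weighted w) := (hsq n).symm
        _ ≤ ∫⁻ z, S z * G n z ∂(weighted w) := by
            refine lintegral_mono fun z => ?_
            rw [sq]
            exact mul_le_mul' (min_le_left _ _) le_rfl
        _ = _ := lintegral_dyadicOp_mul _ _ _ (hGm n).aemeasurable
        _ ≤ ∑ l, K l * B * eLpNorm F 2 (weighted σ) * eLpNorm (G n) 2 (weighted w) :=
            Finset.sum_le_sum fun l _ => hK l σ w hσ hw hσfin hwfin hB F (G n) hF
              (hGm n).aemeasurable hF2 (hGfin n)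
        _ = X * eLpNorm (G n) 2 (weighted w) := by
            rw [hX, ENNReal.ofNNReal_finsetSum, ← Finset.sum_mul, ← Finset.sum_mul, ← Finset.sum_mul]
    rcases eq_or_ne (eLpNorm (G n) 2 (weighted w)) 0 with h0 | h0
    · rw [h0]; exact bot_le
    · rw [sq] at h1
      exact (ENNReal.mul_le_mul_iff_left h0 (hGfin n)).1 h1
  have hsup : ∀ z, S z ^ 2 = ⨆ n, G n z ^ 2 := by
    intro z
    refine le_antisymm ?_ (iSup_le fun n => pow_le_pow_left' (min_le_left _ _) 2)
    have h1 : S z = ⨆ n : ℕ, min (S z) n := by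
      rw [← inf_iSup_eq, ENNReal.iSup_natCast, inf_top_eq]
    have h2 : Tendsto (fun n : ℕ => min (S z) (n : ℝ≥0∞)) atTop (nhds (S z)) := by
      conv_rhs => rw [h1]
      exact tendsto_atTop_iSup fun m n hmn => min_le_min le_rfl (by exact_mod_cast hmn)
    exact le_of_tendsto' (((ENNReal.continuous_pow 2).tendsto _).comp h2)
      fun n => le_iSup (fun n => G n z ^ 2) n
  refine (ENNReal.pow_le_pow_left_iff two_ne_zero).1 ?_
  rw [sq_eLpNorm_two]
  change ∫⁻ z, S z ^ 2 ∂(weighted w) ≤ _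
  simp only [hsup]
  rw [lintegral_iSup (fun n => (hGm n).pow_const 2)
    (fun m n hmn z => pow_le_pow_left' (min_le_min le_rfl (by exact_mod_cast hmn)) 2)]
  refine iSup_le fun n => ?_
  rw [hsq]
  exact pow_le_pow_left' (hle n) 2

/-! ### The Bergman projection -/

/-- The Bergman projection of an integrable function is holomorphic. -/
theorem differentiableOn_bergmanProj {g : E d → ℂ} (hg : Integrable g (nu d)) :
    DifferentiableOn ℂ (bergmanProj g) (unitBall d) := by
  intro z₀ hz₀
  have hz₀' := mem_unitBall.1 hz₀
  set ε := (1 - ‖z₀‖) / 2 with hε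
  have hε0 : 0 < ε := by rw [hε]; linarith
  have hnear : ∀ z ∈ Metric.ball z₀ ε, ε ≤ 1 - ‖z‖ := by
    intro z hz
    rw [mem_ball_iff_norm] at hz
    have := norm_le_norm_add_norm_sub' z z₀
    linarith
  set F' : E d → E d → (E d →L[ℂ] ℂ) := fun z ζ =>
    (g ζ * ((d + 1 : ℕ) / (1 - inner ℂ ζ z : ℂ) ^ (d + 2))) • innerSL ℂ ζ with hF'
  have hkm : ∀ (n : ℕ) (z : E d), Measurable fun ζ : E d => (1 - inner ℂ ζ z : ℂ) ^ n :=
    fun n z => by fun_prop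
  have hmeas : ∀ z : E d, AEStronglyMeasurable
      (fun ζ => g ζ / (1 - inner ℂ ζ z : ℂ) ^ (d + 1)) (nu d) := fun z => by
    simp only [div_eq_mul_inv]
    exact hg.aestronglyMeasurable.mul (hkm (d + 1) z).inv.aestronglyMeasurable
  have hder : ∀ z ∈ Metric.ball z₀ ε, ∀ ζ ∈ unitBall d,
      HasFDerivAt (fun z => g ζ / (1 - inner ℂ ζ z : ℂ) ^ (d + 1)) (F' z ζ) z := by
    intro z hz ζ hζ
    have hzb : z ∈ unitBall d := mem_unitBall.2 (by linarith [hnear z hz])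
    have hne := one_sub_inner_ne_zero hzb hζ
    have h1 : HasFDerivAt (fun z : E d => (1 - inner ℂ ζ z : ℂ)) (-(innerSL ℂ ζ)) z :=
      (innerSL ℂ ζ).hasFDerivAt.const_sub 1
    have h2 : HasDerivAt (fun x : ℂ => g ζ / x ^ (d + 1))
        (-(g ζ * ((d + 1 : ℕ) / (1 - inner ℂ ζ z : ℂ) ^ (d + 2)))) (1 - inner ℂ ζ z : ℂ) := by
      have h3 := ((hasDerivAt_pow (d + 1) (1 - inner ℂ ζ z : ℂ)).inv
        (pow_ne_zero _ hne)).const_mul (g ζ)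
      simp only [← div_eq_mul_inv, Pi.inv_apply] at h3
      refine h3.congr_deriv ?_
      simp only [Nat.add_sub_cancel]
      field_simp
      ring
    have h4 := h2.comp_hasFDerivAt z h1
    refine h4.congr_fderiv ?_
    simp only [hF', smul_neg, neg_smul, neg_neg]
  have hbound : ∀ z ∈ Metric.ball z₀ ε, ∀ ζ ∈ unitBall d,
      ‖F' z ζ‖ ≤ ‖g ζ‖ * ((d + 1 : ℕ) / ε ^ (d + 2)) := by
    intro z hz ζ hζ
    have hζ1 := mem_unitBall.1 hζ
    have h1 : ε ≤ ‖(1 - inner ℂ ζ z : ℂ)‖ :=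
      (hnear z hz).trans (one_sub_norm_le_norm_one_sub_inner hζ1.le)
    rw [hF', norm_smul, norm_mul, norm_div, norm_pow, innerSL_apply_norm, Complex.norm_natCast]
    calc _ ≤ ‖g ζ‖ * ((d + 1 : ℕ) / ε ^ (d + 2)) * 1 := by gcongr
      _ = _ := mul_one _
  have hint := hasFDerivAt_integral_of_dominated_of_fderiv_le (μ := nu d)
    (F := fun z ζ => g ζ / (1 - inner ℂ ζ z : ℂ) ^ (d + 1)) (F' := F') (x₀ := z₀)
    (bound := fun ζ => ‖g ζ‖ * ((d + 1 : ℕ) / ε ^ (d + 2)))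
    (Metric.ball_mem_nhds z₀ hε0)
    (Eventually.of_forall hmeas)
    (by
      refine (hg.norm.mul_const (1 / ε ^ (d + 1))).mono' (hmeas z₀) ?_
      filter_upwards [ae_mem_unitBall] with ζ hζ
      have h1 : ε ≤ ‖(1 - inner ℂ ζ z₀ : ℂ)‖ :=
        (hnear z₀ (Metric.mem_ball_self hε0)).trans
          (one_sub_norm_le_norm_one_sub_inner (mem_unitBall.1 hζ).le)
      rw [norm_div, norm_pow, div_eq_mul_one_div]
      gcongr)
    (by
      refine AEStronglyMeasurable.smul (hg.aestronglyMeasurable.mul ?_) ?_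
      · exact ((hkm (d + 2) z₀).const_div _).aestronglyMeasurable
      · exact (innerSL ℂ).continuous.aestronglyMeasurable)
    (by
      filter_upwards [ae_mem_unitBall] with ζ hζ z hz
      exact hbound z hz ζ hζ)
    (hg.norm.mul_const _)
    (by
      filter_upwards [ae_mem_unitBall] with ζ hζ z hz
      exact hder z hz ζ hζ)
  exact hint.differentiableAt.differentiableWithinAt

/-- The weighted estimate when the bump is finite, with a constant independent of the weights. -/
theorem exists_boundedBy (hd : 1 ≤ d) (hR : 0 < R) (hδ : 0 < δ)
    (hT : ApproximatesCarlesonTents (tents T)) {Φ Ψ : ℝ≥0 → ℝ≥0}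
    (hΦ : MaximalBounded Φ (tents T)) (hΨ : MaximalBounded Ψ (tents T)) :
    ∃ K : ℝ≥0, ∀ σ w : E d → ℝ≥0, IsWeight σ → IsWeight w → bump (tents T) Φ Ψ w σ ≠ ∞ →
      BoundedBy σ w (K * (bump (tents T) Φ Ψ w σ).toNNReal) := by
  obtain ⟨C, hC⟩ := exists_lintegral_kernel_le hd hR hδ hT
  obtain ⟨K, hK⟩ := exists_eLpNorm_dyadicOp_le hd hR hδ hT hΦ hΨ
  refine ⟨C * K, fun σ w hσ hw hB f hf => ?_⟩
  obtain ⟨hwfin, hσfin⟩ := weighted_univ_ne_top hd hR hδ hT hΦ hΨ hw hσ hB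
  have hfinite : IsFiniteMeasure (weighted σ) := ⟨lt_top_iff_ne_top.2 hσfin⟩
  have hnn : AEMeasurable σ (nu d) := by simpa using hσ.aemeasurable.ennreal_toNNReal
  have hσm : AEStronglyMeasurable (fun ζ => (σ ζ : ℂ)) (nu d) :=
    (Complex.measurable_ofReal.comp_aemeasurable
      (measurable_coe_nnreal_real.comp_aemeasurable hnn)).aestronglyMeasurable
  have hfm : AEStronglyMeasurable f (nu d) := hf.1.mono_ac hσ.absolutelyContinuous
  have henorm : ∀ ζ, ‖(σ ζ : ℂ) * f ζ‖ₑ = (σ ζ : ℝ≥0∞) * ‖f ζ‖ₑ := by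
    intro ζ
    rw [enorm_mul]
    congr 1
    rw [← ofReal_norm, Complex.norm_real, Real.norm_of_nonneg (NNReal.coe_nonneg _), ENNReal.ofReal_coe_nnreal]
  have hFm : AEMeasurable (fun ζ => ‖f ζ‖ₑ) (weighted σ) := hf.1.enorm
  have hlint : ∀ k : E d → ℝ≥0∞, Measurable k → ∫⁻ ζ, k ζ * ‖(σ ζ : ℂ) * f ζ‖ₑ ∂(nu d) =
      ∫⁻ ζ, k ζ * ‖f ζ‖ₑ ∂(weighted σ) := by
    intro k hk
    rw [weighted, lintegral_withDensity_eq_lintegral_mul₀ hσ.aemeasurable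
      (g := fun ζ => k ζ * ‖f ζ‖ₑ) (hk.aemeasurable.mul hfm.enorm)]
    refine lintegral_congr fun ζ => ?_
    rw [henorm, Pi.mul_apply]
    ring
  have hint : Integrable (fun ζ => (σ ζ : ℂ) * f ζ) (nu d) := by
    refine ⟨hσm.mul hfm, ?_⟩
    rw [hasFiniteIntegral_iff_enorm]
    have h1 := hlint (fun _ => 1) measurable_const
    simp only [one_mul] at h1
    rw [h1]
    exact (hasFiniteIntegral_iff_enorm.1 (hf.integrable (by norm_num)).2)
  have hdiff := differentiableOn_bergmanProj hint
  have hnorm : eLpNorm (bergmanProj fun ζ => (σ ζ : ℂ) * f ζ) 2 (weighted w) ≤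
      ↑(C * K * (bump (tents T) Φ Ψ w σ).toNNReal) * eLpNorm f 2 (weighted σ) := by
    have h1 : eLpNorm (bergmanProj fun ζ => (σ ζ : ℂ) * f ζ) 2 (weighted w) ≤
        C * eLpNorm (dyadicOp T (weighted σ) fun ζ => ‖f ζ‖ₑ) 2 (weighted w) := by
      refine eLpNorm_le_nnreal_smul_eLpNorm_of_ae_le_mul' ?_ 2
      filter_upwards [(weighted_absolutelyContinuous w).ae_le ae_mem_unitBall] with z hz
      refine (enorm_integral_le_lintegral_enorm _).trans ?_
      refine le_trans (le_of_eq ?_) (hC (weighted σ) (fun ζ => ‖f ζ‖ₑ)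
        (weighted_absolutelyContinuous σ) hFm z hz)
      rw [← hlint (fun ζ => ‖(1 - inner ℂ ζ z : ℂ) ^ (d + 1)‖ₑ⁻¹)
        (Measurable.inv (by fun_prop))]
      refine lintegral_congr_ae ?_
      filter_upwards [ae_mem_unitBall] with ζ hζ
      rw [div_eq_mul_inv, enorm_mul, enorm_inv (pow_ne_zero _ (one_sub_inner_ne_zero hz hζ)),
        mul_comm]
    have h2 := hK σ w hσ hw hB (fun ζ => ‖f ζ‖ₑ) hFm (by rw [eLpNorm_enorm]; exact hf.2.ne)
    rw [eLpNorm_enorm] at h2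
    refine h1.trans ((mul_le_mul_right h2 _).trans_eq ?_)
    rw [ENNReal.coe_mul, ENNReal.coe_toNNReal hB, ENNReal.coe_mul]
    ring
  refine ⟨hint, ⟨hdiff, ?_, ?_⟩, hnorm⟩
  · refine AEStronglyMeasurable.mono_ac ((weighted_absolutelyContinuous w).trans
      nu_absolutelyContinuous) ?_
    exact hdiff.continuousOn.aestronglyMeasurable measurableSet_unitBall
  · exact hnorm.trans_lt (ENNReal.mul_lt_top ENNReal.coe_lt_top hf.2)

end

/-! ### Adjacent partitions of the sphere at one scale -/

/-- The nonisotropic metric is doubling: separated sets in a ball of comparable radius have bounded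
cardinality. -/
theorem exists_card_le_of_separated (d : ℕ) {L : ℝ} (hL : 0 ≤ L) :
    ∃ N : ℕ, ∀ r : ℝ, 0 < r → r ≤ 1 → ∀ (y : E d) (X : Finset (E d)), ‖y‖ = 1 →
      (∀ x ∈ X, ‖x‖ = 1) → (∀ x ∈ X, rho y x ≤ L * r) →
      (∀ x ∈ X, ∀ x' ∈ X, x ≠ x' → r ≤ rho x x') → X.card ≤ N := by
  obtain ⟨N, hN⟩ := exists_nat_ge ((96 * (L + 1) ^ 2) ^ (d + 1))
  refine ⟨N, fun r hr hr1 y X hy hX hyX hsep => ?_⟩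
  set V : E d → Set (E d) := fun x => {ζ | ζ ∈ unitBall d ∧ ‖(1 - inner ℂ x ζ : ℂ)‖ < (r / 2) ^ 2}
    with hV
  have hVrho : ∀ x ζ, ζ ∈ V x → rho x ζ < r / 2 := by
    intro x ζ hζ
    have := hζ.2
    rw [← rho_sq] at this
    exact lt_of_pow_lt_pow_left₀ 2 (by positivity) this
  have hVm : ∀ x, MeasurableSet (V x) := by
    intro x
    have h : Measurable fun ζ : E d => ‖(1 - inner ℂ x ζ : ℂ)‖ := by fun_prop
    exact measurableSet_unitBall.inter (measurableSet_lt h measurable_const)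
  have hdisj : Set.PairwiseDisjoint (↑X) V := by
    intro x hx x' hx' hne
    refine Set.disjoint_left.2 fun ζ h h' => ?_
    have h1 := hVrho x ζ h
    have h2 := hVrho x' ζ h'
    have h3 := rho_triangle (hX x hx).le (mem_unitBall.1 h.1).le (hX x' hx').le
    rw [rho_comm ζ x'] at h3
    linarith [hsep x hx x' hx' hne]
  have hsum := measure_biUnion_finset (μ := nu d) hdisj fun x _ => hVm x
  have hup : nu d (⋃ x ∈ X, V x) ≤ ENNReal.ofReal ((3 * ((L + 1) * r) ^ 2) ^ (d + 1)) := by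
    refine le_trans (measure_mono ?_) (nu_setOf_norm_one_sub_inner_le hy
      (s := ((L + 1) * r) ^ 2) (by positivity))
    refine Set.iUnion₂_subset fun x hx ζ hζ => ⟨hζ.1, ?_⟩
    have h1 := hVrho x ζ hζ
    have h3 := rho_triangle hy.le (hX x hx).le (mem_unitBall.1 hζ.1).le
    rw [← rho_sq]
    refine pow_le_pow_left₀ (rho_nonneg _ _) ?_ 2
    linarith [hyX x hx]
  have hlow : (X.card : ℝ≥0∞) * ENNReal.ofReal (((r / 2) ^ 2 / 8) ^ (d + 1)) ≤
      nu d (⋃ x ∈ X, V x) := by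
    rw [hsum, ← nsmul_eq_mul]
    refine Finset.card_nsmul_le_sum _ _ _ fun x hx => ?_
    exact le_nu_setOf_norm_one_sub_inner_lt (hX x hx) (by positivity) (by nlinarith)
  have h := hlow.trans hup
  rw [← ENNReal.ofReal_natCast, ← ENNReal.ofReal_mul (by positivity),
    ENNReal.ofReal_le_ofReal_iff (by positivity)] at h
  have e : (3 * ((L + 1) * r) ^ 2) ^ (d + 1) =
      (96 * (L + 1) ^ 2) ^ (d + 1) * ((r / 2) ^ 2 / 8) ^ (d + 1) := by
    rw [← mul_pow]; congr 1; ring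
  rw [e] at h
  have h2 := le_of_mul_le_mul_right h (by positivity)
  exact_mod_cast h2.trans hN

theorem rho_le_two {x y : E d} (hx : ‖x‖ ≤ 1) (hy : ‖y‖ ≤ 1) : rho x y ≤ 2 := by
  refine Real.sqrt_le_iff.2 ⟨by norm_num, ?_⟩
  have h1 := norm_sub_le (1 : ℂ) (inner ℂ x y)
  have h2 := norm_inner_le_norm (𝕜 := ℂ) x y
  rw [norm_one] at h1
  nlinarith [norm_nonneg x, norm_nonneg y]

/-- Every separated subset of the sphere extends to a maximal one. -/
theorem exists_maximal_separated {s : ℝ} (hs : 0 < s) (X : Finset (E d))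
    (hX : ∀ x ∈ X, ‖x‖ = 1) (hsep : ∀ x ∈ X, ∀ x' ∈ X, x ≠ x' → s ≤ rho x x') :
    ∃ Z : Finset (E d), X ⊆ Z ∧ (∀ x ∈ Z, ‖x‖ = 1) ∧
      (∀ x ∈ Z, ∀ x' ∈ Z, x ≠ x' → s ≤ rho x x') ∧ ∀ ξ : E d, ‖ξ‖ = 1 → ∃ x ∈ Z, rho x ξ < s := by
  classical
  set r := min s 1 with hr
  have hr0 : 0 < r := lt_min hs one_pos
  obtain ⟨N, hN⟩ := exists_card_le_of_separated d (L := 2 / r) (by positivity)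
  have hbound : ∀ X : Finset (E d), (∀ x ∈ X, ‖x‖ = 1) →
      (∀ x ∈ X, ∀ x' ∈ X, x ≠ x' → s ≤ rho x x') → X.card ≤ N := by
    intro X hX hsep
    rcases X.eq_empty_or_nonempty with rfl | ⟨y, hy⟩
    · simp
    refine hN r hr0 (min_le_right _ _) y X (hX y hy) hX (fun x hx => ?_)
      fun x hx x' hx' hne => (min_le_left _ _).trans (hsep x hx x' hx' hne)
    rw [div_mul_cancel₀ _ hr0.ne']
    exact rho_le_two (hX y hy).le (hX x hx).le
  induction hk : N - X.card using Nat.strong_induction_on generalizing X with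
  | _ k ih =>
    by_cases hmax : ∀ ξ : E d, ‖ξ‖ = 1 → ∃ x ∈ X, rho x ξ < s
    · exact ⟨X, subset_rfl, hX, hsep, hmax⟩
    push Not at hmax
    obtain ⟨ξ, hξ, hfar⟩ := hmax
    have hξX : ξ ∉ X := fun h => by
      have := hfar ξ h
      rw [rho_self hξ] at this
      linarith
    have hX' : ∀ x ∈ insert ξ X, ‖x‖ = 1 := by
      intro x hx
      rcases Finset.mem_insert.1 hx with rfl | hx
      exacts [hξ, hX x hx]
    have hsep' : ∀ x ∈ insert ξ X, ∀ x' ∈ insert ξ X, x ≠ x' → s ≤ rho x x' := by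
      intro x hx x' hx' hne
      rcases Finset.mem_insert.1 hx with h | h <;> rcases Finset.mem_insert.1 hx' with h' | h'
      · exact absurd (h.trans h'.symm) hne
      · rw [h, rho_comm]; exact hfar x' h'
      · rw [h']; exact hfar x h
      · exact hsep x h x' h' hne
    have hcard := hbound _ hX' hsep'
    rw [Finset.card_insert_of_notMem hξX] at hcard
    obtain ⟨Z, hZ, h1, h2, h3⟩ := ih (N - (insert ξ X).card)
      (by rw [Finset.card_insert_of_notMem hξX]; omega) (insert ξ X) hX' hsep' rfl
    exact ⟨Z, (Finset.subset_insert _ _).trans hZ, h1, h2, h3⟩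

/-- Greedy colouring of a finite set with fewer than `N` neighbours at each point. -/
theorem exists_coloring {α : Type*} (adj : α → α → Prop) (hsymm : ∀ x y, adj x y → adj y x)
    {N : ℕ} (hN : 0 < N) (X : Finset α)
    (hX : ∀ x ∈ X, ∀ Y ⊆ X, (∀ y ∈ Y, y ≠ x ∧ adj x y) → Y.card < N) :
    ∃ c : α → Fin N, ∀ x ∈ X, ∀ y ∈ X, x ≠ y → adj x y → c x ≠ c y := by
  classical
  induction X using Finset.induction_on with
  | empty => exact ⟨fun _ => ⟨0, hN⟩, by simp⟩
  | insert a X ha ih =>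
    obtain ⟨c, hc⟩ := ih fun x hx Y hY h =>
      hX x (Finset.mem_insert_of_mem hx) Y (hY.trans (Finset.subset_insert _ _)) h
    set Y := X.filter fun y => y ≠ a ∧ adj a y with hY
    have hcard : Y.card < N := hX a (Finset.mem_insert_self _ _) Y
      ((Finset.filter_subset _ _).trans (Finset.subset_insert _ _))
      fun y hy => (Finset.mem_filter.1 hy).2
    obtain ⟨i, hi⟩ : ∃ i : Fin N, i ∉ Y.image c := by
      by_contra hall
      push Not at hall
      have h1 : (Finset.univ : Finset (Fin N)) ⊆ Y.image c := fun i _ => hall i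
      have h2 := (Finset.card_le_card h1).trans Finset.card_image_le
      rw [Finset.card_univ, Fintype.card_fin] at h2
      omega
    have hfree : ∀ y ∈ X, adj a y → c y ≠ i := by
      intro y hy hay h
      exact hi (Finset.mem_image.2 ⟨y, Finset.mem_filter.2
        ⟨hy, fun h => ha (h ▸ hy), hay⟩, h⟩)
    have hne : ∀ y ∈ X, y ≠ a := fun y hy h => ha (h ▸ hy)
    refine ⟨Function.update c a i, fun x hx y hy hxy hadj => ?_⟩
    rcases Finset.mem_insert.1 hx with h | h <;> rcases Finset.mem_insert.1 hy with h' | h'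
    · exact absurd (h.trans h'.symm) hxy
    · subst h
      rw [Function.update_self, Function.update_of_ne (hne y h')]
      exact (hfree y h' hadj).symm
    · subst h'
      rw [Function.update_self, Function.update_of_ne (hne x h)]
      exact hfree x h (hsymm _ _ hadj)
    · rw [Function.update_of_ne (hne x h), Function.update_of_ne (hne y h')]
      exact hc x h y h' hxy hadj

/-- A finite family of disjoint Borel sets covering the unit sphere, with a marked unit vector for
each set. -/
structure SpherePartition (d : ℕ) where
  /-- number of cells -/
  J : ℕ
  /-- the marked unit vectors -/
  x : Fin J → E d
  /-- the cells, as sets of the whole space of which only the trace on the sphere matters -/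
  cell : Fin J → Set (E d)
  norm_x : ∀ j, ‖x j‖ = 1
  measurableSet_cell : ∀ j, MeasurableSet (cell j)
  disjoint_cell : Pairwise fun i j => Disjoint (cell i) (cell j)
  exists_mem : ∀ ξ : E d, ‖ξ‖ = 1 → ∃ j, ξ ∈ cell j

namespace SpherePartition

/-- The cells are comparable with nonisotropic balls of radius `r` around the marked points. -/
structure IsAdapted (P : SpherePartition d) (r : ℝ) : Prop where
  mem_cell : ∀ j (ξ : E d), ‖ξ‖ = 1 → rho (P.x j) ξ < 2 * r → ξ ∈ P.cell j
  rho_le : ∀ j (ξ : E d), ξ ∈ P.cell j → rho (P.x j) ξ ≤ 4 * r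

/-- The partition with a single cell. -/
def trivial {x : E d} (hx : ‖x‖ = 1) : SpherePartition d where
  J := 1
  x _ := x
  cell _ := Set.univ
  norm_x _ := hx
  measurableSet_cell _ := MeasurableSet.univ
  disjoint_cell i j h := absurd (Subsingleton.elim i j) h
  exists_mem _ _ := ⟨0, Set.mem_univ _⟩

open Classical in
/-- The marked vector of the cell that contains `ξ` (and `0` if no cell does). -/
noncomputable def pt (P : SpherePartition d) (ξ : E d) : E d :=
  if h : ∃ j, ξ ∈ P.cell j then P.x h.choose else 0

theorem pt_eq (P : SpherePartition d) {ξ : E d} {j : Fin P.J} (h : ξ ∈ P.cell j) :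
    P.pt ξ = P.x j := by
  have hex : ∃ j, ξ ∈ P.cell j := ⟨j, h⟩
  rw [pt, dif_pos hex]
  congr 1
  by_contra hne
  exact Set.disjoint_left.1 (P.disjoint_cell hne) hex.choose_spec h

theorem norm_pt (P : SpherePartition d) {ξ : E d} (hξ : ‖ξ‖ = 1) : ‖P.pt ξ‖ = 1 := by
  obtain ⟨j, hj⟩ := P.exists_mem ξ hξ
  rw [P.pt_eq hj, P.norm_x]

theorem IsAdapted.rho_pt_le {P : SpherePartition d} {r : ℝ} (h : P.IsAdapted r) {ξ : E d}
    (hξ : ‖ξ‖ = 1) : rho (P.pt ξ) ξ ≤ 4 * r := by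
  obtain ⟨j, hj⟩ := P.exists_mem ξ hξ
  rw [P.pt_eq hj]
  exact h.rho_le j ξ hj

end SpherePartition

/-- A maximal separated set carries an adapted partition: points close to a marked point are
forced into its cell, and the others go to the first marked point in reach. -/
theorem exists_adapted_partition {r : ℝ} (hr : 0 < r) (Z : Finset (E d)) (hZ : ∀ x ∈ Z, ‖x‖ = 1)
    (hsep : ∀ x ∈ Z, ∀ x' ∈ Z, x ≠ x' → 4 * r ≤ rho x x')
    (hmax : ∀ ξ : E d, ‖ξ‖ = 1 → ∃ x ∈ Z, rho x ξ < 4 * r) :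
    ∃ P : SpherePartition d, (∀ x ∈ Z, ∃ j, ∀ ξ : E d, ‖ξ‖ = 1 → rho x ξ < 2 * r → ξ ∈ P.cell j) ∧
      P.IsAdapted r := by
  set x : Fin Z.card → E d := fun j => (Z.equivFin.symm j : E d) with hx
  have hxZ : ∀ j, x j ∈ Z := fun j => (Z.equivFin.symm j).2
  have hxinj : Function.Injective x := Subtype.val_injective.comp Z.equivFin.symm.injective
  have hxsurj : ∀ y ∈ Z, ∃ j, x j = y := fun y hy => ⟨Z.equivFin ⟨y, hy⟩, by simp [hx]⟩
  -- `A j` is the set of points that may be put into the cell `j`.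
  set A : Fin Z.card → Set (E d) := fun j =>
    {ξ | rho (x j) ξ < 4 * r ∧ ∀ i, i ≠ j → ¬ rho (x i) ξ < 2 * r} with hA
  set B : Fin Z.card → Set (E d) := fun j => {ξ | ξ ∈ A j ∧ ∀ i, i < j → ξ ∉ A i} with hB
  have hmlt : ∀ j (s : ℝ), MeasurableSet {ξ | rho (x j) ξ < s} := fun j s =>
    measurableSet_lt (continuous_rho _).measurable measurable_const
  have hAm : ∀ j, MeasurableSet (A j) := by
    intro j
    have : A j = {ξ | rho (x j) ξ < 4 * r} ∩ ⋂ i, ⋂ (_ : i ≠ j), {ξ | rho (x i) ξ < 2 * r}ᶜ := by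
      ext ξ; simp [hA]
    rw [this]
    exact (hmlt j _).inter (MeasurableSet.iInter fun i => MeasurableSet.iInter fun _ =>
      (hmlt i _).compl)
  have hBm : ∀ j, MeasurableSet (B j) := by
    intro j
    have : B j = A j ∩ ⋂ i, ⋂ (_ : i < j), (A i)ᶜ := by
      ext ξ; simp [hB]
    rw [this]
    exact (hAm j).inter (MeasurableSet.iInter fun i => MeasurableSet.iInter fun _ => (hAm i).compl)
  have hnear : ∀ j (ξ : E d), ‖ξ‖ = 1 → rho (x j) ξ < 2 * r → ξ ∈ B j := by
    intro j ξ hξ h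
    refine ⟨⟨by linarith, fun i hij hi => ?_⟩, fun i hij hi => hi.2 j hij.ne' h⟩
    have h1 := hsep (x i) (hxZ i) (x j) (hxZ j) fun h => hij (hxinj h)
    have h2 := rho_triangle (hZ _ (hxZ i)).le hξ.le (hZ _ (hxZ j)).le
    rw [rho_comm ξ] at h2
    linarith
  have hcover : ∀ ξ : E d, ‖ξ‖ = 1 → ∃ j, ξ ∈ A j := by
    intro ξ hξ
    by_cases h : ∃ j, rho (x j) ξ < 2 * r
    · obtain ⟨j, hj⟩ := h
      exact ⟨j, (hnear j ξ hξ hj).1⟩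
    · push Not at h
      obtain ⟨y, hy, hyξ⟩ := hmax ξ hξ
      obtain ⟨j, rfl⟩ := hxsurj y hy
      exact ⟨j, hyξ, fun i _ hi => absurd hi (not_lt.2 (h i))⟩
  refine ⟨⟨Z.card, x, B, fun j => hZ _ (hxZ j), hBm, ?_, ?_⟩, ?_, ?_, ?_⟩
  · intro i j hij
    refine Set.disjoint_left.2 fun ξ hi hj => ?_
    rcases lt_or_gt_of_ne hij with h | h
    · exact hj.2 i h hi.1
    · exact hi.2 j h hj.1
  · intro ξ hξ
    obtain ⟨j, hj, hmin⟩ := WellFounded.has_min (wellFounded_lt (α := Fin Z.card))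
      {j | ξ ∈ A j} (hcover ξ hξ)
    exact ⟨j, hj, fun i hi h => hmin i h hi⟩
  · intro y hy
    obtain ⟨j, rfl⟩ := hxsurj y hy
    exact ⟨j, hnear j⟩
  · exact hnear
  · exact fun j ξ h => h.1.1.le

/-- At every scale there are boundedly many adapted partitions such that every ball of that scale
lies in a cell of one of them: the points of a net are coloured so that points of the same colour
are far apart, and every colour class is extended to a maximal separated set. -/
theorem exists_adjacent_partitions (d : ℕ) : ∃ N : ℕ, ∀ r : ℝ, 0 < r → r ≤ 1 →
    ∃ P : Fin N → SpherePartition d, (∀ l, (P l).IsAdapted r) ∧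
      ∀ e : E d, ‖e‖ = 1 → ∃ l j, ∀ ξ : E d, ‖ξ‖ = 1 → rho e ξ < r → ξ ∈ (P l).cell j := by
  classical
  obtain ⟨N, hN⟩ := exists_card_le_of_separated d (L := 4) (by norm_num)
  refine ⟨N + 1, fun r hr hr1 => ?_⟩
  obtain ⟨X, -, hX, hsep, hmax⟩ := exists_maximal_separated (d := d) hr ∅ (by simp) (by simp)
  obtain ⟨c, hc⟩ := exists_coloring (fun x y : E d => rho x y < 4 * r)
    (fun x y h => by rwa [rho_comm]) N.succ_pos X fun x hx Y hYX hY =>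
      Nat.lt_succ_of_le (hN r hr hr1 x Y (hX x hx) (fun y hy => hX y (hYX hy))
        (fun y hy => (hY y hy).2.le) fun y hy y' hy' => hsep y (hYX hy) y' (hYX hy'))
  have hP : ∀ l : Fin (N + 1), ∃ P : SpherePartition d, (∀ x ∈ X, c x = l →
      ∃ j, ∀ ξ : E d, ‖ξ‖ = 1 → rho x ξ < 2 * r → ξ ∈ P.cell j) ∧ P.IsAdapted r := by
    intro l
    obtain ⟨Z, hXZ, hZ, hZsep, hZmax⟩ := exists_maximal_separated (d := d) (s := 4 * r)
      (by positivity) (X.filter fun x => c x = l) (fun x hx => hX x (Finset.mem_filter.1 hx).1)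
      (fun x hx x' hx' hne => by
        rw [Finset.mem_filter] at hx hx'
        by_contra h
        exact hc x hx.1 x' hx'.1 hne (not_le.1 h) (hx.2.trans hx'.2.symm))
    obtain ⟨P, hP, hPa⟩ := exists_adapted_partition hr Z hZ hZsep hZmax
    exact ⟨P, fun x hx hl => hP x (hXZ (Finset.mem_filter.2 ⟨hx, hl⟩)), hPa⟩
  choose P hP hPa using hP
  refine ⟨P, hPa, fun e he => ?_⟩
  obtain ⟨x, hx, hxe⟩ := hmax e he
  obtain ⟨j, hj⟩ := hP (c x) x hx rfl
  refine ⟨c x, j, fun ξ hξ h => hj ξ hξ ?_⟩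
  have := rho_triangle (hX x hx).le he.le hξ.le
  linarith

/-! ### Bergman trees from partitions of the sphere -/

theorem exists_cosh_gt {δ : ℝ} (hδ : 0 < δ) {V : ℝ} (hV : 0 < V) :
    ∃ C : ℝ, 0 < C ∧ V < Real.cosh (C * δ) := by
  refine ⟨V / δ, by positivity, ?_⟩
  rw [div_mul_cancel₀ _ hδ.ne']
  exact (Real.self_le_sinh_iff.2 hV.le).trans_lt (Real.sinh_lt_cosh _)

theorem sinh_add_le {x y : ℝ} (hx : 1 ≤ Real.sinh x) (hx0 : 0 ≤ x) (hy : 0 ≤ y) :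
    Real.sinh (x + y) ≤ 2 * Real.exp y * Real.sinh x := by
  have h1 : Real.cosh x ≤ 2 * Real.sinh x := by
    have := Real.cosh_sub_sinh x
    have : Real.exp (-x) ≤ 1 := Real.exp_le_one_iff.2 (by linarith)
    linarith
  have h2 := Real.sinh_nonneg_iff.2 hy
  have h3 := Real.cosh_pos y
  rw [Real.sinh_add, ← Real.cosh_add_sinh]
  nlinarith

theorem cosh_add_le (x : ℝ) {y : ℝ} (hy : 0 ≤ y) :
    Real.cosh (x + y) ≤ Real.exp y * Real.cosh x := by
  rw [Real.cosh_add, ← Real.cosh_add_sinh]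
  have h1 := Real.sinh_lt_cosh x
  have h2 := Real.sinh_nonneg_iff.2 hy
  nlinarith

theorem tanh_sq_eq (x : ℝ) :
    Real.tanh x ^ 2 = (1 - Real.tanh x ^ 2) * Real.sinh x ^ 2 := by
  have := Real.cosh_pos x
  rw [one_sub_tanh_sq, Real.tanh_eq_sinh_div_cosh]
  field_simp

variable {R δ : ℝ}

/-- The scale, in the nonisotropic metric, of the partition used at the levels `n` with
`n / M = k`. For `k = 0` this is the junk value `0`, and the partition is the trivial one. -/
noncomputable def scale (R δ : ℝ) (M k : ℕ) : ℝ := Real.cosh δ / Real.sinh ((k * M : ℕ) * R)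

/-- A sequence of adapted partitions, the `k`-th one being used at all levels `n` with `n / M = k`,
defines a Bergman tree. The scale is chosen so that the Bergman balls of radius `δ` fit into the
pieces. Repeating a partition on long stretches of levels makes the scales of
consecutive partitions as far apart as desired, however small `R` is. -/
theorem exists_tree (hR : 0 < R) (hδ : 0 < δ) {M : ℕ} (hM : 0 < M)
    (hMR : Real.cosh δ ≤ Real.sinh (M * R)) (P : ℕ → SpherePartition d) {x₀ : E d}
    (hx₀ : ‖x₀‖ = 1) (hP0 : P 0 = SpherePartition.trivial hx₀)
    (hP : ∀ k, 1 ≤ k → (P k).IsAdapted (scale R δ M k)) :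
    ∃ T : BergmanTree d R δ, ∀ a : T.Vertex, 1 ≤ a.1 → ∀ ξ : E d, ‖ξ‖ = 1 →
      ((Real.tanh (a.1 * R) : ℝ) : ℂ) • ξ ∈ T.Ω a.1 a.2 → T.dir a = (P (a.1 / M)).pt ξ := by
  have htriv : ∀ n : ℕ, n / M = 0 → ∀ (j : Fin (P (n / M)).J) (ξ : E d),
      ξ ∈ (P (n / M)).cell j := by
    intro n hn
    rw [hn, hP0]
    exact fun _ _ => Set.mem_univ _
  have htriv' : ∀ n : ℕ, n / M = 0 → Nonempty (Fin (P (n / M)).J) := by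
    intro n hn
    rw [hn, hP0]
    exact ⟨(0 : Fin 1)⟩
  have hscale : ∀ n : ℕ, n / M ≠ 0 → 1 ≤ Real.sinh ((n / M * M : ℕ) * R) ∧
      1 ≤ Real.sinh (n * R) / Real.sinh ((n / M * M : ℕ) * R) ∧
      Real.sinh (n * R) / Real.sinh ((n / M * M : ℕ) * R) ≤ 2 * Real.exp (M * R) := by
    intro n hn
    have hn1 : 1 ≤ n / M := Nat.one_le_iff_ne_zero.2 hn
    have h1 : (M : ℝ) ≤ (n / M * M : ℕ) := by
      exact_mod_cast Nat.le_mul_of_pos_left M hn1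
    have h2 : ((n / M * M : ℕ) : ℝ) ≤ n := by exact_mod_cast Nat.div_mul_le_self n M
    have h3 : (n : ℝ) ≤ (n / M * M : ℕ) + M := by
      exact_mod_cast (Nat.lt_div_mul_add hM).le
    have h4 : 1 ≤ Real.sinh ((n / M * M : ℕ) * R) :=
      ((Real.one_le_cosh δ).trans hMR).trans (Real.sinh_le_sinh.2 (by gcongr))
    refine ⟨h4, ?_, ?_⟩
    · rw [one_le_div (by linarith)]
      exact Real.sinh_le_sinh.2 (by gcongr)
    · rw [div_le_iff₀ (by linarith)]
      refine le_trans (Real.sinh_le_sinh.2 ?_)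
        (sinh_add_le h4 (by positivity) (y := M * R) (by positivity))
      rw [← add_mul]
      gcongr
  -- On a sphere of radius `t`, `|1 - ⟨·, ·⟩|` is comparable with `t² ρ²` up to the height `1 - t²`.
  have hinner : ∀ (t : ℝ) (x ξ : E d), 0 ≤ t → t < 1 → ‖x‖ = 1 → ‖ξ‖ = 1 →
      t ^ 2 * rho x ξ ^ 2 ≤ ‖(1 - inner ℂ ((t : ℂ) • x) ((t : ℂ) • ξ) : ℂ)‖ ∧
      ‖(1 - inner ℂ ((t : ℂ) • x) ((t : ℂ) • ξ) : ℂ)‖ ≤ (1 - t ^ 2) + t ^ 2 * rho x ξ ^ 2 := by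
    intro t x ξ h0 h1 hx hξ
    have hc : ‖(inner ℂ x ξ : ℂ)‖ ≤ 1 := (norm_inner_le_norm x ξ).trans_eq (by rw [hx, hξ, one_mul])
    rw [one_sub_smul_inner, rho_sq]
    exact ⟨mul_norm_one_sub_le hc (sq_nonneg _) (by nlinarith),
      norm_one_sub_mul_le _ (sq_nonneg _) (by nlinarith)⟩
  have hz : ∀ (n : ℕ) (j : Fin (P (n / M)).J),
      ‖((Real.tanh (n * R) : ℝ) : ℂ) • (P (n / M)).x j‖ = Real.tanh (n * R) := by
    intro n j
    rw [norm_smul, (P (n / M)).norm_x, mul_one, Complex.norm_real,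
      Real.norm_of_nonneg (tanh_nonneg (by positivity))]
  have hdirpos : ∀ n : ℕ, n / M ≠ 0 → 0 < Real.tanh (n * R) := by
    intro n hn
    have : 0 < n := by
      rcases Nat.eq_zero_or_pos n with rfl | h
      · simp at hn
      · exact h
    exact tanh_pos (by positivity)
  have hdir : ∀ (n : ℕ) (w : E d), 0 < Real.tanh (n * R) → ‖w‖ = Real.tanh (n * R) →
      ‖direction w‖ = 1 ∧ w = ((Real.tanh (n * R) : ℝ) : ℂ) • direction w := by
    intro n w hpos hw
    have hw0 : w ≠ 0 := norm_pos_iff.1 (hw ▸ hpos)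
    refine ⟨norm_direction hw0, ?_⟩
    rw [← hw, norm_smul_direction]
  let T : BergmanTree d R δ :=
    { J := fun n => (P (n / M)).J
      z := fun n j => ((Real.tanh (n * R) : ℝ) : ℂ) • (P (n / M)).x j
      Ω := fun n j => {w | ‖w‖ = Real.tanh (n * R) ∧ direction w ∈ (P (n / M)).cell j}
      z_mem := fun n j => mem_bergmanSphere.2 (hz n j)
      measurableSet_Ω := fun n j =>
        (measurableSet_eq_fun measurable_norm measurable_const).inter
          (measurable_direction ((P (n / M)).measurableSet_cell j))
      disjoint_Ω := fun n i j hij => Set.disjoint_left.2 fun w hi hj =>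
        Set.disjoint_left.1 ((P (n / M)).disjoint_cell hij) hi.2 hj.2
      iUnion_Ω := by
        intro n
        ext w
        rw [mem_bergmanSphere, Set.mem_iUnion]
        refine ⟨fun ⟨j, hj⟩ => hj.1, fun hw => ?_⟩
        by_cases hn : n / M = 0
        · obtain ⟨j⟩ := htriv' n hn
          exact ⟨j, hw, htriv n hn j _⟩
        · obtain ⟨j, hj⟩ := (P (n / M)).exists_mem _ (hdir n w (hdirpos n hn) hw).1
          exact ⟨j, hw, hj⟩
      ball_subset_Ω := by
        rintro n j w ⟨hwb, hws⟩
        have hw := mem_bergmanSphere.1 hws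
        refine ⟨hw, ?_⟩
        by_cases hn : n / M = 0
        · exact htriv n hn j _
        obtain ⟨hξ, hwe⟩ := hdir n w (hdirpos n hn) hw
        rw [mem_bergmanBall_of_norm_eq hδ (Real.tanh_lt_one (n * R)) (hz n j) hw, hwe] at hwb
        have ht := hdirpos n hn
        have h1 := (hinner _ _ _ ht.le (Real.tanh_lt_one (n * R))
          ((P (n / M)).norm_x j) hξ).1.trans_lt hwb
        refine (hP _ (Nat.one_le_iff_ne_zero.2 hn)).mem_cell j _ hξ ?_
        obtain ⟨hs1, hs2, -⟩ := hscale n hn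
        set s := Real.sinh ((n / M * M : ℕ) * R) with hs
        have hc := Real.one_le_cosh δ
        have hpos := one_sub_tanh_sq_pos (n * R)
        have e : Real.tanh (n * R) ^ 2 * rho ((P (n / M)).x j) (direction w) ^ 2 =
            (1 - Real.tanh (n * R) ^ 2) *
              (Real.sinh (n * R) ^ 2 * rho ((P (n / M)).x j) (direction w) ^ 2) := by
          rw [← mul_assoc, ← tanh_sq_eq]
        rw [e] at h1
        have h2 := lt_of_mul_lt_mul_left h1 hpos.le
        rw [one_le_div (by linarith)] at hs2
        have h3 : rho ((P (n / M)).x j) (direction w) ^ 2 < (2 * scale R δ M (n / M)) ^ 2 := by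
          have e : (2 * scale R δ M (n / M)) ^ 2 = 4 * Real.cosh δ ^ 2 / s ^ 2 := by
            rw [scale, ← hs]; ring
          rw [e, lt_div_iff₀ (by positivity)]
          have h4 : rho ((P (n / M)).x j) (direction w) ^ 2 * s ^ 2 ≤
              Real.sinh (n * R) ^ 2 * rho ((P (n / M)).x j) (direction w) ^ 2 := by
            rw [mul_comm]; gcongr
          nlinarith
        refine lt_of_pow_lt_pow_left₀ 2 ?_ h3
        rw [scale, ← hs]
        positivity
      Ω_subset_ball := by
        -- The first term of `V` serves the levels below `M`, where there is a single piece, and the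
        -- second one all other levels.
        set V := 2 * Real.cosh (M * R) ^ 2 + (1 + 64 * Real.exp (M * R) ^ 2 * Real.cosh δ ^ 2)
          with hV
        obtain ⟨C, hC, hCV⟩ := exists_cosh_gt hδ (V := V) (by positivity)
        refine ⟨C, hC, fun n j w hw => ⟨?_, mem_bergmanSphere.2 hw.1⟩⟩
        have hpos := one_sub_tanh_sq_pos (n * R)
        rw [mem_bergmanBall_of_norm_eq (by positivity) (Real.tanh_lt_one (n * R)) (hz n j) hw.1]
        by_cases hn : n / M = 0
        · have hnM : n < M := (Nat.div_eq_zero_iff_lt hM).1 hn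
          have h1 : ‖(1 - inner ℂ (((Real.tanh (n * R) : ℝ) : ℂ) • (P (n / M)).x j) w : ℂ)‖ ≤ 2 := by
            refine (norm_sub_le _ _).trans ?_
            have h2 := norm_inner_le_norm (𝕜 := ℂ)
              (((Real.tanh (n * R) : ℝ) : ℂ) • (P (n / M)).x j) w
            rw [hz, hw.1] at h2
            have := Real.tanh_sq_lt_one (n * R)
            rw [norm_one]
            nlinarith
          refine h1.trans_lt ?_
          rw [one_sub_tanh_sq, ← div_eq_inv_mul, lt_div_iff₀ (by have := Real.cosh_pos (n * R); positivity)]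
          have h3 : Real.cosh (n * R) ≤ Real.cosh (M * R) := by
            rw [Real.cosh_le_cosh, abs_of_nonneg (by positivity), abs_of_nonneg (by positivity)]
            gcongr
          have h4 : Real.cosh (n * R) ^ 2 ≤ Real.cosh (M * R) ^ 2 :=
            pow_le_pow_left₀ (Real.cosh_pos _).le h3 2
          have : 0 < 64 * Real.exp (M * R) ^ 2 * Real.cosh δ ^ 2 := by positivity
          linarith
        · have ht := hdirpos n hn
          obtain ⟨hξ, hwe⟩ := hdir n w ht hw.1
          conv_lhs => rw [hwe]
          refine (hinner _ _ _ ht.le (Real.tanh_lt_one (n * R)) ((P (n / M)).norm_x j)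
            hξ).2.trans_lt ?_
          have h1 := (hP _ (Nat.one_le_iff_ne_zero.2 hn)).rho_le j _ hw.2
          obtain ⟨hs1, -, hs2⟩ := hscale n hn
          set s := Real.sinh ((n / M * M : ℕ) * R) with hs
          have h2 : Real.sinh (n * R) * rho ((P (n / M)).x j) (direction w) ≤
              8 * Real.exp (M * R) * Real.cosh δ := by
            have hsn : 0 ≤ Real.sinh (n * R) := Real.sinh_nonneg_iff.2 (by positivity)
            have hc := Real.cosh_pos δ
            calc _ ≤ Real.sinh (n * R) * (4 * scale R δ M (n / M)) := by gcongr
              _ = 4 * (Real.sinh (n * R) / s) * Real.cosh δ := by rw [scale, ← hs]; ring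
              _ ≤ 4 * (2 * Real.exp (M * R)) * Real.cosh δ := by gcongr
              _ = _ := by ring
          have h3 : Real.sinh (n * R) ^ 2 * rho ((P (n / M)).x j) (direction w) ^ 2 ≤
              64 * Real.exp (M * R) ^ 2 * Real.cosh δ ^ 2 := by
            have h4 := pow_le_pow_left₀ (mul_nonneg
              (Real.sinh_nonneg_iff.2 (by positivity)) (rho_nonneg _ _)) h2 2
            calc _ = (Real.sinh (n * R) * rho ((P (n / M)).x j) (direction w)) ^ 2 := by ring
              _ ≤ _ := h4
              _ = _ := by ring
          have e : Real.tanh (n * R) ^ 2 * rho ((P (n / M)).x j) (direction w) ^ 2 =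
              (1 - Real.tanh (n * R) ^ 2) *
                (Real.sinh (n * R) ^ 2 * rho ((P (n / M)).x j) (direction w) ^ 2) := by
            rw [← mul_assoc, ← tanh_sq_eq]
          rw [e]
          have : 0 < Real.cosh (M * R) ^ 2 := pow_pos (Real.cosh_pos _) 2
          nlinarith }
  refine ⟨T, fun a ha ξ hξ h => ?_⟩
  have ht : 0 < Real.tanh (a.1 * R) := by
    have : (1 : ℝ) ≤ a.1 := by exact_mod_cast ha
    exact tanh_pos (by positivity)
  have h2 : direction (((Real.tanh (a.1 * R) : ℝ) : ℂ) • ξ) ∈ (P (a.1 / M)).cell a.2 := h.2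
  rw [direction_smul ht hξ] at h2
  rw [(P (a.1 / M)).pt_eq h2]
  exact direction_smul ht ((P (a.1 / M)).norm_x a.2)

namespace BergmanTree

variable {T : BergmanTree d R δ}

theorem z_mem_Ω (hδ : 0 < δ) (n : ℕ) (j : Fin (T.J n)) : T.z n j ∈ T.Ω n j := by
  refine T.ball_subset_Ω n j ⟨?_, T.z_mem n j⟩
  rw [mem_bergmanBall_of_norm_eq hδ (Real.tanh_lt_one (n * R)) (T.norm_z n j) (T.norm_z n j),
    inner_self_eq_norm_sq_to_K, T.norm_z]
  have h := one_sub_tanh_sq_pos (n * R)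
  have e : (1 - ((Real.tanh (n * R) : ℝ) : ℂ) ^ 2) = ((1 - Real.tanh (n * R) ^ 2 : ℝ) : ℂ) := by
    push_cast; rfl
  erw [e]
  rw [Complex.norm_real, Real.norm_of_nonneg h.le]
  have := Real.one_lt_cosh.2 hδ.ne'
  nlinarith

theorem eq_of_dir_eq (hδ : 0 < δ) {a b : T.Vertex} (hl : a.1 = b.1) (h : T.dir a = T.dir b) :
    a = b := by
  have hz : T.z a.1 a.2 = T.z b.1 b.2 := by rw [← tanh_smul_dir, ← tanh_smul_dir, h, hl]
  obtain ⟨n, i⟩ := a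
  obtain ⟨m, j⟩ := b
  obtain rfl : n = m := hl
  have h1 := z_mem_Ω hδ n i
  have h2 := z_mem_Ω hδ n j
  rw [show T.z n i = T.z n j from hz] at h1
  rw [eq_of_mem_Ω h1 h2]

theorem exists_ancestor (hR : 0 < R) (b : T.Vertex) {n : ℕ} (hn : n ≤ b.1) :
    ∃ a : T.Vertex, a.1 = n ∧ Relation.ReflTransGen T.IsChild a b := by
  induction hn using Nat.decreasingInduction with
  | self => exact ⟨b, rfl, .refl⟩
  | of_succ n _ ih =>
    obtain ⟨a, ha, hab⟩ := ih
    obtain ⟨j, hj⟩ := exists_parent hR ha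
    exact ⟨_, rfl, .head hj hab⟩

theorem exists_mem_kube (hR : 0 < R) {ζ : E d} (hζ : ζ ∈ unitBall d) :
    ∃ b : T.Vertex, ζ ∈ T.kube b := by
  have hζ1 := mem_unitBall.1 hζ
  have hζ0 := norm_nonneg ζ
  set y := Real.artanh ‖ζ‖ with hy
  have hty : Real.tanh y = ‖ζ‖ := Real.tanh_artanh ⟨by linarith, hζ1⟩
  have hy0 : 0 ≤ y := Real.artanh_nonneg hζ0
  set n := ⌊y / R⌋₊ with hn
  have h1 : n * R ≤ y := by
    rw [← le_div_iff₀ hR]; exact Nat.floor_le (by positivity)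
  have h2 : y < (n + 1) * R := by
    rw [← div_lt_iff₀ hR]; exact Nat.lt_floor_add_one _
  obtain ⟨j, hj⟩ := exists_mem_Ω (T := T) (n := n) (w := radialProj (n * R) ζ)
    (norm_radialProj (by positivity) (by
      rcases eq_or_ne ζ 0 with rfl | h
      · left
        have : y = 0 := by simp [hy]
        rw [hn, this]; simp
      · exact Or.inr h))
  refine ⟨⟨n, j⟩, mem_kube.2 ⟨?_, ?_, hj⟩⟩
  · rw [← hty]; exact tanh_le_tanh.2 h1
  · rw [← hty]; exact tanh_lt_tanh.2 h2

theorem eq_of_level_zero (hδ : 0 < δ) {a b : T.Vertex} (ha : a.1 = 0) (hb : b.1 = 0) : a = b := by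
  obtain ⟨n, i⟩ := a
  obtain ⟨m, j⟩ := b
  obtain rfl : n = 0 := ha
  obtain rfl : m = 0 := hb
  have hz : ∀ j, T.z 0 j = 0 := fun j => norm_eq_zero.1 (by rw [T.norm_z]; simp)
  have h1 := z_mem_Ω hδ 0 i
  have h2 := z_mem_Ω hδ 0 j
  rw [hz] at h1 h2
  rw [eq_of_mem_Ω h1 h2]

theorem unitBall_subset_tent (hR : 0 < R) (hδ : 0 < δ) {a : T.Vertex} (ha : a.1 = 0) :
    unitBall d ⊆ T.tent a := by
  intro ζ hζ
  obtain ⟨b, hb⟩ := exists_mem_kube (T := T) hR hζ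
  obtain ⟨a', ha', hab⟩ := exists_ancestor hR b (Nat.zero_le _)
  rw [eq_of_level_zero hδ ha' ha] at hab
  exact mem_tent.2 ⟨b, hab, hb⟩

/-- Following the ancestors of a kube that meets a small ball around `e`: above the partition `k`
their unit vectors drift by a geometric series, so that at partition `k` they lie in the cell
of `e`. -/
theorem exists_ancestor_of_rho_lt (hR : 0 < R) (hδ : 0 < δ) {M : ℕ} (hM : 0 < M)
    {P : ℕ → SpherePartition d} {r : ℕ → ℝ} (hP : ∀ k, 1 ≤ k → (P k).IsAdapted (r k))
    (hr : ∀ k, 1 ≤ k → 0 < r k ∧ r (k + 1) ≤ r k / 2)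
    (hT : ∀ a : T.Vertex, 1 ≤ a.1 → ∀ ξ : E d, ‖ξ‖ = 1 →
      ((Real.tanh (a.1 * R) : ℝ) : ℂ) • ξ ∈ T.Ω a.1 a.2 → T.dir a = (P (a.1 / M)).pt ξ)
    {k : ℕ} (hk : 1 ≤ k) {e : E d} (he : ‖e‖ = 1)
    (hcell : ∀ ξ : E d, ‖ξ‖ = 1 → rho e ξ < r k → (P k).pt ξ = (P k).pt e)
    {b : T.Vertex} (hb : (k + 1) * M ≤ b.1) {ξ : E d} (hξ : ‖ξ‖ = 1)
    (hbξ : ((Real.tanh (b.1 * R) : ℝ) : ℂ) • ξ ∈ T.Ω b.1 b.2)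
    (hsmall : rho e ξ + 8 * r (k + 1) < r k) :
    ∃ a : T.Vertex, a.1 = k * M ∧ T.dir a = (P k).pt e ∧ Relation.ReflTransGen T.IsChild a b := by
  have hkM : 1 ≤ k * M := Nat.mul_pos hk hM
  have hfix : ∀ a : T.Vertex, 1 ≤ a.1 → T.dir a = (P (a.1 / M)).pt (T.dir a) := fun a ha =>
    hT a ha _ (norm_dir hR ha) (by rw [tanh_smul_dir]; exact z_mem_Ω hδ _ _)
  -- Downward induction on the level: while the partition index exceeds `k` the ancestor stays within
  -- `8 r (n / M)` of `ξ`, and once the index is `k` it is the marked point of the cell of `e`.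
  have key : ∀ n, n ≤ b.1 → k * M ≤ n → ∃ a : T.Vertex, a.1 = n ∧
      Relation.ReflTransGen T.IsChild a b ∧
      ((k + 1) * M ≤ n → rho (T.dir a) ξ ≤ 8 * r (n / M)) ∧
      (n < (k + 1) * M → T.dir a = (P k).pt e) := by
    intro n hn
    induction hn using Nat.decreasingInduction with
    | self =>
      intro hkb
      refine ⟨b, rfl, .refl, fun _ => ?_, fun h => absurd hb (not_le.2 h)⟩
      have hg : 1 ≤ b.1 / M := (Nat.one_le_div_iff hM).2 (by nlinarith)
      rw [hT b (hkM.trans hkb) ξ hξ hbξ]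
      have := (hP _ hg).rho_pt_le hξ
      linarith [(hr _ hg).1]
    | of_succ n hn ih =>
      intro hkn
      obtain ⟨a', ha', hab, hfar, hnear⟩ := ih (by omega)
      obtain ⟨j, hj⟩ := exists_parent hR ha'
      have ha'1 : 1 ≤ a'.1 := by omega
      have hn1 : 1 ≤ n := by omega
      have hg : k ≤ n / M := (Nat.le_div_iff_mul_le hM).2 hkn
      have hg1 : 1 ≤ n / M := hk.trans hg
      have hdir : T.dir ⟨n, j⟩ = (P (n / M)).pt (T.dir a') :=
        hT ⟨n, j⟩ hn1 _ (norm_dir hR ha'1) ((isChild_iff hR).1 hj).2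
      have hfix' := hfix a' ha'1
      rw [ha'] at hfix'
      have hdiv : (n + 1) / M = n / M ∨ (n + 1) / M = n / M + 1 := by
        rw [Nat.succ_div]; split_ifs <;> simp
      refine ⟨⟨n, j⟩, rfl, .head hj hab, fun hle => ?_, fun hlt => ?_⟩
      · have h1 := hfar (by omega)
        rw [hdir]
        rcases hdiv with hg' | hg'
        · rw [hg'] at h1 hfix'
          rwa [← hfix']
        · rw [hg'] at h1
          have h2 := (hP _ hg1).rho_pt_le (norm_dir hR ha'1)
          have h3 := rho_triangle ((P (n / M)).norm_pt (norm_dir hR ha'1)).le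
            (norm_dir hR ha'1).le hξ.le
          have h4 := (hr _ hg1).2
          linarith
      · have hgk : n / M = k := by
          refine le_antisymm ?_ hg
          exact Nat.lt_succ_iff.1 ((Nat.div_lt_iff_lt_mul hM).2 hlt)
        rw [hdir, hgk]
        rcases lt_or_ge (n + 1) ((k + 1) * M) with hlt' | hge
        · have h1 := hnear hlt'
          have hg' : (n + 1) / M = k := by
            refine le_antisymm ?_ (hgk ▸ Nat.div_le_div_right (Nat.le_succ n))
            exact Nat.lt_succ_iff.1 ((Nat.div_lt_iff_lt_mul hM).2 hlt')
          rw [hg'] at hfix'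
          rw [← hfix', h1]
        · have h1 := hfar hge
          have hg' : (n + 1) / M = k + 1 := by
            have : n + 1 = (k + 1) * M := le_antisymm hlt hge
            rw [this, Nat.mul_div_cancel _ hM]
          rw [hg'] at h1
          refine hcell _ (norm_dir hR ha'1) ?_
          have h3 := rho_triangle he.le hξ.le (norm_dir hR ha'1).le
          rw [rho_comm ξ] at h3
          linarith
  have hlt : k * M < (k + 1) * M := by nlinarith
  obtain ⟨a, ha, hab, -, hnear⟩ := key (k * M) (hlt.le.trans hb) le_rfl
  exact ⟨a, ha, hnear hlt, hab⟩

end BergmanTree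

/-! ### Trees approximating all Carleson tents -/

theorem norm_le_of_mem_carlesonTent {z ζ : E d} (hz : z ≠ 0) (hζ : ζ ∈ carlesonTent z) :
    ‖z‖ ≤ ‖ζ‖ := by
  have h1 := ((mem_carlesonTent hz).1 hζ).2
  have h2 := norm_inner_le_norm (𝕜 := ℂ) (direction z) ζ
  rw [norm_direction hz, one_mul] at h2
  have h3 := norm_sub_norm_le (1 : ℂ) (inner ℂ (direction z) ζ)
  rw [norm_one] at h3
  linarith

theorem rho_direction_sq_le {z ζ : E d} (hz : 1 / 2 ≤ ‖z‖) (hζ : ζ ∈ carlesonTent z) :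
    rho (direction z) (direction ζ) ^ 2 ≤ 4 * (1 - ‖z‖) := by
  have hz0 : z ≠ 0 := norm_pos_iff.1 (by linarith)
  have hle := norm_le_of_mem_carlesonTent hz0 hζ
  obtain ⟨hb, h1⟩ := (mem_carlesonTent hz0).1 hζ
  have hb1 := mem_unitBall.1 hb
  have e : ((‖ζ‖ : ℝ) : ℂ) * (1 - inner ℂ (direction z) (direction ζ)) =
      (1 - inner ℂ (direction z) ζ) - ((1 - ‖ζ‖ : ℝ) : ℂ) := by
    conv_rhs => rw [← norm_smul_direction ζ, inner_smul_right]
    rw [norm_smul_direction]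
    push_cast
    ring
  have h2 := norm_sub_le (1 - inner ℂ (direction z) ζ : ℂ) ((1 - ‖ζ‖ : ℝ) : ℂ)
  rw [← e, norm_mul, Complex.norm_real, Complex.norm_real, Real.norm_of_nonneg (norm_nonneg _),
    Real.norm_of_nonneg (by linarith : (0 : ℝ) ≤ 1 - ‖ζ‖), ← rho_sq] at h2
  nlinarith [sq_nonneg (rho (direction z) (direction ζ))]

theorem le_nu_carlesonTent {z : E d} (hz : z ∈ unitBall d) :
    ENNReal.ofReal (((1 - ‖z‖) / 8) ^ (d + 1)) ≤ nu d (carlesonTent z) := by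
  have hz1 := mem_unitBall.1 hz
  rcases eq_or_ne z 0 with rfl | hz0
  · have : IsProbabilityMeasure (nu d) := isProbabilityMeasure_nu
    have h : nu d (carlesonTent (0 : E d)) = 1 := by
      rw [carlesonTent_zero]
      exact prob_compl_eq_zero_iff Metric.isOpen_ball.measurableSet |>.1 nu_compl_unitBall
    rw [h, norm_zero, sub_zero]
    refine ENNReal.ofReal_le_one.2 (pow_le_one₀ (by norm_num) (by norm_num))
  · refine (le_nu_setOf_norm_one_sub_inner_lt (norm_direction hz0) (by linarith)
      (by linarith [norm_nonneg z])).trans (measure_mono fun ζ hζ => ?_)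
    exact (mem_carlesonTent hz0).2 ⟨hζ.1, hζ.2.le⟩

theorem one_sub_tanh_sq_le {x y s : ℝ} (hy : 0 ≤ y) (hs : 0 ≤ s) (h : y ≤ x + s) :
    1 - Real.tanh x ^ 2 ≤ Real.exp s ^ 2 * (1 - Real.tanh y ^ 2) := by
  have h1 : Real.cosh y ≤ Real.exp s * Real.cosh x := by
    refine le_trans ?_ (cosh_add_le x hs)
    rw [Real.cosh_le_cosh, abs_of_nonneg hy]
    exact h.trans (le_abs_self _)
  have h2 := pow_le_pow_left₀ (Real.cosh_pos y).le h1 2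
  have hx := Real.cosh_pos x
  have hy := Real.cosh_pos y
  rw [one_sub_tanh_sq, one_sub_tanh_sq, ← div_eq_mul_inv, inv_eq_one_div, div_le_div_iff₀
    (by positivity) (by positivity)]
  linarith

theorem scale_pos (hR : 0 < R) {M k : ℕ} (hM : 0 < M) (hk : 1 ≤ k) : 0 < scale R δ M k := by
  have : 0 < k * M := Nat.mul_pos hk hM
  have h : (0 : ℝ) < (k * M : ℕ) := by exact_mod_cast this
  exact div_pos (Real.cosh_pos _) (Real.sinh_pos_iff.2 (by positivity))

theorem scale_le_one (hR : 0 < R) {M k : ℕ} (hk : 1 ≤ k)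
    (hMR : Real.cosh δ ≤ Real.sinh (M * R)) : scale R δ M k ≤ 1 := by
  have h : (M : ℝ) ≤ (k * M : ℕ) := by exact_mod_cast Nat.le_mul_of_pos_left M hk
  have h1 : Real.cosh δ ≤ Real.sinh ((k * M : ℕ) * R) :=
    hMR.trans (Real.sinh_le_sinh.2 (by gcongr))
  exact (div_le_one ((Real.cosh_pos δ).trans_le h1)).2 h1

theorem scale_succ_le (hR : 0 < R) {M k : ℕ} (hM : 0 < M) (hk : 1 ≤ k)
    (hexp : 16 ≤ Real.exp (M * R)) : 16 * scale R δ M (k + 1) ≤ scale R δ M k := by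
  have h : (0 : ℝ) < (k * M : ℕ) := by exact_mod_cast Nat.mul_pos hk hM
  have hs : 0 < Real.sinh ((k * M : ℕ) * R) := Real.sinh_pos_iff.2 (by positivity)
  have h1 : 16 * Real.sinh ((k * M : ℕ) * R) ≤ Real.sinh (((k + 1) * M : ℕ) * R) := by
    have e : (((k + 1) * M : ℕ) : ℝ) * R = (k * M : ℕ) * R + M * R := by push_cast; ring
    rw [e]
    refine le_trans ?_ (BergmanTree.exp_mul_sinh_le (by positivity))
    gcongr
  have hc := Real.cosh_pos δ
  rw [scale, scale, ← mul_div_assoc, div_le_div_iff₀ (by linarith) hs]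
  nlinarith

/-- The finitely many adjacent partitions of the sphere at each scale give finitely many Bergman
trees such that every Carleson tent lies in a dyadic tent whose level differs from the right one
by a bounded amount. -/
theorem exists_trees_subset (hd : 1 ≤ d) (hR : 0 < R) (hδ : 0 < δ) :
    ∃ (N : ℕ) (T : Fin N → BergmanTree d R δ) (s : ℝ), 0 ≤ s ∧ ∀ z ∈ unitBall d,
      ∃ (l : Fin N) (a : (T l).Vertex), carlesonTent z ⊆ (T l).tent a ∧
        Real.artanh ‖z‖ ≤ a.1 * R + s := by
  obtain ⟨N, hN⟩ := exists_adjacent_partitions d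
  obtain ⟨M, hM, hMR, hexp⟩ : ∃ M : ℕ, 0 < M ∧ Real.cosh δ ≤ Real.sinh (M * R) ∧
      16 ≤ Real.exp (M * R) := by
    obtain ⟨M, hM⟩ := exists_nat_gt ((17 + 2 * Real.cosh δ) / R)
    have hc := Real.one_le_cosh δ
    have h1 : 17 + 2 * Real.cosh δ < M * R := (div_lt_iff₀ hR).1 hM
    have h2 := Real.add_one_le_exp (M * R)
    have hM0 : 0 < M := by
      rcases Nat.eq_zero_or_pos M with rfl | h
      · simp at h1; linarith
      · exact h
    have h3 : Real.exp (-(M * R)) ≤ 1 := Real.exp_le_one_iff.2 (by linarith)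
    refine ⟨M, hM0, ?_, by linarith⟩
    rw [Real.sinh_eq]
    linarith
  have hx₀ : ‖(EuclideanSpace.single ⟨0, hd⟩ 1 : E d)‖ = 1 := by simp
  set x₀ : E d := EuclideanSpace.single ⟨0, hd⟩ 1
  have hpos : ∀ k, 1 ≤ k → 0 < scale R δ M k := fun k hk => scale_pos hR hM hk
  have hex : ∀ k : ℕ, ∃ P : Fin N → SpherePartition d,
      (k = 0 → ∀ l, P l = SpherePartition.trivial hx₀) ∧
      (1 ≤ k → (∀ l, (P l).IsAdapted (scale R δ M k)) ∧
        ∀ e : E d, ‖e‖ = 1 → ∃ l j, ∀ ξ : E d, ‖ξ‖ = 1 → rho e ξ < scale R δ M k →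
          ξ ∈ (P l).cell j) := by
    intro k
    rcases Nat.eq_zero_or_pos k with rfl | hk
    · exact ⟨fun _ => SpherePartition.trivial hx₀, fun _ _ => rfl, fun h => absurd h (by simp)⟩
    · obtain ⟨P, hP⟩ := hN _ (hpos k hk) (scale_le_one hR hk hMR)
      exact ⟨P, fun h => absurd h hk.ne', fun _ => hP⟩
  choose P hP0 hP using hex
  have htree : ∀ l : Fin N, ∃ T : BergmanTree d R δ, ∀ a : T.Vertex, 1 ≤ a.1 → ∀ ξ : E d, ‖ξ‖ = 1 →
      ((Real.tanh (a.1 * R) : ℝ) : ℂ) • ξ ∈ T.Ω a.1 a.2 → T.dir a = (P (a.1 / M) l).pt ξ :=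
    fun l => exists_tree hR hδ hM hMR (fun k => P k l) hx₀ (hP0 0 rfl l)
      fun k hk => (hP k hk).1 l
  choose T hT using htree
  refine ⟨N, T, 2 * (M * R), by positivity, fun z hz => ?_⟩
  have hz1 := mem_unitBall.1 hz
  set y := Real.artanh ‖z‖ with hy
  have hty : Real.tanh y = ‖z‖ := Real.tanh_artanh ⟨by linarith [norm_nonneg z], hz1⟩
  have hy0 : 0 ≤ y := Real.artanh_nonneg (norm_nonneg z)
  have hMR0 : 0 < M * R := by positivity
  set n := ⌊y / (M * R)⌋₊ with hn
  have h1 : n * (M * R) ≤ y := by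
    rw [← le_div_iff₀ hMR0]; exact Nat.floor_le (by positivity)
  have h2 : y < (n + 1) * (M * R) := by
    rw [← div_lt_iff₀ hMR0]; exact Nat.lt_floor_add_one _
  by_cases hn1 : n ≤ 1
  · obtain ⟨l, -, -⟩ := (hP 1 le_rfl).2 x₀ hx₀
    obtain ⟨j, -⟩ := BergmanTree.exists_mem_Ω (T := T l) (n := 0) (w := 0) (by simp)
    refine ⟨l, ⟨0, j⟩, ?_, ?_⟩
    · refine Set.Subset.trans (fun ζ hζ => ?_) (BergmanTree.unitBall_subset_tent hR hδ rfl)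
      rcases eq_or_ne z 0 with rfl | hz0
      · rwa [carlesonTent_zero] at hζ
      · exact ((mem_carlesonTent hz0).1 hζ).1
    · have : (n : ℝ) ≤ 1 := by exact_mod_cast hn1
      simp only [Nat.cast_zero, zero_mul, zero_add]
      nlinarith
  obtain ⟨k, hk⟩ : ∃ k, n = k + 1 := ⟨n - 1, by omega⟩
  have hk1 : 1 ≤ k := by omega
  rw [hk] at h1 h2
  have hr := hpos (k + 1) (by omega)
  have hsucc := scale_succ_le (δ := δ) hR hM hk1 hexp
  -- The size of the Carleson tent is at most the square of the scale of the partition `k + 1`.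
  have hsc : 1 ≤ scale R δ M (k + 1) * Real.cosh y := by
    have hsp : 0 < Real.sinh (((k + 1) * M : ℕ) * R) := Real.sinh_pos_iff.2 (by positivity)
    have h3 : Real.sinh (((k + 1) * M : ℕ) * R) ≤ Real.sinh y := by
      refine Real.sinh_le_sinh.2 (le_trans (le_of_eq ?_) h1)
      push_cast; ring
    have h4 := Real.sinh_lt_cosh y
    have h5 := Real.one_le_cosh δ
    rw [scale, div_mul_eq_mul_div, one_le_div hsp]
    nlinarith
  have hh : 1 - ‖z‖ ≤ scale R δ M (k + 1) ^ 2 := by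
    have h3 : 1 - ‖z‖ ≤ 1 - ‖z‖ ^ 2 := by nlinarith [norm_nonneg z]
    refine h3.trans ?_
    have hc := Real.cosh_pos y
    rw [← hty, one_sub_tanh_sq, inv_le_iff_one_le_mul₀ (by positivity), ← mul_pow]
    exact one_le_pow₀ hsc
  have hk16 : 16 * scale R δ M (k + 1) ≤ 1 := hsucc.trans (scale_le_one hR hk1 hMR)
  have hzh : 1 / 2 ≤ ‖z‖ := by nlinarith
  have hz0 : z ≠ 0 := norm_pos_iff.1 (by linarith)
  have he := norm_direction hz0
  obtain ⟨l, j, hlj⟩ := (hP k hk1).2 _ he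
  have hcell : ∀ ξ : E d, ‖ξ‖ = 1 → rho (direction z) ξ < scale R δ M k →
      (P k l).pt ξ = (P k l).pt (direction z) := by
    intro ξ hξ h
    rw [(P k l).pt_eq (hlj ξ hξ h),
      (P k l).pt_eq (hlj _ he (by rw [rho_self he]; exact hpos k hk1))]
  obtain ⟨i, hi⟩ := BergmanTree.exists_mem_Ω (T := T l) (n := k * M)
    (w := ((Real.tanh ((k * M : ℕ) * R) : ℝ) : ℂ) • direction z) (by
      rw [norm_smul, he, mul_one, Complex.norm_real,
        Real.norm_of_nonneg (tanh_nonneg (by positivity))])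
  have hdir := hT l ⟨k * M, i⟩ (Nat.mul_pos hk1 hM) _ he hi
  simp only [Nat.mul_div_cancel _ hM] at hdir
  refine ⟨l, ⟨k * M, i⟩, fun ζ hζ => ?_, ?_⟩
  · have hζz := norm_le_of_mem_carlesonTent hz0 hζ
    have hζ0 : ζ ≠ 0 := norm_pos_iff.1 (by linarith)
    have hζb := ((mem_carlesonTent hz0).1 hζ).1
    obtain ⟨b, hb⟩ := BergmanTree.exists_mem_kube (T := T l) hR hζb
    obtain ⟨-, hb2, hb3⟩ := BergmanTree.mem_kube.1 hb
    rw [radialProj_eq] at hb3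
    have hlev : (k + 1) * M ≤ b.1 := by
      rw [← Nat.lt_succ_iff]
      have h3 := hb2.trans_le' hζz
      rw [← hty, tanh_lt_tanh] at h3
      have h4 : ((k + 1 : ℕ) * M : ℝ) * R < (b.1 + 1) * R := by nlinarith
      have h5 := lt_of_mul_lt_mul_right h4 hR.le
      exact_mod_cast h5
    have hrho : rho (direction z) (direction ζ) ≤ 2 * scale R δ M (k + 1) := by
      refine le_of_sq_le_sq ?_ (by positivity)
      have := rho_direction_sq_le hzh hζ
      nlinarith
    obtain ⟨a, ha, had, hab⟩ := BergmanTree.exists_ancestor_of_rho_lt (T := T l) hR hδ hM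
      (P := fun k => P k l) (r := scale R δ M) (fun k hk => (hP k hk).1 l)
      (fun k hk => ⟨hpos k hk, by
        have := scale_succ_le (δ := δ) hR hM hk hexp
        have := hpos (k + 1) (by omega)
        linarith⟩) (hT l) hk1 he hcell hlev (norm_direction hζ0) hb3 (by linarith)
    have : a = ⟨k * M, i⟩ := BergmanTree.eq_of_dir_eq hδ ha (had.trans hdir.symm)
    rw [this] at hab
    exact BergmanTree.mem_tent.2 ⟨b, hab, hb⟩
  · push_cast at h2 ⊢
    linarith

theorem exists_approximatesCarlesonTents (hd : 1 ≤ d) (hR : 0 < R) (hδ : 0 < δ) :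
    ∃ (N : ℕ) (T : Fin N → BergmanTree d R δ), ApproximatesCarlesonTents (tents T) := by
  obtain ⟨N, T, s, hs, hT⟩ := exists_trees_subset (d := d) hd hR hδ
  choose D hD hDT using fun l => BergmanTree.exists_nu_tent_le hR hδ (T l)
  set S := ∑ l, D l with hS
  have hDS : ∀ l, D l ≤ S := fun l =>
    Finset.single_le_sum (fun i _ => (hD i).le) (Finset.mem_univ l)
  refine ⟨N, T, Real.toNNReal ((16 * S * Real.exp s ^ 2) ^ (d + 1)), fun z hz => ?_⟩
  have hz1 := mem_unitBall.1 hz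
  obtain ⟨l, a, hsub, ha⟩ := hT z hz
  refine ⟨_, ⟨l, a, rfl⟩, hsub, (hDT l a).trans ?_⟩
  refine le_trans ?_ (mul_le_mul_right (le_nu_carlesonTent hz) _)
  have h1 := one_sub_tanh_sq_le (Real.artanh_nonneg (norm_nonneg z)) hs ha
  rw [Real.tanh_artanh ⟨by linarith [norm_nonneg z], hz1⟩] at h1
  have h2 : 1 - ‖z‖ ^ 2 ≤ 2 * (1 - ‖z‖) := by nlinarith [norm_nonneg z]
  have hSp : 0 < S := (hD l).trans_le (hDS l)
  have h0 := one_sub_tanh_sq_pos (a.1 * R)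
  have he := Real.exp_pos s
  have h3 : D l * (1 - Real.tanh (a.1 * R) ^ 2) ≤
      (16 * S * Real.exp s ^ 2) * ((1 - ‖z‖) / 8) := by
    calc _ ≤ S * (Real.exp s ^ 2 * (2 * (1 - ‖z‖))) := by
          gcongr
          · exact hDS l
          · exact h1.trans (by gcongr)
      _ = _ := by ring
  have e : ((Real.toNNReal ((16 * S * Real.exp s ^ 2) ^ (d + 1)) : ℝ≥0) : ℝ≥0∞) =
      ENNReal.ofReal ((16 * S * Real.exp s ^ 2) ^ (d + 1)) := rfl
  rw [e, ← ENNReal.ofReal_mul (by positivity), ← mul_pow]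
  refine ENNReal.ofReal_le_ofReal (pow_le_pow_left₀ ?_ h3 _)
  exact mul_nonneg (hD l).le h0.le

end BergmanBump

theorem theorem2 (d : ℕ) (hd : 1 ≤ d) (R δ : ℝ) (hR : 0 < R) (hδ : 0 < δ) :
    (∃ (N : ℕ) (T : Fin N → BergmanBump.BergmanTree d R δ),
      BergmanBump.ApproximatesCarlesonTents (BergmanBump.tents T)) ∧
    ∀ (N : ℕ) (T : Fin N → BergmanBump.BergmanTree d R δ),
      BergmanBump.ApproximatesCarlesonTents (BergmanBump.tents T) →
      ∀ Φ Ψ : ℝ≥0 → ℝ≥0, BergmanBump.IsYoung Φ → BergmanBump.IsYoung Ψ →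
        BergmanBump.MaximalBounded Φ (BergmanBump.tents T) →
        BergmanBump.MaximalBounded Ψ (BergmanBump.tents T) →
        ∃ C : ℝ≥0, 0 < C ∧
          ∀ σ w : EuclideanSpace ℂ (Fin d) → ℝ≥0,
            BergmanBump.IsWeight σ → BergmanBump.IsWeight w →
            BergmanBump.opNorm σ w ≤ C * BergmanBump.bump (BergmanBump.tents T) Φ Ψ w σ := by
  refine ⟨BergmanBump.exists_approximatesCarlesonTents hd hR hδ,
    fun N T hT Φ Ψ _ _ hΦ hΨ => ?_⟩
  obtain ⟨K, hK⟩ := BergmanBump.exists_boundedBy hd hR hδ hT hΦ hΨ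
  -- `K + 1` instead of `K` makes the constant positive, so that an infinite bump gives no condition.
  refine ⟨K + 1, by positivity, fun σ w hσ hw => ?_⟩
  by_cases hb : BergmanBump.bump (BergmanBump.tents T) Φ Ψ w σ = ∞
  · rw [hb, ENNReal.mul_top (by simp)]
    exact le_top
  · refine (iInf₂_le _ (hK σ w hσ hw hb)).trans ?_
    rw [ENNReal.coe_mul, ENNReal.coe_toNNReal hb]
    gcongr
    simp
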